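/- Let $N,M\ge 0$, $\epsilon\in\{1,-1\}$, and let the indices $a=1,\dots,N+M$ carry degrees $[a]\in\mathbb Z/2$, with $N$ even and $M$ odd indices. Let $\varepsilon_{ab}\in\mathbb C$ be a super-metric: an invertible matrix with $\varepsilon_{ab}=\epsilon(-1)^{[a][b]}\varepsilon_{ba}$ and $\varepsilon_{ab}=0$ unless $[a]=[b]$. Let $\varepsilon^{ab}$ be its inverse matrix, raise indices by $z^a=\varepsilon^{ab}z_b$, and put $\omega=\epsilon(N-M)$. Summation over repeated indices is understood. Let $\mathcal A$ be the unital associative $\mathbb C$-algebra generated by $c^a$ with relations $c^ac^b+\epsilon(-1)^{[a][b]}c^bc^a=\varepsilon^{ab}$, $\mathbb Z/2$-graded by $\mathrm{grad}(c^a)=[a]$. Let $$c^{(a_1\dots a_k)}=c^{(a_1}\cdots c^{a_k)}=\frac1{k!}\sum_{\sigma\in S_k}s_\sigma\,c^{a_{\sigma(1)}}\cdots c^{a_{\sigma(k)}},$$ where $s_\sigma$ is the product of $-\epsilon(-1)^{[a_{\sigma(i)}][a_{\sigma(j)}]}$ over the inversions $i<j$, $\sigma(i)>\sigma(j)$. Put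 $F^{ab}=\epsilon(-1)^{[b]}c^{(a}c^{b)}$. Let $\mathcal Y$ be a $\mathbb Z/2$-graded unital associative $\mathbb C$-algebra with elements $G_{ab}$ that are generators of $osp$, i.e. $G_{ab}$ is homogeneous of degree $[a]+[b]$, $G_{ab}=-\epsilon(-1)^{[a][b]+[a]+[b]}G_{ba}$, and $$(-1)^{[c_1]([a_2]+[c_2])}[G^{a_1}{}_{c_1},G^{a_2}{}_{c_2}]_\pm=\epsilon(-1)^{[c_1][c_2]}\delta^{a_2}_{c_1}G^{a_1}{}_{c_2}-\epsilon(-1)^{[a_1][a_2]}\delta^{a_1}_{c_2}G^{a_2}{}_{c_1}+\epsilon(-1)^{[c_2]}\varepsilon^{a_1a_2}G_{c_2c_1}-\epsilon(-1)^{[a_2]}\varepsilon_{c_1c_2}G^{a_1a_2},$$ where $[X,Z]_\pm=XZ-(-1)^{\mathrm{grad}X\,\mathrm{grad}Z}ZX$. Suppose in addition that $$\{G_{(bc},G_{d)a}\}_\mp=0\quad\text{for all }a,b,c,d,$$ where $\{X,Z\}_\mp=XZ+(-1)^{\mathrm{grad}X\,\mathrm{grad}Z}ZX$ and $(bcd)$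 denotes super-symmetrisation over $b,c,d$ as above, but with the factor $-\epsilon(-1)^{[p][q]+[p]+[q]}$ for each inversion of indices $p,q$. In the graded tensor product $\mathcal A\otimes\mathcal A\otimes\mathcal Y$, with $c_1^a,F_1^{ab}$ in the first and $c_2^a,F_2^{ab}$ in the second factor, put $L_i(u)=u-\tfrac12F_i^{ab}\otimes G_{ba}$. For a complex sequence $(r_k)_{k\ge0}$ let $\check{\mathcal R}$ be the formal series $$\check{\mathcal R}=\sum_{k\ge0}\frac{r_k}{k!}\,\varepsilon_{a_1b_1}\cdots\varepsilon_{a_kb_k}\,c_1^{(a_1\dots a_k)}c_2^{(b_k\dots b_1)}$$ in the completion in which convergence means coefficientwise convergence with respect to the super-symmetrised monomials: a sequence tends to $0$ if, for every $d$, it eventually lies in the span of the elements $c_1^{(a_1\dots a_k)}c_2^{(b_1\dots b_l)}\otimes y$ with $k+l\ge d$. (Multiplication by elements of $\mathcal A\otimes\mathcal A\otimes\mathcal Y$ extends to such series.) Then: 1. Let $A,B$ be functions $\mathbb C\to\mathbb C$ and $$r_{2m}(u)=(-4)^m\frac{\Gamma(m-\frac u2)}{\Gamma(m+1+\frac{u-\omega}2)}A(u),\qquad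 r_{2m+1}(u)=(-4)^m\frac{\Gamma(m-\frac{u-1}2)}{\Gamma(m+1+\frac{u-\omega+1}2)}B(u),$$ where $1/\Gamma$ is the entire function. Let $u\in\mathbb C$ be such that $u\notin\{0,2,4,\dots\}$ or $A(u)=0$ (in which case $r_{2m}(u)$ means $0$ for all $m$), and $u\notin\{1,3,5,\dots\}$ or $B(u)=0$ (in which case $r_{2m+1}(u)$ means $0$ for all $m$). Then $$(k+2+u-\omega)\,r_{k+2}(u)=4(u-k)\,r_k(u)\qquad(k\ge0),$$ and, with $r_k=r_k(u)$ and $\check{\mathcal R}(u)=\check{\mathcal R}$, for all $v\in\mathbb C$ $$\check{\mathcal R}(u)L_1(u+v)L_2(v)=L_1(v)L_2(u+v)\check{\mathcal R}(u).$$ 2. More generally, for every $u\in\mathbb C$ and every sequence $(r_k)$ with $(k+2+u-\omega)r_{k+2}=4(u-k)r_k$ for all $k\ge0$, the series $\check{\mathcal R}(u)=\check{\mathcal R}$ satisfies the same relation for all $v\in\mathbb C$. 3. If $u\in\mathbb C$ is not a non-negative integer, a sequence satisfies this recurrence if and only if it is of the form in 1 for some values $A(u),B(u)\in\mathbb C$.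 -/

import Mathlib

open scoped TensorProduct

noncomputable section

namespace OSp

/-! ### Super-algebras: a parity involution and its eigenspaces -/

/-- The sign `(-1)^x` of a parity `x ∈ ℤ/2`, as a complex number. -/
def sgn (x : ZMod 2) : ℂ := if x = 0 then 1 else -1

theorem sgn_zero : sgn 0 = 1 := by simp [sgn]

theorem sgn_one : sgn 1 = -1 := by simp [sgn]

theorem zmod_two_cases (x : ZMod 2) : x = 0 ∨ x = 1 := by
  revert x
  decide

theorem sgn_add (x y : ZMod 2) : sgn (x + y) = sgn x * sgn y := by
  have h : (1 + 1 : ZMod 2) = 0 := rfl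
  rcases zmod_two_cases x with rfl | rfl <;> rcases zmod_two_cases y with rfl | rfl <;>
    simp [sgn_zero, sgn_one, h]

theorem sgn_mul_self (x : ZMod 2) : sgn x * sgn x = 1 := by
  rcases zmod_two_cases x with rfl | rfl <;> simp [sgn_zero, sgn_one]

/-- The `ℤ/2`-grading of an algebra attached to a parity automorphism `σ`: the elements of
degree `i` are those with `σ x = (-1)^i x`. -/
def parityGrading {A : Type*} [Ring A] [Algebra ℂ A] (σ : A →ₐ[ℂ] A) (i : ZMod 2) :
    Submodule ℂ A :=
  LinearMap.ker (σ.toLinearMap - sgn i • LinearMap.id)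

theorem mem_parityGrading {A : Type*} [Ring A] [Algebra ℂ A] (σ : A →ₐ[ℂ] A) (i : ZMod 2)
    (x : A) : x ∈ parityGrading σ i ↔ σ x = sgn i • x := by
  simp [parityGrading, sub_eq_zero]

theorem parityGrading_gradedMonoid {A : Type*} [Ring A] [Algebra ℂ A] (σ : A →ₐ[ℂ] A) :
    SetLike.GradedMonoid (parityGrading σ) where
  one_mem := by simp [mem_parityGrading, sgn_zero]
  mul_mem := by
    intro i j x y hx hy
    rw [mem_parityGrading] at *
    rw [map_mul, hx, hy, sgn_add, smul_mul_smul_comm]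

/-- The projection `x ↦ ½ (x + (-1)^i σ x)` onto the part of degree `i`. -/
def parityProj {A : Type*} [Ring A] [Algebra ℂ A] (σ : A →ₐ[ℂ] A)
    (hσ : ∀ x, σ (σ x) = x) (i : ZMod 2) : A →ₗ[ℂ] parityGrading σ i :=
  LinearMap.codRestrict (parityGrading σ i)
    ((1 / 2 : ℂ) • (LinearMap.id + sgn i • σ.toLinearMap)) (by
      intro x
      have h : sgn i • sgn i • σ x = σ x := by rw [smul_smul, sgn_mul_self, one_smul]
      simp only [mem_parityGrading, LinearMap.smul_apply, LinearMap.add_apply, LinearMap.id_apply,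
        AlgHom.toLinearMap_apply, map_smul, map_add, hσ]
      rw [smul_comm (sgn i), smul_add (sgn i), h, add_comm])

theorem coe_parityProj {A : Type*} [Ring A] [Algebra ℂ A] (σ : A →ₐ[ℂ] A)
    (hσ : ∀ x, σ (σ x) = x) (i : ZMod 2) (x : A) :
    (parityProj σ hσ i x : A) = (1 / 2 : ℂ) • (x + sgn i • σ x) := rfl

/-- An involutive automorphism makes an algebra `ℤ/2`-graded. -/
@[reducible]
def parityGradedAlgebra {A : Type*} [Ring A] [Algebra ℂ A] (σ : A →ₐ[ℂ] A)
    (hσ : ∀ x, σ (σ x) = x) : GradedAlgebra (parityGrading σ) :=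
  { parityGrading_gradedMonoid σ,
    DirectSum.Decomposition.ofLinearMap (parityGrading σ)
      (DirectSum.lof ℂ _ (fun i => parityGrading σ i) 0 ∘ₗ parityProj σ hσ 0 +
        DirectSum.lof ℂ _ (fun i => parityGrading σ i) 1 ∘ₗ parityProj σ hσ 1)
      (by
        ext x
        simp only [LinearMap.comp_apply, LinearMap.add_apply, map_add, LinearMap.id_apply,
          DirectSum.coeLinearMap_lof, coe_parityProj, sgn_zero, sgn_one]
        module)
      (by
        ext i y : 2
        obtain ⟨y, hy⟩ := y
        have hy' := (mem_parityGrading σ i y).1 hy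
        simp only [LinearMap.comp_apply, LinearMap.add_apply, LinearMap.id_apply,
          DirectSum.coeLinearMap_lof]
        rcases zmod_two_cases i with rfl | rfl
        · have h0 : parityProj σ hσ 0 y = ⟨y, hy⟩ := by
            ext
            rw [coe_parityProj, hy', sgn_zero]
            module
          have h1 : parityProj σ hσ 1 y = 0 := by
            ext
            rw [coe_parityProj, hy', sgn_zero, sgn_one, Submodule.coe_zero]
            module
          rw [h0, h1, map_zero, add_zero]
        · have h0 : parityProj σ hσ 1 y = ⟨y, hy⟩ := by
            ext
            rw [coe_parityProj, hy', sgn_one]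
            module
          have h1 : parityProj σ hσ 0 y = 0 := by
            ext
            rw [coe_parityProj, hy', sgn_zero, sgn_one, Submodule.coe_zero]
            module
          rw [h0, h1, map_zero, zero_add]) with }

/-- The total parity automorphism `σ ⊗ τ` of a graded tensor product of two super-algebras. -/
def tensorParity {A B : Type*} [Ring A] [Algebra ℂ A] [Ring B] [Algebra ℂ B]
    (σ : A →ₐ[ℂ] A) (τ : B →ₐ[ℂ] B)
    [GradedAlgebra (parityGrading σ)] [GradedAlgebra (parityGrading τ)] :
    (parityGrading σ ᵍ⊗[ℂ] parityGrading τ) →ₐ[ℂ] (parityGrading σ ᵍ⊗[ℂ] parityGrading τ) :=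
  GradedTensorProduct.lift (parityGrading σ) (parityGrading τ)
    ((GradedTensorProduct.includeLeft _ _).comp σ)
    ((GradedTensorProduct.includeRight _ _).comp τ) (by
      intro i j a b
      have ha := (mem_parityGrading σ i a).1 a.2
      have hb := (mem_parityGrading τ j b).1 b.2
      simp only [AlgHom.comp_apply, ha, hb, map_smul, smul_mul_smul_comm,
        GradedTensorProduct.includeLeft_apply, GradedTensorProduct.includeRight_apply]
      rw [GradedTensorProduct.tmul_one_mul_one_tmul,
        GradedTensorProduct.tmul_coe_mul_coe_tmul, smul_comm, smul_smul, Int.units_mul_self,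
        one_smul, one_mul, mul_one, mul_comm (sgn i)])

theorem tensorParity_tmul {A B : Type*} [Ring A] [Algebra ℂ A] [Ring B] [Algebra ℂ B]
    (σ : A →ₐ[ℂ] A) (τ : B →ₐ[ℂ] B)
    [GradedAlgebra (parityGrading σ)] [GradedAlgebra (parityGrading τ)] (a : A) (b : B) :
    tensorParity σ τ (a ᵍ⊗ₜ[ℂ] b) = (σ a) ᵍ⊗ₜ[ℂ] (τ b) := by
  simp [tensorParity, GradedTensorProduct.tmul_one_mul_one_tmul]

theorem tensorParity_invol {A B : Type*} [Ring A] [Algebra ℂ A] [Ring B] [Algebra ℂ B]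
    (σ : A →ₐ[ℂ] A) (τ : B →ₐ[ℂ] B)
    [GradedAlgebra (parityGrading σ)] [GradedAlgebra (parityGrading τ)]
    (hσ : ∀ x, σ (σ x) = x) (hτ : ∀ x, τ (τ x) = x)
    (x : parityGrading σ ᵍ⊗[ℂ] parityGrading τ) : tensorParity σ τ (tensorParity σ τ x) = x := by
  have h : (tensorParity σ τ).comp (tensorParity σ τ) = AlgHom.id ℂ _ := by
    ext y
    · simp [tensorParity_tmul, hσ]
    · simp [tensorParity_tmul, hτ]
  exact congrArg (fun f => f x) h

/-! ### The super-metric -/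

/-- The indices of the superspace with `N` even and `M` odd coordinates. -/
abbrev Idx (N M : ℕ) : Type := Fin N ⊕ Fin M

/-- The degree `[a]` of an index. -/
def deg {N M : ℕ} : Idx N M → ZMod 2 := Sum.elim (fun _ => 0) (fun _ => 1)

/-- A super-metric `ε_{ab}` with `ε_{ab} = ϵ (-1)^{[a][b]} ε_{ba}`, which is even and
non-degenerate. -/
structure SuperMetric (N M : ℕ) (ϵ : ℤˣ) where
  /-- the metric `ε_{ab}` with lower indices -/
  low : Matrix (Idx N M) (Idx N M) ℂ
  symm : ∀ a b, low a b = ((ϵ : ℤ) : ℂ) * sgn (deg a * deg b) * low b a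
  even : ∀ a b, deg a ≠ deg b → low a b = 0
  nondeg : IsUnit low.det

namespace SuperMetric

variable {N M : ℕ} {ϵ : ℤˣ} (E : SuperMetric N M ϵ)

/-- The sign `ϵ = ±1` as a complex number. -/
def eps (_E : SuperMetric N M ϵ) : ℂ := ((ϵ : ℤ) : ℂ)

/-- `ε^{ab}`: the inverse matrix of the metric. -/
def up : Matrix (Idx N M) (Idx N M) ℂ := E.low⁻¹

/-- `ω = ϵ (N - M)`. -/
def omega (_E : SuperMetric N M ϵ) : ℂ := ((ϵ : ℤ) : ℂ) * ((N : ℂ) - (M : ℂ))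

theorem up_even (a b : Idx N M) (h : deg a ≠ deg b) : E.up a b = 0 := by
  have hu := E.nondeg
  let D : Matrix (Idx N M) (Idx N M) ℂ := Matrix.diagonal fun a => sgn (deg a)
  have hDD : D * D = 1 := by
    simp only [D, Matrix.diagonal_mul_diagonal, sgn_mul_self, Matrix.diagonal_one]
  have hD : D⁻¹ = D := Matrix.inv_eq_left_inv hDD
  have hl : D * E.low * D = E.low := by
    ext i j
    simp only [D, Matrix.diagonal_mul, Matrix.mul_diagonal]
    by_cases hij : deg i = deg j
    · rw [hij, mul_right_comm, sgn_mul_self, one_mul]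
    · rw [E.even i j hij]; simp
  have hup : D * E.up * D = E.up := by
    conv_rhs => rw [up, ← hl, Matrix.mul_inv_rev, Matrix.mul_inv_rev, hD, ← Matrix.mul_assoc]
    rfl
  have := congrFun (congrFun hup a) b
  simp only [D, Matrix.diagonal_mul, Matrix.mul_diagonal] at this
  rw [mul_right_comm, ← sgn_add] at this
  have h1 : deg a + deg b = 1 := by
    revert h
    generalize deg a = x
    generalize deg b = y
    revert x y
    decide
  rw [h1, sgn_one] at this
  linear_combination (-1 / 2 : ℂ) * this

/-! ### The algebra of super-oscillators -/

/-- The defining relations `c^a c^b + ϵ (-1)^{[a][b]} c^b c^a = ε^{ab}`. -/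
inductive OscRel : FreeAlgebra ℂ (Idx N M) → FreeAlgebra ℂ (Idx N M) → Prop
  | rel (a b : Idx N M) :
      OscRel
        (FreeAlgebra.ι ℂ a * FreeAlgebra.ι ℂ b +
          (E.eps * sgn (deg a * deg b)) • (FreeAlgebra.ι ℂ b * FreeAlgebra.ι ℂ a))
        (algebraMap ℂ _ (E.up a b))

/-- The super-oscillator algebra `𝒜`. -/
def Osc : Type := RingQuot E.OscRel

instance : Ring E.Osc := inferInstanceAs (Ring (RingQuot E.OscRel))

instance : Algebra ℂ E.Osc := inferInstanceAs (Algebra ℂ (RingQuot E.OscRel))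

/-- The super-oscillators `c^a`. -/
def c (a : Idx N M) : E.Osc := RingQuot.mkAlgHom ℂ E.OscRel (FreeAlgebra.ι ℂ a)

theorem c_rel (a b : Idx N M) :
    E.c a * E.c b + (E.eps * sgn (deg a * deg b)) • (E.c b * E.c a) =
      algebraMap ℂ E.Osc (E.up a b) := by
  have h := RingQuot.mkAlgHom_rel ℂ (OscRel.rel (E := E) a b)
  rw [map_add, map_mul, map_smul, map_mul, AlgHom.commutes] at h
  exact h

/-- The parity automorphism `c^a ↦ (-1)^{[a]} c^a` of `𝒜`. -/
def oscParity : E.Osc →ₐ[ℂ] E.Osc :=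
  RingQuot.liftAlgHom ℂ (s := E.OscRel)
    ⟨FreeAlgebra.lift ℂ fun a => sgn (deg a) • E.c a, by
      rintro _ _ ⟨a, b⟩
      simp only [map_add, map_mul, map_smul, FreeAlgebra.lift_ι_apply, AlgHom.commutes,
        smul_mul_smul_comm]
      rw [mul_comm (sgn (deg b)), smul_comm _ (sgn (deg a) * sgn (deg b)), ← smul_add, c_rel,
        ← sgn_add]
      by_cases h : deg a = deg b
      · rw [h, sgn_add, sgn_mul_self, one_smul]
      · rw [E.up_even a b h, map_zero, smul_zero]⟩

theorem oscParity_c (a : Idx N M) : E.oscParity (E.c a) = sgn (deg a) • E.c a := by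
  rw [oscParity, c]
  erw [RingQuot.liftAlgHom_mkAlgHom_apply]
  rw [FreeAlgebra.lift_ι_apply]
  rfl

theorem oscParity_invol (x : E.Osc) : E.oscParity (E.oscParity x) = x := by
  have h : E.oscParity.comp E.oscParity = AlgHom.id ℂ E.Osc := by
    apply RingQuot.ringQuot_ext' (S := ℂ) (s := E.OscRel)
    apply FreeAlgebra.hom_ext
    funext a
    change E.oscParity (E.oscParity (E.c a)) = E.c a
    rw [oscParity_c, map_smul, oscParity_c, smul_smul, sgn_mul_self, one_smul]
  exact congrArg (fun f => f x) h

/-- The `ℤ/2`-grading of `𝒜` in which `c^a` has degree `[a]`. -/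
abbrev oscGrading : ZMod 2 → Submodule ℂ E.Osc := parityGrading E.oscParity

instance : GradedAlgebra E.oscGrading := parityGradedAlgebra _ E.oscParity_invol

/-- The graded tensor product `𝒜 ⊗ 𝒜`. -/
abbrev Osc2 : Type := E.oscGrading ᵍ⊗[ℂ] E.oscGrading

/-- The total `ℤ/2`-grading of `𝒜 ⊗ 𝒜`. -/
abbrev osc2Grading : ZMod 2 → Submodule ℂ E.Osc2 :=
  parityGrading (tensorParity E.oscParity E.oscParity)

instance : GradedAlgebra E.osc2Grading :=
  parityGradedAlgebra _ (tensorParity_invol _ _ E.oscParity_invol E.oscParity_invol)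

/-- The two embeddings `x ↦ x ⊗ e` and `x ↦ e ⊗ x` of `𝒜` into `𝒜 ⊗ 𝒜`. -/
def leg (i : Fin 2) : E.Osc →ₐ[ℂ] E.Osc2 :=
  if i = 0 then GradedTensorProduct.includeLeft E.oscGrading E.oscGrading
  else GradedTensorProduct.includeRight E.oscGrading E.oscGrading

/-! ### Super-symmetrised products and the `osp` generators in `𝒜` -/

/-- The sign produced by reordering `c^{a_1} ⋯ c^{a_k}` into `c^{a_{σ(1)}} ⋯ c^{a_{σ(k)}}`: each
inversion of `σ` contributes `-ϵ (-1)^{[a][b]}`, with `a`, `b` the two indices involved. -/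
def reorderSign {k : ℕ} (a : Fin k → Idx N M) (σ : Equiv.Perm (Fin k)) : ℂ :=
  ∏ i : Fin k, ∏ j : Fin k,
    if i < j ∧ σ j < σ i then -E.eps * sgn (deg (a (σ i)) * deg (a (σ j))) else 1

/-- The super-symmetrised product `c^{(a_1} ⋯ c^{a_k)}`. -/
def symProd {k : ℕ} (a : Fin k → Idx N M) : E.Osc :=
  (1 / (k.factorial : ℂ)) •
    ∑ σ : Equiv.Perm (Fin k), E.reorderSign a σ • (List.ofFn fun i => E.c (a (σ i))).prod

/-- `F^{ab} = ϵ (-1)^{[b]} c^{(a} c^{b)}`. -/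
def F (a b : Idx N M) : E.Osc := (E.eps * sgn (deg b)) • E.symProd ![a, b]

/-- The invariants `ε_{a_1 b_1} ⋯ ε_{a_k b_k} c_1^{(a_1} ⋯ c_1^{a_k)} c_2^{(b_k} ⋯ c_2^{b_1)}`. -/
def invariant (k : ℕ) : E.Osc2 :=
  ∑ a : Fin k → Idx N M, ∑ b : Fin k → Idx N M,
    (∏ i, E.low (a i) (b i)) •
      (E.leg 0 (E.symProd a) * E.leg 1 (E.symProd fun i => b (Fin.rev i)))

/-! ### The generators `G` -/

variable {Y : Type*} [Ring Y] [Algebra ℂ Y]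

/-- `G^a_b = ε^{ac} G_{cb}`. -/
def raiseFst (G : Idx N M → Idx N M → Y) (a b : Idx N M) : Y := ∑ d, E.up a d • G d b

/-- `G^{ab} = ε^{ac} ε^{bd} G_{cd}`. -/
def raiseBoth (G : Idx N M → Idx N M → Y) (a b : Idx N M) : Y :=
  ∑ d, E.up b d • E.raiseFst G a d

/-- The family `G_{ab}` of elements of a super-algebra consists of generators of the Lie
superalgebra `osp`: `G_{ab}` has degree `[a]+[b]`, has the symmetry of an element of `osp`, and the
`G^a_b` satisfy the `osp` supercommutation relations. -/
structure IsOspGenerators (𝒴 : ZMod 2 → Submodule ℂ Y) (G : Idx N M → Idx N M → Y) : Prop where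
  homogeneous : ∀ a b, G a b ∈ 𝒴 (deg a + deg b)
  symmetry : ∀ a b,
    G a b + (E.eps * sgn (deg a * deg b + deg a + deg b)) • G b a = 0
  supercomm : ∀ a₁ c₁ a₂ c₂ : Idx N M,
    sgn (deg c₁ * (deg a₂ + deg c₂)) •
        (E.raiseFst G a₁ c₁ * E.raiseFst G a₂ c₂ -
          sgn ((deg a₁ + deg c₁) * (deg a₂ + deg c₂)) •
            (E.raiseFst G a₂ c₂ * E.raiseFst G a₁ c₁)) =
      (E.eps * sgn (deg c₁ * deg c₂) * (if a₂ = c₁ then 1 else 0)) • E.raiseFst G a₁ c₂ -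
      (E.eps * sgn (deg a₁ * deg a₂) * (if a₁ = c₂ then 1 else 0)) • E.raiseFst G a₂ c₁ +
      (E.eps * sgn (deg c₂) * E.up a₁ a₂) • G c₂ c₁ -
      (E.eps * sgn (deg a₂) * E.low c₁ c₂) • E.raiseBoth G a₁ a₂

/-- The super-anticommutator `{G_{ab}, G_{cd}}_∓`. -/
def superAnticomm (G : Idx N M → Idx N M → Y) (a b p q : Idx N M) : Y :=
  G a b * G p q + sgn ((deg a + deg b) * (deg p + deg q)) • (G p q * G a b)

/-- The sign of a reordering of the indices of `G`: each inversion contributes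
`-ϵ (-1)^{[a][b]+[a]+[b]}`. -/
def reorderSignG {k : ℕ} (a : Fin k → Idx N M) (σ : Equiv.Perm (Fin k)) : ℂ :=
  ∏ i : Fin k, ∏ j : Fin k,
    if i < j ∧ σ j < σ i then
      -E.eps * sgn (deg (a (σ i)) * deg (a (σ j)) + deg (a (σ i)) + deg (a (σ j)))
    else 1

/-- The constraint `{G_{(bc}, G_{d)a}}_∓ = 0`; the three super-symmetrised indices are
`b = x 0`, `c = x 1`, `d = x 2`. -/
def SymAnticommVanishes (G : Idx N M → Idx N M → Y) : Prop :=
  ∀ (x : Fin 3 → Idx N M) (a : Idx N M),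
    (1 / ((3).factorial : ℂ)) • ∑ σ : Equiv.Perm (Fin 3),
      E.reorderSignG x σ • superAnticomm G (x (σ 0)) (x (σ 1)) (x (σ 2)) a = 0

/-! ### The `L`-operators, the `R`-operator and the spinorial `RLL`-relation -/

variable (𝒴 : ZMod 2 → Submodule ℂ Y) [GradedAlgebra 𝒴]

/-- The graded tensor product `𝒜 ⊗ 𝒜 ⊗ Y`. -/
abbrev Osc2Y : Type _ := E.osc2Grading ᵍ⊗[ℂ] 𝒴

/-- `L_i(u) = u - ½ F_i^{ab} ⊗ G_{ba}`, where `i = 0` and `i = 1` stand for the first and the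
second factor `𝒜`. -/
def L (G : Idx N M → Idx N M → Y) (i : Fin 2) (u : ℂ) : E.Osc2Y 𝒴 :=
  u • (1 : E.Osc2Y 𝒴) -
    (1 / 2 : ℂ) • ∑ a : Idx N M, ∑ b : Idx N M,
      ((E.leg i (E.F a b)) ᵍ⊗ₜ[ℂ] (G b a) : E.Osc2Y 𝒴)

/-- The partial sums `∑_{k < K} (r_k / k!) ε_{a,b} c_1^{(a_1…a_k)} c_2^{(b_k…b_1)}` of the formal
series defining the `R`-operator. -/
def Rsum (r : ℕ → ℂ) (K : ℕ) : E.Osc2 :=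
  ∑ k ∈ Finset.range K, (r k / (k.factorial : ℂ)) • E.invariant k

/-- The span of the `c_1^{(a_1} ⋯ c_1^{a_k)} c_2^{(b_1} ⋯ c_2^{b_l)} ⊗ y` with `k + l ≥ d`. The
super-symmetrised monomials span `𝒜 ⊗ 𝒜` and, apart from the symmetries under permutations of the
indices, are linearly independent, so this is a separated decreasing filtration of `𝒜 ⊗ 𝒜 ⊗ Y`.
A formal series `∑ x_k` of super-symmetrised monomials of growing degrees is an element of the
completion. -/
def filtration (d : ℕ) : Submodule ℂ (E.Osc2Y 𝒴) :=
  Submodule.span ℂ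
    {z | ∃ (k l : ℕ) (a : Fin k → Idx N M) (b : Fin l → Idx N M) (y : Y), d ≤ k + l ∧
      z = ((E.leg 0 (E.symProd a) * E.leg 1 (E.symProd b)) ᵍ⊗ₜ[ℂ] y : E.Osc2Y 𝒴)}

/-- Convergence to zero of a sequence in `𝒜 ⊗ 𝒜 ⊗ Y`, coefficientwise with respect to the
super-symmetrised monomials: it eventually enters each step of the filtration. -/
def TendsToZero (x : ℕ → E.Osc2Y 𝒴) : Prop :=
  ∀ d : ℕ, ∃ K₀ : ℕ, ∀ K ≥ K₀, x K ∈ E.filtration 𝒴 d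

/-- The spinorial relation `R(u) L_1(u+v) L_2(v) = L_1(v) L_2(u+v) R(u)` for the formal series
`R(u) = ∑_k (r_k / k!) ε_{a,b} c_1^{(a_1…a_k)} c_2^{(b_k…b_1)}`. Multiplication by an element of
`𝒜 ⊗ 𝒜 ⊗ Y` on either side lowers the filtration by a bounded amount, hence both sides are the
limits of the corresponding expressions for the partial sums; when all products
`c^{(a_1} ⋯ c^{a_k)}` of large order vanish this is an identity in `𝒜 ⊗ 𝒜 ⊗ Y`. -/
def SpinorialRLL (G : Idx N M → Idx N M → Y) (r : ℕ → ℂ) (u v : ℂ) : Prop :=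
  E.TendsToZero 𝒴 fun K =>
    ((E.Rsum r K) ᵍ⊗ₜ[ℂ] (1 : Y) : E.Osc2Y 𝒴) * E.L 𝒴 G 0 (u + v) * E.L 𝒴 G 1 v -
      E.L 𝒴 G 0 v * E.L 𝒴 G 1 (u + v) * ((E.Rsum r K) ᵍ⊗ₜ[ℂ] (1 : Y) : E.Osc2Y 𝒴)

end SuperMetric

/-- The recurrence `r_{k+2} = 4 (u - k) / (k + 2 + u - ω) r_k`, with the denominator cleared. -/
def Recurrence (ω u : ℂ) (r : ℕ → ℂ) : Prop :=
  ∀ k : ℕ, ((k : ℂ) + 2 + u - ω) * r (k + 2) = 4 * (u - k) * r k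

/-- The coefficients
`r_{2m} = (-4)^m Γ(m - u/2) / Γ(m + 1 + (u-ω)/2) α` and
`r_{2m+1} = (-4)^m Γ(m - (u-1)/2) / Γ(m + 1 + (u-ω+1)/2) β`. (A pole of the denominator
gives the value `0`, in agreement with the entire function `1/Γ`.) -/
def gammaCoeff (ω u α β : ℂ) (k : ℕ) : ℂ :=
  if Even k then
    (-4) ^ (k / 2) *
      (Complex.Gamma (((k / 2 : ℕ) : ℂ) - u / 2) /
        Complex.Gamma (((k / 2 : ℕ) : ℂ) + 1 + (u - ω) / 2)) * α
  else
    (-4) ^ (k / 2) *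
      (Complex.Gamma (((k / 2 : ℕ) : ℂ) - (u - 1) / 2) /
        Complex.Gamma (((k / 2 : ℕ) : ℂ) + 1 + (u - ω + 1) / 2)) * β

end OSp

end

noncomputable section

namespace OSp

/-! Write s = ε_{ab} c_1^a c_2^b, X_i = F_i^{ab} G_{ba}, H = X_2 - X_1, and let [ , ], { , } be
ordinary commutators and anticommutators. Up to the sign χ_k = ∏_{i<k} (-ϵ)^i, the k-th invariant is
a polynomial J_k in s alone, with J_{k+1} = s J_k - κ_k J_{k-1} and κ_k = ϵ k (ω - k + 1)/4
(`invariant_eq`). So the whole relation is governed by commutation with s. Since X_1 + X_2 commutes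
with s (`commute_add`), the parameter v drops out, and the difference of the two sides of the
relation is ¼ ([R, X_1 X_2] - u {R, H}) (`rll_difference`).

The quadratic forms X_1, X_2 and the mixed form built from c_1 c_2 G span a space stable under
commutation with s, which gives [s, [s, H]] = 4ϵ H. The constraint on G enters only through
`row_anticomm`: it makes the mixed form have the same anticommutator with X_1 and with X_2. Together
with [X_1, X_2], computed from the osp relations, this yields [s, X_1 X_2] = {s, H} (`comm_mul`),
and then [J_k, X_1 X_2] = (ϵ/4) {s, [J_k, [s, H]]} by induction on k.

Let T_k be H with its two oscillators symmetrised around J_k (`twDiff`). Then {J_k, H} = 2 T_k + ½ϵ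
k(k-1) T_{k-2}, and the contribution of J_k to the difference is, up to the factor ¼, -2(u-k) T_k -
½ϵ k(k-1)(k+u-ω) T_{k-2} (`defect_eq`). With the weights r_k χ_k / k! the recurrence says exactly
that the T_k produced by k and by k+2 cancel (`sum_telescope`). A partial sum leaves only its last
two T's; as T_k consists of super-symmetrised monomials of degree 2k+2, the remainder tends to zero.

For the Gamma functions, the two-step recurrence splits into one first-order recurrence for each
parity. Away from non-negative integers u each of these has a one-dimensional solution space,
spanned by the quotient of Gamma functions (`eq_smul_gammaSeq`), even if its leading coefficient
vanishes somewhere. -/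

/-- The sign `(-1)^{[a][b]}` of exchanging two indices. -/
def ks {N M : ℕ} (a b : Idx N M) : ℂ := sgn (deg a * deg b)

/-! ### Exchange signs and the super-metric -/

section Signs

variable {N M : ℕ} (a b c d : Idx N M)

theorem ks_comm : ks a b = ks b a := by rw [ks, ks, mul_comm]

theorem ks_mul_self : ks a b * ks a b = 1 := sgn_mul_self _

theorem ks_self : ks a a = sgn (deg a) := by
  rw [ks]
  congr 1
  rcases zmod_two_cases (deg a) with h | h <;> rw [h] <;> rfl

theorem sgn_mul_add : sgn (deg a * (deg b + deg c)) = ks a b * ks a c := by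
  rw [mul_add, sgn_add, ks, ks]

variable {a b} in
theorem ks_congr_left (h : deg a = deg b) (c : Idx N M) : ks a c = ks b c := by
  rw [ks, ks, h]

variable {a b} in
theorem ks_congr_right (h : deg a = deg b) (c : Idx N M) : ks c a = ks c b := by
  rw [ks, ks, h]

end Signs

namespace SuperMetric

variable {N M : ℕ} {ϵ : ℤˣ} (E : SuperMetric N M ϵ)

theorem eps_mul_self : E.eps * E.eps = 1 := by
  have h : ((ϵ : ℤ) * (ϵ : ℤ)) = 1 := Int.units_coe_mul_self ϵ
  rw [eps, ← Int.cast_mul, h, Int.cast_one]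

/-- The sign `-ϵ (-1)^{[a][b]}` of exchanging two super-symmetrised indices. -/
def q (a b : Idx N M) : ℂ := -E.eps * ks a b

theorem q_comm (a b : Idx N M) : E.q a b = E.q b a := by rw [q, q, ks_comm]

theorem q_mul_self (a b : Idx N M) : E.q a b * E.q a b = 1 := by
  rw [q]
  linear_combination (ks a b * ks a b) * E.eps_mul_self + ks_mul_self a b

theorem q_congr_left {a b : Idx N M} (h : deg a = deg b) (c : Idx N M) : E.q a c = E.q b c := by
  rw [q, q, ks_congr_left h]

theorem q_congr_right {a b : Idx N M} (h : deg a = deg b) (c : Idx N M) : E.q c a = E.q c b := by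
  rw [q, q, ks_congr_right h]

/-- The form in which evenness of the metric is used throughout: either a term vanishes, or the two
degrees agree and one index may replace the other in every sign. -/
theorem low_eq_zero_or (a b : Idx N M) : E.low a b = 0 ∨ deg a = deg b :=
  or_iff_not_imp_right.2 (E.even a b)

theorem up_eq_zero_or (a b : Idx N M) : E.up a b = 0 ∨ deg a = deg b :=
  or_iff_not_imp_right.2 (E.up_even a b)

theorem low_symm (a b : Idx N M) : E.low a b = E.eps * ks a b * E.low b a := E.symm a b

theorem low_mul_up : E.low * E.up = 1 := Matrix.mul_nonsing_inv _ E.nondeg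

theorem up_mul_low : E.up * E.low = 1 := Matrix.nonsing_inv_mul _ E.nondeg

theorem sum_low_up (a c : Idx N M) :
    ∑ b, E.low a b * E.up b c = if a = c then 1 else 0 := by
  rw [← Matrix.mul_apply, low_mul_up, Matrix.one_apply]

theorem sum_up_low (a c : Idx N M) :
    ∑ b, E.up a b * E.low b c = if a = c then 1 else 0 := by
  rw [← Matrix.mul_apply, up_mul_low, Matrix.one_apply]

/-- The sign-twisted transpose of the inverse is again a right inverse of the metric, and the
inverse is unique. -/
theorem up_symm (a b : Idx N M) : E.up a b = E.eps * ks a b * E.up b a := by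
  have h : E.low * Matrix.of (fun a b => E.eps * ks a b * E.up b a) = 1 := by
    ext a c
    rw [Matrix.mul_apply, Matrix.one_apply]
    have : ∀ b, E.low a b * (Matrix.of (fun a b => E.eps * ks a b * E.up b a)) b c =
        E.up c b * E.low b a := by
      intro b
      rw [Matrix.of_apply, E.low_symm a b]
      rcases E.low_eq_zero_or b a with h | h
      · rw [h]; ring
      rcases E.up_eq_zero_or c b with h' | h'
      · rw [h']; ring
      rw [ks_congr_left h.symm b, ks_congr_right h' b]
      linear_combination (ks b b * ks b b * E.up c b * E.low b a) * E.eps_mul_self +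
        (E.up c b * E.low b a) * ks_mul_self b b
    rw [Finset.sum_congr rfl fun b _ => this b, sum_up_low]
    simp [eq_comm]
  have h' : E.up = Matrix.of (fun a b => E.eps * ks a b * E.up b a) :=
    Matrix.inv_eq_right_inv h
  exact congrFun (congrFun h' a) b

/-! ### Super-symmetrised products -/

/-- The sign of exchanging an index with a family of super-symmetrised indices. -/
def qprod (e : Idx N M) {k : ℕ} (a : Fin k → Idx N M) : ℂ := ∏ i, E.q e (a i)

/-- The sign of moving the index number `p` of a family to the front. -/
def frontSign {k : ℕ} (a : Fin (k + 1) → Idx N M) (p : Fin (k + 1)) : ℂ :=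
  ∏ l, if p.succAbove l < p then E.q (a p) (a (p.succAbove l)) else 1

/-- The family without its index number `p`. -/
def del {k : ℕ} (a : Fin (k + 1) → Idx N M) (p : Fin (k + 1)) : Fin k → Idx N M :=
  fun l => a (p.succAbove l)

theorem qprod_mul_self (e : Idx N M) {k : ℕ} (a : Fin k → Idx N M) :
    E.qprod e a * E.qprod e a = 1 := by
  rw [qprod, ← Finset.prod_mul_distrib]
  simp [q_mul_self]

theorem qprod_congr {e f : Idx N M} (h : deg e = deg f) {k : ℕ} (a : Fin k → Idx N M) :
    E.qprod e a = E.qprod f a := by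
  simp only [qprod, E.q_congr_left h]

theorem qprod_cons (e f : Idx N M) {k : ℕ} (a : Fin k → Idx N M) :
    E.qprod e (Fin.cons f a : Fin (k + 1) → Idx N M) = E.q e f * E.qprod e a := by
  simp [qprod, Fin.prod_univ_succ]

theorem qprod_snoc (e f : Idx N M) {k : ℕ} (a : Fin k → Idx N M) :
    E.qprod e (Fin.snoc a f : Fin (k + 1) → Idx N M) = E.q e f * E.qprod e a := by
  simp [qprod, Fin.prod_univ_castSucc, mul_comm]

theorem q_mul_qprod_del (e : Idx N M) {k : ℕ} (a : Fin (k + 1) → Idx N M) (p : Fin (k + 1)) :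
    E.q e (a p) * E.qprod e (del a p) = E.qprod e a := by
  rw [qprod, qprod, Fin.prod_univ_succAbove _ p]
  rfl

theorem frontSign_cons_zero (e : Idx N M) {k : ℕ} (a : Fin k → Idx N M) :
    E.frontSign (Fin.cons e a : Fin (k + 1) → Idx N M) 0 = 1 := by
  simp [frontSign]

theorem del_cons_zero (e : Idx N M) {k : ℕ} (a : Fin k → Idx N M) :
    del (Fin.cons e a : Fin (k + 1) → Idx N M) 0 = a := by
  funext l
  simp [del]

theorem frontSign_cons_succ (e : Idx N M) {k : ℕ} (a : Fin (k + 1) → Idx N M)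
    (j : Fin (k + 1)) :
    E.frontSign (Fin.cons e a : Fin (k + 2) → Idx N M) j.succ =
      E.q e (a j) * E.frontSign a j := by
  rw [frontSign, Fin.prod_univ_succ, q_comm]
  simp [frontSign]

theorem del_cons_succ (e : Idx N M) {k : ℕ} (a : Fin (k + 1) → Idx N M) (j : Fin (k + 1)) :
    del (Fin.cons e a : Fin (k + 2) → Idx N M) j.succ =
      (Fin.cons e (del a j) : Fin (k + 1) → Idx N M) := by
  funext l
  refine Fin.cases ?_ (fun l => ?_) l <;> simp [del]

theorem c_mul_c (a b : Idx N M) :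
    E.c a * E.c b = E.q a b • (E.c b * E.c a) + E.up a b • (1 : E.Osc) := by
  have h := E.c_rel a b
  rw [Algebra.algebraMap_eq_smul_one] at h
  rw [← h, q, ks]
  module

/-- The super-symmetrised product, defined by symmetrised multiplication with one generator
at a time. -/
def nested : (k : ℕ) → (Fin k → Idx N M) → E.Osc
  | 0, _ => 1
  | k + 1, a => (1 / 2 : ℂ) • (E.c (a 0) * nested k (Fin.tail a) +
      E.qprod (a 0) (Fin.tail a) • (nested k (Fin.tail a) * E.c (a 0)))

theorem nested_cons (e : Idx N M) {k : ℕ} (a : Fin k → Idx N M) :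
    E.nested (k + 1) (Fin.cons e a) = (1 / 2 : ℂ) • (E.c e * E.nested k a +
      E.qprod e a • (E.nested k a * E.c e)) := by
  simp [nested]

/-- The twisted commutator with `c e` is a twisted derivation sending each letter to its contraction
with `e`. In the induction, moving `c e` past the new letter `f` contracts once in each of the two
halves of the symmetrised product, giving ½ + ½; the signs agree because a non-zero `E.up e f`
forces equal degrees. -/
theorem nested_derivation (e : Idx N M) {k : ℕ} (a : Fin (k + 1) → Idx N M) :
    E.c e * E.nested (k + 1) a - E.qprod e a • (E.nested (k + 1) a * E.c e) =
      ∑ j, (E.frontSign a j * E.up e (a j)) • E.nested k (del a j) := by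
  induction k with
  | zero =>
    induction a using Fin.consCases with
    | _ f a =>
    rw [nested_cons, Fin.sum_univ_succ]
    have h : (1 / 2 : ℂ) • (E.c f + E.c f) = E.c f := by module
    simp only [nested, qprod, frontSign]
    simp only [Finset.univ_eq_empty, Finset.prod_empty, Finset.sum_empty, mul_one, one_mul,
      one_smul, Fin.prod_univ_succ, Fin.cons_zero, add_zero, h, E.c_mul_c e f]
    module
  | succ k ih =>
    induction a using Fin.consCases with
    | _ f b =>
    rw [Fin.sum_univ_succ]
    simp only [frontSign_cons_zero, del_cons_zero, frontSign_cons_succ, del_cons_succ,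
      Fin.cons_zero, Fin.cons_succ, nested_cons, qprod_cons]
    have hterm : ∀ j, (E.q f (b j) * E.frontSign b j * E.up e (b j)) • (1 / 2 : ℂ) •
        (E.c f * E.nested k (del b j) +
          E.qprod f (del b j) • (E.nested k (del b j) * E.c f)) =
        (E.q e f * (1 / 2)) • (E.c f * ((E.frontSign b j * E.up e (b j)) • E.nested k (del b j)))
        + (E.qprod f b * (1 / 2)) •
          (((E.frontSign b j * E.up e (b j)) • E.nested k (del b j)) * E.c f) := by
      intro j
      rw [← E.q_mul_qprod_del f b j]
      rcases E.up_eq_zero_or e (b j) with h | h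
      · simp [h]
      rw [E.q_congr_left h f, E.q_comm (b j) f]
      simp only [mul_smul_comm, smul_mul_assoc]
      module
    rw [Finset.sum_congr rfl fun j _ => hterm j, Finset.sum_add_distrib, ← Finset.smul_sum,
      ← Finset.smul_sum, ← Finset.mul_sum, ← Finset.sum_mul, ← ih]
    generalize E.nested (k + 1) b = Z
    have h1 : E.c e * (E.c f * Z) = E.q e f • (E.c f * (E.c e * Z)) + E.up e f • Z := by
      rw [← mul_assoc, c_mul_c, add_mul, smul_mul_assoc, smul_mul_assoc, one_mul, mul_assoc]
    have h2 : Z * E.c e * E.c f = E.q e f • (Z * E.c f * E.c e) + E.up e f • Z := by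
      rw [mul_assoc, c_mul_c, mul_add, mul_smul_comm, mul_smul_comm, mul_one, mul_assoc]
    simp only [mul_smul_comm, smul_mul_assoc, mul_add, add_mul, smul_add, smul_smul, mul_sub,
      sub_mul, smul_sub, h1, h2]
    simp only [← mul_assoc]
    rcases E.up_eq_zero_or e f with h | h
    · rw [h]
      module
    · rw [E.qprod_congr h b]
      have hq := E.qprod_mul_self f b
      match_scalars <;> first | ring1 | linear_combination (E.up e f / 2) * hq

/-- An Euler identity: every letter is brought to the front once. In the induction the contractions
created by exchanging the new letter with the others add up, by `nested_derivation`, to a twisted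
commutator, which turns the one unsymmetrised term into a symmetrised one. -/
theorem sum_frontSign_c_mul_nested {k : ℕ} (a : Fin (k + 1) → Idx N M) :
    ∑ p, E.frontSign a p • (E.c (a p) * E.nested k (del a p)) =
      ((k : ℂ) + 1) • E.nested (k + 1) a := by
  induction k with
  | zero =>
    induction a using Fin.consCases with
    | _ f a =>
    rw [nested_cons, Fin.sum_univ_succ]
    simp only [nested, qprod, frontSign]
    simp
    module
  | succ k ih =>
    induction a using Fin.consCases with
    | _ e b =>
    have hder := E.nested_derivation e b
    have hsum := ih b
    rw [Fin.sum_univ_succ]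
    simp only [frontSign_cons_zero, del_cons_zero, frontSign_cons_succ, del_cons_succ,
      Fin.cons_zero, Fin.cons_succ, nested_cons]
    have hterm : ∀ j, (E.q e (b j) * E.frontSign b j) • (E.c (b j) * (1 / 2 : ℂ) •
        (E.c e * E.nested k (del b j) +
          E.qprod e (del b j) • (E.nested k (del b j) * E.c e))) =
        (1 / 2 : ℂ) • (E.c e * (E.frontSign b j • (E.c (b j) * E.nested k (del b j))))
        - (1 / 2 : ℂ) • ((E.frontSign b j * E.up e (b j)) • E.nested k (del b j))
        + (E.qprod e b * (1 / 2)) •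
          ((E.frontSign b j • (E.c (b j) * E.nested k (del b j))) * E.c e) := by
      intro j
      have h1 : E.c e * (E.c (b j) * E.nested k (del b j)) =
          E.q e (b j) • (E.c (b j) * (E.c e * E.nested k (del b j))) +
            E.up e (b j) • E.nested k (del b j) := by
        rw [← mul_assoc, c_mul_c, add_mul, smul_mul_assoc, smul_mul_assoc, one_mul, mul_assoc]
      rw [← E.q_mul_qprod_del e b j]
      simp only [mul_smul_comm, smul_mul_assoc, mul_add, h1, mul_assoc]
      module
    rw [Finset.sum_congr rfl fun j _ => hterm j, Finset.sum_add_distrib,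
      Finset.sum_sub_distrib, ← Finset.smul_sum,
      ← Finset.smul_sum, ← Finset.smul_sum, ← Finset.mul_sum, ← Finset.sum_mul, ← hder, hsum]
    push_cast
    simp only [mul_smul_comm, smul_mul_assoc]
    module

/-! ### Expansion of the super-symmetrised product by its first letter -/

/-- The permutation with first value `p` and the remaining values ordered as by `τ`. -/
def consPerm {k : ℕ} (p : Fin (k + 1)) (τ : Equiv.Perm (Fin k)) : Equiv.Perm (Fin (k + 1)) :=
  Equiv.ofBijective (Fin.cons p fun i => p.succAbove (τ i)) (by
    rw [← Finite.injective_iff_bijective, Fin.cons_injective_iff]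
    refine ⟨?_, Fin.succAbove_right_injective.comp τ.injective⟩
    rintro ⟨i, hi⟩
    exact Fin.succAbove_ne p _ hi)

theorem consPerm_zero {k : ℕ} (p : Fin (k + 1)) (τ : Equiv.Perm (Fin k)) :
    consPerm p τ 0 = p := rfl

theorem consPerm_succ {k : ℕ} (p : Fin (k + 1)) (τ : Equiv.Perm (Fin k)) (i : Fin k) :
    consPerm p τ i.succ = p.succAbove (τ i) := rfl

theorem consPerm_bijective (k : ℕ) :
    Function.Bijective fun x : Fin (k + 1) × Equiv.Perm (Fin k) => consPerm x.1 x.2 := by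
  rw [Fintype.bijective_iff_injective_and_card]
  constructor
  · rintro ⟨p, τ⟩ ⟨p', τ'⟩ h
    have h0 : p = p' := congrArg (fun σ : Equiv.Perm (Fin (k + 1)) => σ 0) h
    subst h0
    have h1 : τ = τ' := by
      ext1 i
      exact Fin.succAbove_right_injective
        (congrArg (fun σ : Equiv.Perm (Fin (k + 1)) => σ i.succ) h)
    rw [h1]
  · rw [Fintype.card_prod, Fintype.card_perm, Fintype.card_perm, Fintype.card_fin,
      Fintype.card_fin, Nat.factorial_succ]

/-- The inversions at position 0 are the letters overtaken by number `p`; the others are those of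
`τ`, because `p.succAbove` is increasing. -/
theorem reorderSign_consPerm {k : ℕ} (a : Fin (k + 1) → Idx N M) (p : Fin (k + 1))
    (τ : Equiv.Perm (Fin k)) :
    E.reorderSign a (consPerm p τ) = E.frontSign a p * E.reorderSign (del a p) τ := by
  rw [reorderSign, Fin.prod_univ_succ]
  congr 1
  · rw [Fin.prod_univ_succ, frontSign]
    refine Eq.trans ?_ (Equiv.prod_comp τ _)
    simp [consPerm_zero, consPerm_succ, q, ks]
  · rw [reorderSign]
    refine Finset.prod_congr rfl fun i _ => ?_
    rw [Fin.prod_univ_succ]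
    simp [consPerm_succ, del]

/-- Grouping the permutations by their first letter gives the left side of
`sum_frontSign_c_mul_nested`, whose factor k + 1 is absorbed by the factorial. From here on only the
recursive form is needed. -/
theorem symProd_eq_nested {k : ℕ} (a : Fin k → Idx N M) : E.symProd a = E.nested k a := by
  induction k with
  | zero => simp [symProd, nested, reorderSign]
  | succ k ih =>
    have hk : (k.factorial : ℂ) ≠ 0 := Nat.cast_ne_zero.2 k.factorial_ne_zero
    have hk' : ((k : ℂ) + 1) ≠ 0 := Nat.cast_add_one_ne_zero k
    have hsum : ∀ b : Fin k → Idx N M, ∑ σ : Equiv.Perm (Fin k), E.reorderSign b σ •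
        (List.ofFn fun i => E.c (b (σ i))).prod = (k.factorial : ℂ) • E.nested k b := by
      intro b
      rw [← ih, symProd, smul_smul, mul_one_div_cancel hk, one_smul]
    rw [symProd, ← (consPerm_bijective k).sum_comp, Fintype.sum_prod_type]
    have hp : ∀ p : Fin (k + 1), ∑ τ : Equiv.Perm (Fin k), E.reorderSign a (consPerm p τ) •
        (List.ofFn fun i => E.c (a (consPerm p τ i))).prod =
        (k.factorial : ℂ) • (E.frontSign a p • (E.c (a p) * E.nested k (del a p))) := by
      intro p
      rw [smul_comm, ← mul_smul_comm, ← hsum, Finset.mul_sum, Finset.smul_sum]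
      refine Finset.sum_congr rfl fun τ _ => ?_
      rw [reorderSign_consPerm, List.ofFn_succ, List.prod_cons, mul_smul, mul_smul_comm]
      rfl
    rw [Finset.sum_congr rfl fun p _ => hp p, ← Finset.smul_sum, sum_frontSign_c_mul_nested,
      smul_smul, smul_smul, Nat.factorial_succ]
    have h1 : 1 / (((k + 1) * k.factorial : ℕ) : ℂ) * k.factorial * ((k : ℂ) + 1) = 1 := by
      push_cast
      field_simp
    rw [h1, one_smul]

theorem symProd_cons (e : Idx N M) {k : ℕ} (a : Fin k → Idx N M) :
    E.symProd (Fin.cons e a : Fin (k + 1) → Idx N M) = (1 / 2 : ℂ) • (E.c e * E.symProd a +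
      E.qprod e a • (E.symProd a * E.c e)) := by
  rw [symProd_eq_nested, symProd_eq_nested, nested_cons]

/-- Attaching `f` in front and `e` at the end are symmetrised multiplications which commute: the
contractions of `f` with `e` coming from the two sides cancel. -/
theorem symProd_snoc (e : Idx N M) {k : ℕ} (a : Fin k → Idx N M) :
    E.symProd (Fin.snoc a e : Fin (k + 1) → Idx N M) = (1 / 2 : ℂ) • (E.symProd a * E.c e +
      E.qprod e a • (E.c e * E.symProd a)) := by
  induction k with
  | zero =>
    have h : (Fin.snoc a e : Fin 1 → Idx N M) = Fin.cons e a := by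
      funext i
      rw [Fin.fin_one_eq_zero i]
      rfl
    rw [h, symProd_cons]
    simp [symProd_eq_nested, nested, qprod]
  | succ k ih =>
    induction a using Fin.consCases with
    | _ f b =>
    rw [← Fin.cons_snoc_eq_snoc_cons, symProd_cons, ih, symProd_cons, qprod_snoc, qprod_cons]
    generalize E.symProd b = Z
    have h1 : E.c f * (E.c e * Z) = E.q f e • (E.c e * (E.c f * Z)) + E.up f e • Z := by
      rw [← mul_assoc, c_mul_c, add_mul, smul_mul_assoc, smul_mul_assoc, one_mul, mul_assoc]
    have h2 : Z * E.c f * E.c e = E.q f e • (Z * E.c e * E.c f) + E.up f e • Z := by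
      rw [mul_assoc, c_mul_c, mul_add, mul_smul_comm, mul_smul_comm, mul_one, mul_assoc]
    simp only [mul_smul_comm, smul_mul_assoc, mul_add, add_mul, smul_add, smul_smul]
    simp only [mul_assoc] at h2 ⊢
    simp only [h1, h2, E.q_comm e f]
    rcases E.up_eq_zero_or f e with h | h
    · rw [h]
      match_scalars <;> ring1
    · rw [E.qprod_congr h b]
      match_scalars <;> ring1

end SuperMetric
/-- The coefficients of the three-term recurrence satisfied by the invariants. -/
def kap (e ω : ℂ) (k : ℕ) : ℂ := 1 / 4 * e * k * (ω - k + 1)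

theorem kap_zero (e ω : ℂ) : kap e ω 0 = 0 := by simp [kap]

theorem kap_mul_pow {e : ℂ} (he : e * e = 1) (ω : ℂ) (k : ℕ) :
    kap e ω k * (-e) ^ (k + 1) = kap e ω k * (-e) ^ (k - 1) := by
  rcases k with _ | k
  · rw [kap_zero, zero_mul, zero_mul]
  · rw [Nat.add_sub_cancel, pow_succ, pow_succ]
    linear_combination (kap e ω (k + 1) * (-e) ^ k) * he

/-! ### Linear recurrences behind symmetrised multiplication -/

section Sequences

variable {V : Type*} [AddCommGroup V] [Module ℂ V]

/-- The ansatz D_k = k m A_{k-1} is consistent because (k+1)(κ_k - e k/4) = k κ_{k+1}, which is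
where the shape of κ matters. The truncated index at k = 0 is harmless, as its coefficient vanishes.
-/
theorem difference_seq {e ω m n : ℂ} (hmn : m * n = e) (σ : V →ₗ[ℂ] V) (D A : ℕ → V)
    (hD : ∀ k, D (k + 1) = σ (D k) + m • A k - kap e ω k • D (k - 1))
    (hA : ∀ k, A (k + 1) = σ (A k) + (n / 4) • D k - kap e ω k • A (k - 1))
    (h0 : D 0 = 0) (k : ℕ) : D k = (k * m) • A (k - 1) := by
  suffices h : D k = (k * m) • A (k - 1) ∧ D (k + 1) = ((k + 1 : ℕ) * m) • A k from h.1
  induction k with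
  | zero =>
    have h1 := hD 0
    simp only [h0, kap_zero, map_zero, zero_add, zero_smul, sub_zero] at h1
    simp [h0, h1]
  | succ k ih =>
    refine ⟨ih.2, ?_⟩
    have h1 : σ (A k) = A (k + 1) - (n / 4) • D k + kap e ω k • A (k - 1) := by
      rw [hA]
      module
    rw [hD, ih.2, map_smul, h1, Nat.add_sub_cancel, ih.1]
    subst hmn
    simp only [kap]
    push_cast
    module

/-- The second-order analogue of `difference_seq`: `hT` is triangular, so T is determined by A, and
the two recurrences become a formula for D and one for σ on T. Each needs the other at smaller
indices, hence the joint induction. -/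
theorem quadratic_seq {e ω : ℂ} (σ : V →ₗ[ℂ] V) (D A T : ℕ → V)
    (hD : ∀ k, D (k + 1) = σ (D k) + (4 * e) • A k - kap e ω k • D (k - 1))
    (hA : ∀ k, A (k + 1) = σ (A k) + (1 / 4 : ℂ) • D k - kap e ω k • A (k - 1))
    (hT : ∀ k, A k = T k + (1 / 4 * e * k * (k - 1)) • T (k - 2))
    (h0 : D 0 = 0) (k : ℕ) :
    D (k + 1) = (4 * e * (k + 1)) • T k ∧
      σ (T k) = T (k + 1) + (1 / 4 * e * k * (ω - 1 - k)) • T (k - 1) := by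
  induction k using Nat.strong_induction_on with
  | _ k ih =>
  rcases k with _ | _ | k
  · have h1 := hD 0
    have h2 := hA 0
    have h3 := hT 0
    have h4 := hT 1
    simp only [h0, kap_zero, map_zero, zero_add, zero_smul, sub_zero, Nat.cast_zero, mul_zero,
      zero_mul, add_zero, Nat.cast_one, sub_self, smul_zero] at h1 h2 h3 h4
    simp [h1, h3, ← h4, h2]
  · have h1 := hD 1
    have h2 := hA 1
    have h3 := hT 0
    have h4 := hT 1
    have h5 := hT 2
    have i1 := (ih 0 (by simp)).1
    have i2 := (ih 0 (by simp)).2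
    simp only [Nat.cast_zero, mul_zero, zero_mul, zero_smul, add_zero, Nat.cast_one, sub_self,
      zero_add, Nat.sub_self, mul_one, Nat.cast_ofNat] at h1 h2 h3 h4 h5 i1 i2
    have hT2 : T 2 = σ (T 1) + e • T 0 - kap e ω 1 • T 0 - (1 / 4 * e * 2 * (2 - 1)) • T 0 := by
      rw [h4, i1, h3, h5] at h2
      rw [eq_sub_of_add_eq h2]
      module
    have hk : kap e ω 1 = 1 / 4 * e * ω := by simp [kap]
    constructor
    · norm_num at *
      rw [h1, i1, h4, map_smul, i2, h0, smul_zero]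
      module
    · norm_num at *
      rw [hT2, hk]
      module
  · have i0 := ih k (by omega)
    have i1 := ih (k + 1) (by omega)
    have h2 := hA (k + 2)
    have h3 := hT (k + 2)
    have h4 := hT (k + 3)
    have h5 := hT (k + 1)
    have h6 := hD (k + 2)
    simp only [Nat.add_sub_cancel, show k + 2 - 1 = k + 1 from rfl, show k + 1 + 1 = k + 2 from rfl,
      show k + 3 - 2 = k + 1 from rfl, show k + 1 - 2 = k - 1 by omega,
      show k + 2 + 1 = k + 3 from rfl] at *
    constructor
    · rw [h6, h3, i1.1, i0.1, map_smul, i1.2]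
      simp only [kap]
      push_cast
      module
    · rw [h3, map_add, map_smul, i0.2, i1.1, h5, h4] at h2
      have := eq_sub_of_add_eq h2
      rw [this]
      simp only [kap]
      push_cast
      module

end Sequences

/-! ### The invariants as polynomials in the first one -/

section Invariants

variable {R : Type*} [Ring R] [Algebra ℂ R]

/-- The polynomials in `s` defined by the recurrence `J_{k+1} = s J_k - κ_k J_{k-1}`. -/
def invPoly (e ω : ℂ) (s : R) : ℕ → R
  | 0 => 1
  | 1 => s
  | k + 2 => s * invPoly e ω s (k + 1) - kap e ω (k + 1) • invPoly e ω s k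

theorem invPoly_succ (e ω : ℂ) (s : R) (k : ℕ) :
    invPoly e ω s (k + 1) = s * invPoly e ω s k - kap e ω k • invPoly e ω s (k - 1) := by
  rcases k with _ | k
  · simp [invPoly, kap_zero]
  · rfl

theorem commute_invPoly (e ω : ℂ) {s z : R} (h : Commute z s) (k : ℕ) :
    Commute z (invPoly e ω s k) := by
  induction k using Nat.strong_induction_on with
  | _ k ih =>
  rcases k with _ | k
  · exact Commute.one_right z
  · rw [invPoly_succ]
    exact (h.mul_right (ih k (by omega))).sub_right ((ih (k - 1) (by omega)).smul_right _)

/-- The sum of the left and right products with the `k`-th invariant, twisted by signs. -/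
def twSum (e ω : ℂ) (s x : R) (k : ℕ) : R :=
  (1 / 2 : ℂ) • (x * invPoly e ω s k + (-e) ^ k • (invPoly e ω s k * x))

/-- As s commutes with J_k, the new factor s can stand on either side of the product; averaging both
placements leaves half of the commutator term `m • y`. This term has opposite signs for the left and
the right product, so the difference for x is coupled to the sum for y, and conversely. -/
theorem twisted_rec {e ω m : ℂ} (he : e * e = 1) {s x y : R}
    (h : x * s = (-e) • (s * x) + m • y) (k : ℕ) :
    (x * invPoly e ω s (k + 1) =
      (1 / 2 : ℂ) • (x * invPoly e ω s k * s + (-e) • (s * (x * invPoly e ω s k))) +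
        (m / 2) • (y * invPoly e ω s k) - kap e ω k • (x * invPoly e ω s (k - 1))) ∧
    ((-e) ^ (k + 1) • (invPoly e ω s (k + 1) * x) =
      (1 / 2 : ℂ) • ((-e) ^ k • (invPoly e ω s k * x) * s +
        (-e) • (s * ((-e) ^ k • (invPoly e ω s k * x)))) -
        (m / 2) • ((-e) ^ k • (invPoly e ω s k * y)) -
        kap e ω k • ((-e) ^ (k - 1) • (invPoly e ω s (k - 1) * x))) := by
  have hc : s * invPoly e ω s k = invPoly e ω s k * s := commute_invPoly e ω (Commute.refl s) k
  have hk := kap_mul_pow he ω k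
  constructor
  · have h1 : s * (x * invPoly e ω s k) =
        (-e) • (x * invPoly e ω s k * s) + (e * m) • (y * invPoly e ω s k) := by
      have : s * x = (-e) • (x * s) + (e * m) • y := by
        rw [h]
        match_scalars
        · linear_combination -he
        · ring
      rw [← mul_assoc, this, add_mul, smul_mul_assoc, smul_mul_assoc, mul_assoc, hc, mul_assoc]
    rw [invPoly_succ, h1, mul_sub, hc, ← mul_assoc, mul_smul_comm]
    match_scalars
    · linear_combination (-1 / 2 : ℂ) * he
    · ring
    · linear_combination (m / 2) * he
  · have h1 : invPoly e ω s k * x * s =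
        (-e) • (s * (invPoly e ω s k * x)) + m • (invPoly e ω s k * y) := by
      rw [mul_assoc, h, mul_add, mul_smul_comm, mul_smul_comm, ← mul_assoc, ← hc, mul_assoc]
    rw [invPoly_succ, sub_mul, smul_mul_assoc, smul_mul_assoc, h1, mul_assoc, mul_smul_comm]
    match_scalars
    · ring
    · linear_combination -hk
    · ring

/-- Twisted commutation acts on the k-th invariant like a derivative: it removes one oscillator pair
and leaves its partner y symmetrised with the invariant of order k - 1. `difference_seq` applies
because x and y play symmetric roles. -/
theorem twisted_difference {e ω m n : ℂ} (he : e * e = 1) (hmn : m * n = e) {s x y : R}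
    (hx : x * s = (-e) • (s * x) + m • y) (hy : y * s = (-e) • (s * y) + n • x) (k : ℕ) :
    x * invPoly e ω s k - (-e) ^ k • (invPoly e ω s k * x) =
      (k * m) • twSum e ω s y (k - 1) := by
  refine difference_seq (ω := ω) hmn
    ((1 / 2 : ℂ) • (LinearMap.mulRight ℂ s + (-e) • LinearMap.mulLeft ℂ s))
    (fun k => x * invPoly e ω s k - (-e) ^ k • (invPoly e ω s k * x)) (twSum e ω s y) ?_ ?_ ?_ k
  · intro k
    simp only [twSum, (twisted_rec he hx k).1, (twisted_rec he hx k).2, LinearMap.smul_apply,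
      LinearMap.add_apply, LinearMap.mulRight_apply, LinearMap.mulLeft_apply, sub_mul, mul_sub,
      mul_smul_comm, smul_mul_assoc]
    module
  · intro k
    simp only [twSum, (twisted_rec he hy k).1, (twisted_rec he hy k).2, LinearMap.smul_apply,
      LinearMap.add_apply, LinearMap.mulRight_apply, LinearMap.mulLeft_apply, add_mul, mul_add,
      mul_smul_comm, smul_mul_assoc]
    module
  · simp [invPoly]

end Invariants

/-! ### Supercommuting pairs of oscillator families -/

namespace SuperMetric

variable {N M : ℕ} {ϵ : ℤˣ} (E : SuperMetric N M ϵ)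

variable {R : Type*} [Ring R] [Algebra ℂ R]

/-- Two families of elements which satisfy the relations of the super-oscillators and
supercommute with each other. -/
structure IsOscPair (x y : Idx N M → R) : Prop where
  left : ∀ a b, x a * x b = E.q a b • (x b * x a) + E.up a b • (1 : R)
  right : ∀ a b, y a * y b = E.q a b • (y b * y a) + E.up a b • (1 : R)
  cross : ∀ a b, y b * x a = ks a b • (x a * y b)

/-- The contraction `ε_{ab} x^a y^b`. -/
def contract (x y : Idx N M → R) : R := ∑ a, ∑ b, E.low a b • (x a * y b)

theorem low_mul_q (a b f : Idx N M) :
    E.low a b * E.q f a * ks f b = -E.eps * E.low a b := by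
  rcases E.low_eq_zero_or a b with h | h
  · simp [h]
  · rw [ks_congr_right h.symm, q]
    linear_combination (-E.low a b * E.eps) * ks_mul_self f a

theorem sum_sum_low_smul_up {V : Type*} [AddCommGroup V] [Module ℂ V] (f : Idx N M)
    (v : Idx N M → V) : ∑ a, ∑ b, (E.up f a * E.low a b) • v b = v f := by
  rw [Finset.sum_comm]
  simp only [← Finset.sum_smul, sum_up_low, ite_smul, one_smul, zero_smul]
  simp

namespace IsOscPair

variable {E} {x y : Idx N M → R} (h : E.IsOscPair x y)

include h

theorem cross' (a b : Idx N M) : x a * y b = ks a b • (y b * x a) := by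
  rw [h.cross, smul_smul, ks_mul_self, one_smul]

theorem symm : E.IsOscPair y x where
  left := h.right
  right := h.left
  cross a b := by rw [h.cross', ks_comm]

theorem left_mul_contract (f : Idx N M) :
    x f * E.contract x y = (-E.eps) • (E.contract x y * x f) + (1 : ℂ) • y f := by
  have hterm : ∀ a b, x f * E.low a b • (x a * y b) =
      (-E.eps) • (E.low a b • (x a * y b) * x f) + (E.up f a * E.low a b) • y b := by
    intro a b
    rw [mul_smul_comm, ← mul_assoc, h.left, add_mul, smul_mul_assoc, smul_mul_assoc, one_mul,
      mul_assoc, h.cross', mul_smul_comm, smul_mul_assoc, ← mul_assoc, smul_add, smul_smul,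
      smul_smul, smul_smul, E.low_mul_q]
    module
  simp only [contract, Finset.mul_sum, hterm, Finset.sum_add_distrib, Finset.sum_mul,
    Finset.smul_sum, E.sum_sum_low_smul_up, one_smul]

/-- Exchanging the families costs only ϵ. Hence later lemmas take a constant m, equal to 1 for the
pair (x, y) and to ϵ for (y, x), and serve both orders. -/
theorem contract_swap : E.contract y x = E.eps • E.contract x y := by
  rw [contract, Finset.sum_comm, contract, Finset.smul_sum]
  refine Finset.sum_congr rfl fun a _ => ?_
  rw [Finset.smul_sum]
  refine Finset.sum_congr rfl fun b _ => ?_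
  rw [h.cross, E.low_symm b a, ks_comm b a]
  match_scalars
  linear_combination (E.eps * E.low a b) * ks_mul_self a b

theorem right_mul_contract (f : Idx N M) :
    y f * E.contract x y = (-E.eps) • (E.contract x y * y f) + E.eps • x f := by
  have h1 := h.symm.left_mul_contract f
  rw [h.contract_swap, mul_smul_comm, smul_mul_assoc] at h1
  have h2 := congrArg (fun z => E.eps • z) h1
  simp only [smul_smul, smul_add, E.eps_mul_self, one_smul] at h2
  rw [h2]
  match_scalars
  · linear_combination -E.eps * E.eps_mul_self
  · ring

end IsOscPair

/-- Transposing the second factor turns the sum into ϵ times the supertrace of the identity. -/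
theorem sum_low_mul_up : ∑ a, ∑ b, E.low a b * E.up a b = E.omega := by
  have h : ∀ a b, E.low a b * E.up a b = E.eps * sgn (deg a) * (E.low a b * E.up b a) := by
    intro a b
    rcases E.low_eq_zero_or a b with h | h
    · simp [h]
    · rw [E.up_symm a b, ← ks_congr_right h a, ks_self]
      ring
  simp only [h, ← Finset.mul_sum, sum_low_up]
  simp only [if_true, mul_one, ← Finset.mul_sum, Fintype.sum_sum_type]
  simp [deg, sgn_zero, sgn_one, omega, eps]
  ring

/-- The oscillator relation makes the contraction equal to minus itself plus ω. -/
theorem contract_self {x : Idx N M → R}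
    (h : ∀ a b, x a * x b = E.q a b • (x b * x a) + E.up a b • (1 : R)) :
    E.contract x x = (E.omega / 2) • (1 : R) := by
  have hterm : ∀ a b, E.low a b • (x a * x b) =
      (-1 : ℂ) • (E.low b a • (x b * x a)) + (E.low a b * E.up a b) • (1 : R) := by
    intro a b
    rw [h, E.low_symm b a, ks_comm b a, q]
    module
  have h1 : E.contract x x = (-1 : ℂ) • E.contract x x + E.omega • (1 : R) := by
    calc E.contract x x
        = ∑ a, ∑ b, ((-1 : ℂ) • (E.low b a • (x b * x a)) +
            (E.low a b * E.up a b) • (1 : R)) :=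
          Finset.sum_congr rfl fun a _ => Finset.sum_congr rfl fun b _ => hterm a b
      _ = _ := by
          simp only [Finset.sum_add_distrib, ← Finset.smul_sum, ← Finset.sum_smul,
            E.sum_low_mul_up]
          rw [Finset.sum_comm, contract]
  have h2 : E.omega • (1 : R) = E.contract x x - (-1 : ℂ) • E.contract x x :=
    eq_sub_of_add_eq' h1.symm
  rw [div_eq_inv_mul, mul_smul, h2]
  module

/-! ### Contractions around the invariants -/

/-- Pulling the right-hand oscillator through J_k leaves a plain contraction times J_k and a sum of
the other type at order k - 1. Thus the xy-sum and the xx-sum determine each other recursively and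
are found together. -/
theorem contract_invPoly_aux {x y : Idx N M → R} {s : R} {m : ℂ} (hm : m * m = 1)
    (hx : ∀ f, x f * s = (-E.eps) • (s * x f) + m • y f)
    (hy : ∀ f, y f * s = (-E.eps) • (s * y f) + (E.eps * m) • x f)
    (hxx : E.contract x x = (E.omega / 2) • (1 : R)) (hxy : E.contract x y = m • s) (k : ℕ) :
    ((-E.eps) ^ k • ∑ a, ∑ b, E.low a b • (x a * invPoly E.eps E.omega s k * y b) =
      m • (invPoly E.eps E.omega s (k + 1) -
        kap E.eps E.omega k • invPoly E.eps E.omega s (k - 1))) ∧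
    ((-E.eps) ^ k • ∑ a, ∑ b, E.low a b • (x a * invPoly E.eps E.omega s k * x b) =
      (E.omega / 2 - k) • invPoly E.eps E.omega s k) := by
  have he := E.eps_mul_self
  set J := invPoly E.eps E.omega s with hJ
  have hdx : ∀ k b, (-E.eps) ^ k • (J k * x b) =
      x b * J k - (k * m) • twSum E.eps E.omega s (y b) (k - 1) := by
    intro k b
    rw [← twisted_difference he (n := E.eps * m) (by linear_combination E.eps * hm) (hx b) (hy b)]
    simp [hJ]
  have hdy : ∀ k b, (-E.eps) ^ k • (J k * y b) =
      y b * J k - (k * (E.eps * m)) • twSum E.eps E.omega s (x b) (k - 1) := by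
    intro k b
    rw [← twisted_difference he (n := m) (by linear_combination E.eps * hm) (hy b) (hx b)]
    simp [hJ]
  -- One reduction step for both types: `v` is the family into which `twisted_difference` turns `u`.
  have hsum : ∀ (u v : Idx N M → R) (k : ℕ) (ν : ℂ),
      (∀ k b, (-E.eps) ^ k • (J k * u b) =
        u b * J k - (k * ν) • twSum E.eps E.omega s (v b) (k - 1)) →
      (-E.eps) ^ k • ∑ a, ∑ b, E.low a b • (x a * J k * u b) =
        E.contract x u * J k - (k * ν / 2) • (E.contract x v * J (k - 1) +
          (-E.eps) ^ (k - 1) • ∑ a, ∑ b, E.low a b • (x a * J (k - 1) * v b)) := by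
    intro u v k ν hu
    simp only [contract, Finset.sum_mul, Finset.smul_sum, ← Finset.sum_add_distrib,
      ← Finset.sum_sub_distrib]
    refine Finset.sum_congr rfl fun a _ => Finset.sum_congr rfl fun b _ => ?_
    rw [smul_comm, mul_assoc, ← mul_smul_comm, hu, twSum]
    simp only [mul_sub, mul_add, mul_smul_comm, smul_mul_assoc, mul_assoc]
    module
  rw [hsum y x k _ hdy, hsum x y k _ hdx, hxx, hxy]
  induction k with
  | zero =>
    simp [kap_zero, hJ, invPoly]
  | succ k ih =>
    rw [Nat.add_sub_cancel]
    have i1 := hsum y x k _ hdy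
    have i2 := hsum x y k _ hdx
    rw [hxx, hxy] at i1 i2
    -- The induction hypotheses are in reduced form; folding them back exhibits the sums of order k
    -- that occur in the goal.
    rw [← i1, ← i2] at ih
    rw [ih.1, ih.2]
    have hs : s * J k = J (k + 1) + kap E.eps E.omega k • J (k - 1) := by
      rw [hJ, invPoly_succ]
      module
    have hs' : s * J (k + 1) = J (k + 1 + 1) + kap E.eps E.omega (k + 1) • J k := by
      rw [hJ, invPoly_succ _ _ _ (k + 1), Nat.add_sub_cancel]
      module
    simp only [smul_mul_assoc, one_mul, hs, hs']
    simp only [kap]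
    push_cast
    constructor
    · module
    · match_scalars
      · linear_combination (-((k : ℂ) + 1)) * hm
      · linear_combination 0 * hm

theorem IsOscPair.contract_invPoly {E : SuperMetric N M ϵ} {x y : Idx N M → R}
    (h : E.IsOscPair x y) (k : ℕ) :
    (-E.eps) ^ k • ∑ a, ∑ b, E.low a b •
        (x a * invPoly E.eps E.omega (E.contract x y) k * y b) =
      invPoly E.eps E.omega (E.contract x y) (k + 1) -
        kap E.eps E.omega k • invPoly E.eps E.omega (E.contract x y) (k - 1) := by
  have h1 := (E.contract_invPoly_aux (m := 1) (by ring) h.left_mul_contract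
    (by simpa using h.right_mul_contract) (E.contract_self h.left) (by simp) k).1
  rwa [one_smul] at h1

theorem IsOscPair.contract_invPoly' {E : SuperMetric N M ϵ} {x y : Idx N M → R}
    (h : E.IsOscPair x y) (k : ℕ) :
    (-E.eps) ^ k • ∑ a, ∑ b, (E.low a b * ks a b) •
        (y b * invPoly E.eps E.omega (E.contract x y) k * x a) =
      invPoly E.eps E.omega (E.contract x y) (k + 1) -
        kap E.eps E.omega k • invPoly E.eps E.omega (E.contract x y) (k - 1) := by
  have he := E.eps_mul_self
  have h1 := (E.contract_invPoly_aux (m := E.eps) he h.right_mul_contract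
    (by simpa [he] using h.left_mul_contract) (E.contract_self h.right) h.contract_swap k).1
  have h2 : ∀ a b, E.low a b * ks a b = E.eps * E.low b a := by
    intro a b
    rw [E.low_symm a b]
    linear_combination (E.eps * E.low b a) * ks_mul_self a b
  simp only [h2, mul_smul, ← Finset.smul_sum]
  rw [Finset.sum_comm, smul_comm, h1, smul_smul, he, one_smul]

/-! ### Twice symmetrised multiplication of the invariants -/

/-- Symmetrised multiplication of the `k`-th invariant by two generators. -/
def twSum₂ (s : R) (x : Idx N M → R) (k : ℕ) (a b : Idx N M) : R :=
  (1 / 2 : ℂ) • (x a * twSum E.eps E.omega s (x b) k +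
    (E.q a b * (-E.eps) ^ k) • (twSum E.eps E.omega s (x b) k * x a))

/-- Compared with full symmetrisation, placing both oscillators on one side of J_k leaves half of a
second twisted difference. Applying `twisted_difference` twice gives the factor k(k-1) and turns
both x into y. -/
theorem anticomm_invPoly_aux {x y : Idx N M → R} {s : R} {m : ℂ} (hm : m * m = 1)
    (hx : ∀ f, x f * s = (-E.eps) • (s * x f) + m • y f)
    (hy : ∀ f, y f * s = (-E.eps) • (s * y f) + (E.eps * m) • x f)
    (hxy : ∀ a b, x a * y b = ks a b • (y b * x a)) (k : ℕ) (a b : Idx N M) :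
    x a * x b * invPoly E.eps E.omega s k +
        E.q a b • (invPoly E.eps E.omega s k * (x b * x a)) =
      (2 : ℂ) • E.twSum₂ s x k a b +
        (1 / 2 * k * (k - 1) * ks a b : ℂ) • E.twSum₂ s y (k - 2) b a := by
  have he := E.eps_mul_self
  have hd : ∀ k b, x b * invPoly E.eps E.omega s k -
      (-E.eps) ^ k • (invPoly E.eps E.omega s k * x b) =
      (k * m) • twSum E.eps E.omega s (y b) (k - 1) := fun k b =>
    twisted_difference he (by linear_combination E.eps * hm) (hx b) (hy b) k
  have hpow : ∀ k, (-E.eps) ^ k * (-E.eps) ^ k = (1 : ℂ) := by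
    intro k
    rw [← mul_pow, neg_mul_neg, he, one_pow]
  have h1 : x a * x b * invPoly E.eps E.omega s k +
        E.q a b • (invPoly E.eps E.omega s k * (x b * x a)) =
      (2 : ℂ) • E.twSum₂ s x k a b + (1 / 2 : ℂ) •
        (x a * (x b * invPoly E.eps E.omega s k -
            (-E.eps) ^ k • (invPoly E.eps E.omega s k * x b)) -
          (E.q a b * (-E.eps) ^ k) • ((x b * invPoly E.eps E.omega s k -
            (-E.eps) ^ k • (invPoly E.eps E.omega s k * x b)) * x a)) := by
    simp only [twSum₂, twSum, mul_sub, sub_mul, mul_add, add_mul, mul_smul_comm, smul_mul_assoc,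
      mul_assoc]
    match_scalars
    · ring
    · linear_combination (-E.q a b) * hpow k
    · ring
    · ring
  rw [h1, hd]
  rcases k with _ | k
  · simp
  congr 1
  have hq : E.q a b * (-E.eps) ^ (k + 1) = ks a b * (-E.eps) ^ k := by
    rw [q, pow_succ]
    linear_combination (ks a b * (-E.eps) ^ k) * he
  rw [hq, Nat.add_sub_cancel]
  have h2 : x a * twSum E.eps E.omega s (y b) k -
      (ks a b * (-E.eps) ^ k) • (twSum E.eps E.omega s (y b) k * x a) =
      (ks a b / 2) • (y b * (x a * invPoly E.eps E.omega s k -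
            (-E.eps) ^ k • (invPoly E.eps E.omega s k * x a)) +
          (ks a b * (-E.eps) ^ k) • ((x a * invPoly E.eps E.omega s k -
            (-E.eps) ^ k • (invPoly E.eps E.omega s k * x a)) * y b)) := by
    have h3 : ∀ z, x a * (y b * z) = ks a b • (y b * (x a * z)) := by
      intro z
      rw [← mul_assoc, hxy, smul_mul_assoc, mul_assoc]
    simp only [twSum, mul_sub, sub_mul, mul_add, add_mul, mul_smul_comm, smul_mul_assoc,
      mul_assoc, hxy, h3]
    match_scalars
    · ring
    · linear_combination (-(-E.eps) ^ k / 2) * ks_mul_self a b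
    · ring
    · linear_combination ((-E.eps) ^ k * (-E.eps) ^ k * ks a b / 2) * ks_mul_self a b
  rw [mul_smul_comm, smul_mul_assoc, smul_comm (ks a b * (-E.eps) ^ k), ← smul_sub, h2, hd]
  rcases k with _ | k
  · simp
  have hq' : ks a b * (-E.eps) ^ (k + 1) = E.q b a * (-E.eps) ^ k := by
    rw [q, pow_succ, ks_comm b a]
    ring
  rw [hq', show k + 1 + 1 - 2 = k from rfl, Nat.add_sub_cancel, twSum₂]
  simp only [mul_smul_comm, smul_mul_assoc]
  push_cast
  match_scalars
  · linear_combination (((k : ℂ) + 1 + 1) * (k + 1) * ks a b / 4) * hm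
  · linear_combination
      (((k : ℂ) + 1 + 1) * (k + 1) * ks a b * E.q b a * (-E.eps) ^ k / 4) * hm

end SuperMetric

/-! ### The osp relations and the constraint on symmetrised anticommutators -/

namespace SuperMetric

variable {N M : ℕ} {ϵ : ℤˣ} (E : SuperMetric N M ϵ)

variable {R : Type*} [Ring R] [Algebra ℂ R]

/-- The sign of exchanging two pairs of indices. -/
def ks₂ (a b c d : Idx N M) : ℂ := ks a c * ks a d * (ks b c * ks b d)

/-- The generators of `osp`, with the index-dependent signs absorbed, together with the
constraint on the symmetrised supercommutators. -/
structure IsOspFamily (g : Idx N M → Idx N M → R) : Prop where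
  symm : ∀ a b, g a b = E.q a b • g b a
  comm : ∀ a b c d, g a b * g c d - ks₂ a b c d • (g c d * g a b) =
    E.eps • (E.low c b • g a d + (E.q b c * E.low d b) • g a c + (E.q a b * E.low c a) • g b d +
      (E.q a b * E.q a c * E.low d a) • g b c)
  cyclic : ∀ a b c d,
    (g d c * g b a + ks₂ d c b a • (g b a * g d c)) +
      (E.q b d * E.q b c) • (g b d * g c a + ks₂ b d c a • (g c a * g b d)) +
      (E.q d b * E.q d c) • (g c b * g d a + ks₂ c b d a • (g d a * g c b)) = 0

/-- The signs of exchanging the elements `g_{ab}` with the elements `w^a`. -/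
def SuperCommutes (g : Idx N M → Idx N M → R) (w : Idx N M → R) : Prop :=
  ∀ a b c, g b c * w a = (ks a b * ks a c) • (w a * g b c)

/-- The contraction `w^b g_{ba}`. -/
def row (w : Idx N M → R) (g : Idx N M → Idx N M → R) (a : Idx N M) : R := ∑ b, w b * g b a

/-- The bilinear contraction `u^a v^b g_{ba}`. -/
def bil (u v : Idx N M → R) (g : Idx N M → Idx N M → R) : R := ∑ a, ∑ b, u a * v b * g b a

theorem eq_zero_of_eq_neg {V : Type*} [AddCommGroup V] [Module ℂ V] {t : V}
    (h : t = (-1 : ℂ) • t) : t = 0 := by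
  calc t = (1 / 2 : ℂ) • (t - (-1 : ℂ) • t) := by module
    _ = 0 := by rw [← h, sub_self, smul_zero]

theorem ks₂_comm (a b c d : Idx N M) : ks₂ a b c d = ks₂ c d a b := by
  rw [ks₂, ks₂, ks_comm a c, ks_comm a d, ks_comm b c, ks_comm b d]
  ring

theorem ks₂_swap (a b c d : Idx N M) : ks₂ a b c d = ks₂ b a c d := by
  rw [ks₂, ks₂]
  ring

theorem ks₂_eq_one {a b : Idx N M} (h : deg a = deg b) (c d : Idx N M) : ks₂ a b c d = 1 := by
  rw [ks₂, ks_congr_left h, ks_congr_left h]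
  linear_combination (ks b d * ks b d) * ks_mul_self b c + ks_mul_self b d

section Lemmas

variable {E} {g : Idx N M → Idx N M → R} {w : Idx N M → R}

/-- The metric and `g` have opposite graded symmetry. -/
theorem IsOspFamily.trace (hg : E.IsOspFamily g) : ∑ c, ∑ d, E.up c d • g d c = 0 := by
  apply eq_zero_of_eq_neg
  conv_lhs => rw [Finset.sum_comm]
  rw [Finset.smul_sum]
  refine Finset.sum_congr rfl fun c _ => ?_
  rw [Finset.smul_sum]
  refine Finset.sum_congr rfl fun d _ => ?_
  rw [E.up_symm d c, hg.symm c d, q, ks_comm d c]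
  match_scalars
  linear_combination (-E.up c d * ks c d * ks c d) * E.eps_mul_self - E.up c d * ks_mul_self c d

/-- The super-symmetrised product of three oscillators. -/
def sym₃ (E : SuperMetric N M ϵ) (w : Idx N M → R) (b c d : Idx N M) : R :=
  w b * w c * w d - (1 / 2 : ℂ) • (E.up b c • w d + (E.q b c * E.up b d) • w c + E.up c d • w b)

theorem sym₃_swap_left (hw : ∀ a b, w a * w b = E.q a b • (w b * w a) + E.up a b • (1 : R))
    (b c d : Idx N M) : E.sym₃ w c b d = E.q b c • E.sym₃ w b c d := by
  have h : E.up c b = -E.q b c * E.up b c := by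
    rw [E.up_symm c b, q, ks_comm c b]
    ring
  rw [sym₃, sym₃, hw c b, add_mul, smul_mul_assoc, smul_mul_assoc, one_mul, h, E.q_comm c b]
  match_scalars
  · ring
  · ring
  · ring
  · linear_combination (E.up b d / 2) * E.q_mul_self b c

theorem sym₃_swap_right (hw : ∀ a b, w a * w b = E.q a b • (w b * w a) + E.up a b • (1 : R))
    (b c d : Idx N M) : E.sym₃ w b d c = E.q c d • E.sym₃ w b c d := by
  have h : E.up d c = -E.q c d * E.up c d := by
    rw [E.up_symm d c, q, ks_comm d c]
    ring
  have h1 : E.q b d * E.up b c = E.q c d * E.up b c := by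
    rcases E.up_eq_zero_or b c with h | h
    · simp [h]
    · rw [E.q_congr_left h]
  have h2 : E.q b c * E.up b d = E.q c d * E.up b d := by
    rcases E.up_eq_zero_or b d with h | h
    · simp [h]
    · rw [E.q_congr_left h, E.q_comm]
  rw [sym₃, sym₃, mul_assoc, hw d c, mul_add, mul_smul_comm, mul_smul_comm, mul_one, h,
    E.q_comm d c, h1, h2, mul_assoc]
  match_scalars
  · ring
  · ring
  · linear_combination (E.up b d / 2) * E.q_mul_self c d
  · ring

theorem sum_rotate {V : Type*} [AddCommMonoid V] {ι : Type*} [Fintype ι] (f : ι → ι → ι → V) :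
    ∑ b, ∑ c, ∑ d, f c d b = ∑ b, ∑ c, ∑ d, f b c d := by
  rw [Finset.sum_comm]
  exact Finset.sum_congr rfl fun b _ => Finset.sum_comm

/-- Against a super-symmetric tensor the three terms of the constraint have equal sums, so three
times the sum vanishes. -/
theorem IsOspFamily.sum_sym₃_mul (hg : E.IsOspFamily g)
    (hw : ∀ a b, w a * w b = E.q a b • (w b * w a) + E.up a b • (1 : R)) (a : Idx N M) :
    ∑ b, ∑ c, ∑ d, E.sym₃ w b c d * (g d c * g b a + ks₂ d c b a • (g b a * g d c)) = 0 := by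
  set f : Idx N M → Idx N M → Idx N M → R :=
    fun b c d => E.sym₃ w b c d * (g d c * g b a + ks₂ d c b a • (g b a * g d c)) with hf
  have h1 : ∀ b c d, f b c d + f c d b + f d b c = 0 := by
    intro b c d
    have h := congrArg (fun z => E.sym₃ w b c d * z) (hg.cyclic a b c d)
    simp only [mul_zero] at h
    rw [← h]
    simp only [hf]
    rw [sym₃_swap_right hw c b d, sym₃_swap_left hw b c d, sym₃_swap_left hw b d c,
      sym₃_swap_right hw b c d, E.q_comm d b, E.q_comm d c]
    simp only [mul_add, mul_smul_comm, smul_mul_assoc]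
    module
  have h2 : (3 : ℂ) • ∑ b, ∑ c, ∑ d, f b c d = 0 := by
    calc (3 : ℂ) • ∑ b, ∑ c, ∑ d, f b c d
        = (∑ b, ∑ c, ∑ d, f b c d) + (∑ b, ∑ c, ∑ d, f c d b) +
            ∑ b, ∑ c, ∑ d, f d b c := by
          rw [sum_rotate f, ← sum_rotate fun b c d => f d b c]
          module
      _ = 0 := by
          simp only [← Finset.sum_add_distrib, h1, Finset.sum_const_zero]
  exact (smul_eq_zero.1 h2).resolve_left (by norm_num)

/-- Of the four terms of the osp commutator, one yields the full trace ω, two yield -1 each, and the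
last is a multiple of the vanishing trace of `g`. -/
theorem IsOspFamily.sum_up_mul_comm (hg : E.IsOspFamily g) (a d : Idx N M) :
    ∑ b, ∑ c, E.up b c • (g d c * g b a - ks₂ d c b a • (g b a * g d c)) =
      (E.eps * (E.omega - 2)) • g d a := by
  have hterm : ∀ b c, E.up b c • (g d c * g b a - ks₂ d c b a • (g b a * g d c)) =
      E.eps • ((E.low b c * E.up b c) • g d a - (E.low a c * E.up c b) • g d b -
        (E.low d b * E.up b c) • g c a + (E.q d c * E.q d b * E.low a d) • (E.up b c • g c b)) := by
    intro b c
    have h1 : E.up b c * E.q c b = -E.up c b := by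
      rw [E.up_symm b c, q, ks_comm c b]
      linear_combination (-E.up c b * ks b c * ks b c) * E.eps_mul_self -
        E.up c b * ks_mul_self b c
    have h2 : E.up b c * (E.q d c * E.low b d) = -(E.low d b * E.up b c) := by
      rcases E.up_eq_zero_or b c with h | h
      · simp [h]
      · rw [E.low_symm b d, q, ← ks_congr_right h d, ks_comm b d]
        linear_combination (-E.low d b * E.up b c * ks d b * ks d b) * E.eps_mul_self -
          E.low d b * E.up b c * ks_mul_self d b
    rw [hg.comm]
    match_scalars
    · ring
    · linear_combination (E.eps * E.low a c) * h1
    · linear_combination E.eps * h2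
    · ring
  have hlast : ∀ b c, (E.q d c * E.q d b * E.low a d) • (E.up b c • g c b) =
      E.low a d • (E.up b c • g c b) := by
    intro b c
    rcases E.up_eq_zero_or b c with h | h
    · simp [h]
    · rw [E.q_congr_right h d, E.q_mul_self, one_mul]
  simp only [hterm, hlast, ← Finset.smul_sum, Finset.sum_add_distrib, Finset.sum_sub_distrib,
    hg.trace, ← Finset.sum_smul, E.sum_low_mul_up]
  have h3 : ∑ b, ∑ c, (E.low a c * E.up c b) • g d b = g d a := by
    simp only [← Finset.sum_smul, sum_low_up, ite_smul, one_smul, zero_smul]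
    simp
  have h4 : ∑ b, ∑ c, (E.low d b * E.up b c) • g c a = g d a := by
    rw [Finset.sum_comm]
    simp only [← Finset.sum_smul, sum_low_up, ite_smul, one_smul, zero_smul]
    simp
  simp only [Finset.sum_smul, h3, h4]
  module

theorem SuperCommutes.mul_mul (hgw : SuperCommutes g w) (a b c d : Idx N M) :
    g a b * (w c * w d) = ks₂ a b c d • (w c * w d * g a b) := by
  rw [← mul_assoc, hgw, smul_mul_assoc, mul_assoc, hgw, mul_smul_comm, smul_smul, mul_assoc,
    mul_assoc, ks₂, ks_comm c a, ks_comm c b, ks_comm d a, ks_comm d b]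
  congr 1
  ring

/-- Write w^b w^c w^d as its symmetrisation plus contractions. The symmetric part meets
anticommutators of `g` and is killed by the constraint; contracting b with c or with d leaves two
equal traces of commutators; contracting c with d gives the trace of `g`, which is zero. -/
theorem IsOspFamily.row_anticomm (hg : E.IsOspFamily g)
    (hw : ∀ a b, w a * w b = E.q a b • (w b * w a) + E.up a b • (1 : R))
    (hgw : SuperCommutes g w) (a : Idx N M) :
    row w g a * bil w w g + bil w w g * row w g a =
      (E.eps * (2 - E.omega)) • row w g a := by
  set br : Idx N M → Idx N M → Idx N M → R :=
    fun b c d => g d c * g b a - ks₂ d c b a • (g b a * g d c) with hbr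
  set ac : Idx N M → Idx N M → Idx N M → R :=
    fun b c d => g d c * g b a + ks₂ d c b a • (g b a * g d c) with hac
  have hterm : ∀ b c d,
      (w b * g b a) * (w c * w d * g d c) + (w c * w d * g d c) * (w b * g b a) =
      E.sym₃ w b c d * ac b c d - (1 / 2 : ℂ) • (w d * (E.up b c • br b c d)) -
        (1 / 2 : ℂ) • (w c * ((E.q b c * E.up b d) • br b c d)) +
        (1 / 2 : ℂ) • (w b * (E.up c d • ac b c d)) := by
    intro b c d
    have h1 : (w b * g b a) * (w c * w d * g d c) =
        ks₂ d c b a • (w b * w c * w d * (g b a * g d c)) := by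
      rw [mul_assoc, ← mul_assoc (g b a), hgw.mul_mul, smul_mul_assoc, mul_smul_comm,
        ks₂_comm b a, ks₂_swap]
      simp only [mul_assoc]
    have h2 : (w c * w d * g d c) * (w b * g b a) =
        (w b * w c * w d - E.up b c • w d - (E.q b c * E.up b d) • w c) *
          (g d c * g b a) := by
      have h3 : w b * w c * w d = E.q b c • (E.q b d • (w c * w d * w b)) +
          (E.q b c * E.up b d) • w c + E.up b c • w d := by
        rw [hw b c, add_mul, smul_mul_assoc, smul_mul_assoc, one_mul, mul_assoc, hw b d, mul_add,
          mul_smul_comm, mul_smul_comm, mul_one, smul_add, smul_smul (E.q b c) (E.up b d),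
          mul_assoc]
      have h4 : w c * w d * g d c * (w b * g b a) =
          (ks b d * ks b c) • (w c * w d * w b * (g d c * g b a)) := by
        rw [← mul_assoc, mul_assoc _ _ (w b), hgw, mul_smul_comm, smul_mul_assoc]
        simp only [mul_assoc]
      rw [h4, h3, add_sub_cancel_right, add_sub_cancel_right, smul_mul_assoc, smul_mul_assoc,
        smul_smul, q, q]
      congr 1
      linear_combination (-ks b d * ks b c) * E.eps_mul_self
    rw [h1, h2]
    simp only [hbr, hac, sym₃, sub_mul, add_mul, mul_add, mul_sub, mul_smul_comm, smul_mul_assoc]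
    module
  have hs1 : ∑ b, ∑ c, ∑ d, w d * (E.up b c • br b c d) =
      (E.eps * (E.omega - 2)) • row w g a := by
    rw [← sum_rotate fun b c d => w d * (E.up b c • br b c d), row, Finset.smul_sum]
    refine Finset.sum_congr rfl fun d _ => ?_
    simp only [← Finset.mul_sum]
    rw [hg.sum_up_mul_comm a d, mul_smul_comm]
  -- By the graded symmetry of `g` in c, d this is the previous sum with c and d exchanged.
  have hs2 : ∑ b, ∑ c, ∑ d, w c * ((E.q b c * E.up b d) • br b c d) =
      (E.eps * (E.omega - 2)) • row w g a := by
    rw [← hs1]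
    refine Finset.sum_congr rfl fun b _ => ?_
    rw [Finset.sum_comm]
    refine Finset.sum_congr rfl fun c _ => Finset.sum_congr rfl fun d _ => ?_
    congr 1
    simp only [hbr]
    rw [hg.symm c d, ks₂_swap c d]
    rcases E.up_eq_zero_or b c with h | h
    · simp [h]
    · rw [E.q_congr_left h d]
      simp only [smul_mul_assoc, mul_smul_comm]
      match_scalars
      · linear_combination E.up b c * E.q_mul_self c d
      · linear_combination (-E.up b c * ks₂ d c b a) * E.q_mul_self c d
  have hs3 : ∑ b, ∑ c, ∑ d, w b * (E.up c d • ac b c d) = 0 := by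
    refine Finset.sum_eq_zero fun b _ => ?_
    have h : ∀ c d, w b * (E.up c d • ac b c d) =
        w b * ((E.up c d • g d c) * g b a + g b a * (E.up c d • g d c)) := by
      intro c d
      simp only [hac]
      rcases E.up_eq_zero_or c d with h | h
      · simp [h]
      · rw [ks₂_eq_one h.symm, one_smul, smul_add, smul_mul_assoc, mul_smul_comm]
    simp only [h, ← Finset.mul_sum, Finset.sum_add_distrib, ← Finset.sum_mul, hg.trace]
    simp
  have hs4 : ∑ b, ∑ c, ∑ d, E.sym₃ w b c d * ac b c d = 0 := hg.sum_sym₃_mul hw a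
  calc row w g a * bil w w g + bil w w g * row w g a
      = ∑ b, ∑ c, ∑ d, ((w b * g b a) * (w c * w d * g d c) +
          (w c * w d * g d c) * (w b * g b a)) := by
        simp only [row, bil, Finset.sum_mul, Finset.mul_sum, Finset.sum_add_distrib]
        congr 1
        exact (sum_rotate fun c d b => w b * g b a * (w c * w d * g d c)).symm
    _ = _ := by
        simp only [hterm, Finset.sum_add_distrib, Finset.sum_sub_distrib, ← Finset.smul_sum,
          hs1, hs2, hs3, hs4]
        module

end Lemmas

end SuperMetric

/-! ### Quadratic forms and their commutators with the first invariant -/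

namespace SuperMetric

variable {N M : ℕ} {ϵ : ℤˣ} (E : SuperMetric N M ϵ)

variable {R : Type*} [Ring R] [Algebra ℂ R]

section Pair

variable {E} {g : Idx N M → Idx N M → R} {x y : Idx N M → R}

/-- Metric-contracted indices have equal degree, so the signs from x^a and y^b cancel. -/
theorem SuperCommutes.commute_contract (hx : SuperCommutes g x) (hy : SuperCommutes g y)
    (c d : Idx N M) : Commute (g c d) (E.contract x y) := by
  rw [contract]
  refine Commute.sum_right _ _ _ fun a _ => Commute.sum_right _ _ _ fun b _ => ?_
  rcases E.low_eq_zero_or a b with h | h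
  · simp [h]
  · refine Commute.smul_right ?_ _
    rw [Commute, SemiconjBy, ← mul_assoc, hx, smul_mul_assoc, mul_assoc, hy, mul_smul_comm,
      smul_smul, ← mul_assoc (x a), ks_congr_left h, ks_congr_left h]
    have : ks b c * ks b d * (ks b c * ks b d) = 1 := by
      linear_combination (ks b d * ks b d) * ks_mul_self b c + ks_mul_self b d
    rw [this, one_smul]

theorem monomial_mul_comm (hcross : ∀ a b, y b * x a = ks a b • (x a * y b))
    (hgx : SuperCommutes g x) (a b f : Idx N M) :
    y a * y b * g b a * x f = x f * (y a * y b * g b a) := by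
  rw [mul_assoc, hgx, mul_smul_comm, ← mul_assoc, mul_assoc (y a), hcross, mul_smul_comm,
    smul_mul_assoc, ← mul_assoc, hcross]
  simp only [smul_mul_assoc, smul_smul, mul_assoc]
  have : ks f b * ks f a * (ks f b * ks f a) = 1 := by
    linear_combination (ks f a * ks f a) * ks_mul_self f b + ks_mul_self f a
  rw [← mul_assoc (ks f b), this, one_smul]

theorem bil_mul_comm (hcross : ∀ a b, y b * x a = ks a b • (x a * y b))
    (hgx : SuperCommutes g x) (f : Idx N M) : bil y y g * x f = x f * bil y y g := by
  simp only [bil, Finset.sum_mul, Finset.mul_sum, monomial_mul_comm hcross hgx]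

theorem IsOscPair.bil_swap (h : E.IsOscPair x y) (hg : E.IsOspFamily g) :
    bil y x g = (-E.eps) • bil x y g := by
  conv_lhs => rw [bil, Finset.sum_comm]
  rw [bil, Finset.smul_sum]
  refine Finset.sum_congr rfl fun a _ => ?_
  rw [Finset.smul_sum]
  refine Finset.sum_congr rfl fun b _ => ?_
  rw [h.cross, hg.symm a b, q, smul_mul_smul_comm]
  match_scalars
  linear_combination (-E.eps) * ks_mul_self a b

theorem IsOscPair.contract_mul_left (h : E.IsOscPair x y) (f : Idx N M) :
    E.contract x y * x f = (-E.eps) • (x f * E.contract x y) + E.eps • y f := by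
  rw [h.left_mul_contract]
  match_scalars
  · linear_combination -E.eps_mul_self
  · ring

theorem IsOscPair.contract_mul_right (h : E.IsOscPair x y) (f : Idx N M) :
    E.contract x y * y f = (-E.eps) • (y f * E.contract x y) + x f := by
  rw [h.right_mul_contract]
  match_scalars
  · linear_combination -E.eps_mul_self
  · linear_combination E.eps_mul_self

theorem IsOscPair.contract_mul_right' (h : E.IsOscPair x y) (f : Idx N M) :
    E.contract x y * y f = (-E.eps) • (y f * E.contract x y) + (1 : ℂ) • x f := by
  rw [h.contract_mul_right, one_smul]

theorem mul_bil_sub_bil_mul {s : R} (hs : ∀ a b, Commute (g a b) s) {u v u' v' : Idx N M → R}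
    {α β α' β' : ℂ}
    (hu : ∀ f, s * u f = α • (u f * s) + β • u' f) (hv : ∀ f, s * v f = α' • (v f * s) + β' • v' f) :
    s * bil u v g - (α * α') • (bil u v g * s) =
      β • bil u' v g + (α * β') • bil u v' g := by
  simp only [bil, Finset.mul_sum, Finset.sum_mul, Finset.smul_sum, ← Finset.sum_sub_distrib,
    ← Finset.sum_add_distrib]
  refine Finset.sum_congr rfl fun a _ => Finset.sum_congr rfl fun b _ => ?_
  have h1 : s * (u a * v b * g b a) = (α * α') • (u a * v b * (s * g b a)) +
      (α * β') • (u a * v' b * g b a) + β • (u' a * v b * g b a) := by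
    rw [← mul_assoc, ← mul_assoc, hu, add_mul, add_mul, smul_mul_assoc, smul_mul_assoc,
      mul_assoc (u a), hv]
    simp only [mul_add, add_mul, smul_mul_assoc, mul_smul_comm, mul_assoc, smul_add, smul_smul]
  rw [h1, ← (hs b a).eq]
  simp only [mul_assoc]
  module

/-- Passing s through an oscillator produces its partner and a factor -ϵ. Two such factors square to
1, leaving an honest commutator, and the two mixed forms are proportional by `bil_swap`. The next
two lemmas follow the same pattern. -/
theorem IsOscPair.comm_bil_left (h : E.IsOscPair x y) (hg : E.IsOspFamily g)
    (hx : SuperCommutes g x) (hy : SuperCommutes g y) :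
    E.contract x y * bil x x g - bil x x g * E.contract x y = (-2 : ℂ) • bil x y g := by
  have h1 := mul_bil_sub_bil_mul (fun a b => hx.commute_contract (E := E) hy a b)
    h.contract_mul_left h.contract_mul_left
  rw [neg_mul_neg, E.eps_mul_self, one_smul, h.bil_swap hg] at h1
  rw [h1]
  match_scalars
  linear_combination (-2 : ℂ) * E.eps_mul_self

theorem IsOscPair.comm_bil_right (h : E.IsOscPair x y) (hg : E.IsOspFamily g)
    (hx : SuperCommutes g x) (hy : SuperCommutes g y) :
    E.contract x y * bil y y g - bil y y g * E.contract x y = (2 : ℂ) • bil x y g := by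
  have h1 := mul_bil_sub_bil_mul (fun a b => hx.commute_contract (E := E) hy a b)
    h.contract_mul_right'
    h.contract_mul_right'
  rw [neg_mul_neg, E.eps_mul_self, one_smul, h.bil_swap hg] at h1
  rw [h1]
  match_scalars
  linear_combination E.eps_mul_self

theorem IsOscPair.comm_bil_mixed (h : E.IsOscPair x y)
    (hx : SuperCommutes g x) (hy : SuperCommutes g y) :
    E.contract x y * bil x y g - bil x y g * E.contract x y =
      E.eps • (bil y y g - bil x x g) := by
  have h1 := mul_bil_sub_bil_mul (fun a b => hx.commute_contract (E := E) hy a b)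
    h.contract_mul_left h.contract_mul_right'
  rw [neg_mul_neg, E.eps_mul_self, one_smul] at h1
  rw [h1]
  module

theorem bil_eq_sum_row (u v : Idx N M → R) : bil u v g = ∑ a, u a * row v g a := by
  simp only [bil, row, Finset.mul_sum, mul_assoc]

theorem anticomm_bil {u v : Idx N M → R} {β : ℂ} {X : R}
    (hX : ∀ a, row v g a * X + X * row v g a = β • row v g a) (hu : ∀ f, X * u f = u f * X) :
    bil u v g * X + X * bil u v g = β • bil u v g := by
  simp only [bil_eq_sum_row, Finset.sum_mul, Finset.mul_sum, Finset.smul_sum,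
    ← Finset.sum_add_distrib]
  refine Finset.sum_congr rfl fun a _ => ?_
  rw [← mul_assoc X, hu, mul_assoc, mul_assoc, ← mul_add, hX, mul_smul_comm]

/-- The form in y commutes with every x^a, so `row_anticomm` for y can be multiplied by x^a and
summed. The value on the right is the same in the x-version; `comm_mul` uses only this coincidence.
-/
theorem IsOscPair.anticomm_mixed_right (h : E.IsOscPair x y) (hg : E.IsOspFamily g)
    (hx : SuperCommutes g x) (hy : SuperCommutes g y) :
    bil x y g * bil y y g + bil y y g * bil x y g =
      (E.eps * (2 - E.omega)) • bil x y g :=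
  anticomm_bil (hg.row_anticomm h.right hy) (bil_mul_comm h.cross hx)

theorem IsOscPair.anticomm_mixed_left (h : E.IsOscPair x y) (hg : E.IsOspFamily g)
    (hx : SuperCommutes g x) (hy : SuperCommutes g y) :
    bil x y g * bil x x g + bil x x g * bil x y g =
      (E.eps * (2 - E.omega)) • bil x y g := by
  have h1 := h.symm.anticomm_mixed_right hg hy hx
  rw [h.bil_swap hg] at h1
  have h2 := congrArg (fun z => (-E.eps) • z) h1
  simp only [smul_mul_assoc, mul_smul_comm, smul_add, smul_smul, neg_mul_neg, E.eps_mul_self,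
    one_smul] at h2
  rw [h2]
  match_scalars
  linear_combination (E.eps * (2 - E.omega)) * E.eps_mul_self

/-- The contraction `x^a x^b y^c y^d ε_{bc} g_{da}`. -/
def quartic (E : SuperMetric N M ϵ) (g : Idx N M → Idx N M → R) (x y : Idx N M → R) : R :=
  ∑ a, ∑ d, x a * E.contract x y * y d * g d a

theorem sum_eq_quartic (E : SuperMetric N M ϵ) (g : Idx N M → Idx N M → R) (x y : Idx N M → R) :
    ∑ a, ∑ b, ∑ c, ∑ d, E.low b c • (x a * x b * (y c * y d) * g d a) = quartic E g x y := by
  rw [quartic]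
  refine Finset.sum_congr rfl fun a _ => ?_
  rw [← sum_rotate]
  refine Finset.sum_congr rfl fun d _ => ?_
  simp only [contract, Finset.mul_sum, Finset.sum_mul, mul_smul_comm, smul_mul_assoc, mul_assoc]

/-- Each of the four terms of the osp commutator ties one x-index to one y-index. Reordering the
oscillators makes each of them the same quartic form, and the contractions created on the way add up
to two copies of each quadratic form and a vanishing trace. -/
theorem IsOscPair.comm_bil_bil (h : E.IsOscPair x y) (hg : E.IsOspFamily g)
    (hx : SuperCommutes g x) (hy : SuperCommutes g y) :
    bil x x g * bil y y g - bil y y g * bil x x g =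
      (-E.eps) • ((4 : ℂ) • quartic E g x y - (2 : ℂ) • bil x x g - (2 : ℂ) • bil y y g) := by
  have hyg := monomial_mul_comm h.cross hx
  have hterm : ∀ a b c d, x a * x b * g b a * (y c * y d * g d c) -
      y c * y d * g d c * (x a * x b * g b a) = (-E.eps) • (
        (E.low b c • (x a * x b * (y c * y d) * g d a) +
        (E.low a c • (x b * x a * (y c * y d) * g d b) -
          (E.up b a * E.low a c) • (y c * y d * g d b)) +
        (E.low b d • (x a * x b * (y d * y c) * g c a) -
          (E.low b d * E.up d c) • (x a * x b * g c a))) +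
        (E.low a d • (x b * x a * (y d * y c) * g c b) -
          (E.low a d * E.up d c) • (x b * x a * g c b) -
          (E.up b a * E.low a d) • (y d * y c * g c b) +
          (E.up b a * E.low a d) • (E.up d c • g c b))) := by
    intro a b c d
    have h1 : x a * x b * g b a * (y c * y d * g d c) =
        x a * x b * (y c * y d) * (ks₂ d c b a • (g b a * g d c)) := by
      rw [mul_assoc (x a * x b), ← mul_assoc (g b a), hy.mul_mul, ks₂_swap d c, ks₂_comm c d]
      simp only [mul_smul_comm, smul_mul_assoc, mul_assoc]
    have h2 : y c * y d * g d c * (x a * x b * g b a) =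
        x a * x b * (y c * y d) * (g d c * g b a) := by
      rw [← mul_assoc, ← mul_assoc, hyg, mul_assoc (x a), hyg]
      simp only [mul_assoc]
    have h3 : E.q a b • (x a * x b) = x b * x a - E.up b a • (1 : R) := by
      rw [h.left b a, E.q_comm]
      module
    have h4 : E.q d c • (y c * y d) = y d * y c - E.up d c • (1 : R) := by
      rw [h.right d c]
      module
    have e2 : (E.q c b * E.low a c) • (x a * x b * (y c * y d) * g d b) =
        E.low a c • ((E.q a b • (x a * x b)) * (y c * y d) * g d b) := by
      rcases E.low_eq_zero_or a c with h' | h'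
      · simp [h']
      · rw [E.q_congr_left h']
        simp only [smul_mul_assoc]
        module
    have e4 : (E.q d c * E.q d b * E.low a d) • (x a * x b * (y c * y d) * g c b) =
        E.low a d • ((E.q a b • (x a * x b)) * (E.q d c • (y c * y d)) * g c b) := by
      rcases E.low_eq_zero_or a d with h' | h'
      · simp [h']
      · rw [E.q_congr_left h' b]
        simp only [smul_mul_assoc, mul_smul_comm]
        module
    have e3 : (E.q d c * E.low b d) • (x a * x b * (y c * y d) * g c a) =
        E.low b d • (x a * x b * (E.q d c • (y c * y d)) * g c a) := by
      simp only [smul_mul_assoc, mul_smul_comm]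
      module
    rw [h1, h2, ← neg_sub, ← mul_sub, hg.comm, mul_smul_comm]
    simp only [mul_add, mul_smul_comm]
    rw [e2, e3, e4, h3, h4]
    simp only [mul_sub, sub_mul, mul_smul_comm, smul_mul_assoc, mul_one, one_mul]
    module
  have hQ := sum_eq_quartic E g x y
  have hQ' : ∀ a, ∑ b, ∑ c, ∑ d, E.low b c • (x a * x b * (y c * y d) * g d a) =
      ∑ b, ∑ c, ∑ d, E.low b d • (x a * x b * (y d * y c) * g c a) := by
    intro a
    exact Finset.sum_congr rfl fun b _ => Finset.sum_comm
  have s2 : ∑ a, ∑ b, ∑ c, ∑ d, E.low a c • (x b * x a * (y c * y d) * g d b) =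
      quartic E g x y := by
    rw [Finset.sum_comm, hQ]
  have s3 : ∑ a, ∑ b, ∑ c, ∑ d, E.low b d • (x a * x b * (y d * y c) * g c a) =
      quartic E g x y := by
    simp only [← hQ', hQ]
  have s4 : ∑ a, ∑ b, ∑ c, ∑ d, E.low a d • (x b * x a * (y d * y c) * g c b) =
      quartic E g x y := by
    rw [Finset.sum_comm, s3]
  have c2 : ∑ a, ∑ b, ∑ c, ∑ d, (E.up b a * E.low a c) • (y c * y d * g d b) = bil y y g := by
    rw [Finset.sum_comm, bil]
    simp only [← Finset.smul_sum, E.sum_sum_low_smul_up]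
  have c4 : ∑ a, ∑ b, ∑ c, ∑ d, (E.up b a * E.low a d) • (y d * y c * g c b) = bil y y g := by
    rw [← c2]
    exact Finset.sum_congr rfl fun a _ => Finset.sum_congr rfl fun b _ => Finset.sum_comm
  have c5 : ∑ a, ∑ b, ∑ c, ∑ d, (E.up b a * E.low a d) • (E.up d c • g c b) = 0 := by
    rw [← hg.trace, Finset.sum_comm]
    refine Finset.sum_congr rfl fun b _ => ?_
    rw [← E.sum_sum_low_smul_up b fun d => ∑ c, E.up d c • g c b]
    simp only [Finset.smul_sum]
    exact Finset.sum_congr rfl fun a _ => Finset.sum_comm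
  have hcol : ∀ (f : Idx N M → R) a, ∑ c, ∑ d, (E.low a d * E.up d c) • f c = f a := by
    intro f a
    simp only [← Finset.sum_smul, sum_low_up, ite_smul, one_smul, zero_smul]
    simp
  have c3 : ∑ a, ∑ b, ∑ c, ∑ d, (E.low b d * E.up d c) • (x a * x b * g c a) = bil x x g := by
    simp only [bil, hcol fun c => x _ * x _ * g c _]
  have c3' : ∑ a, ∑ b, ∑ c, ∑ d, (E.low a d * E.up d c) • (x b * x a * g c b) = bil x x g := by
    rw [Finset.sum_comm, c3]
  calc bil x x g * bil y y g - bil y y g * bil x x g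
      = ∑ a, ∑ b, ∑ c, ∑ d, (x a * x b * g b a * (y c * y d * g d c) -
          y c * y d * g d c * (x a * x b * g b a)) := by
        have h1 : ∀ Z : R, bil x x g * Z - Z * bil x x g =
            ∑ a, ∑ b, (x a * x b * g b a * Z - Z * (x a * x b * g b a)) := by
          intro Z
          simp only [bil, Finset.sum_mul, Finset.mul_sum, Finset.sum_sub_distrib]
        rw [h1]
        refine Finset.sum_congr rfl fun a _ => Finset.sum_congr rfl fun b _ => ?_
        simp only [bil, Finset.sum_mul, Finset.mul_sum, Finset.sum_sub_distrib]
    _ = (-E.eps) • ((quartic E g x y + (quartic E g x y - bil y y g) +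
          (quartic E g x y - bil x x g)) +
          (quartic E g x y - bil x x g - bil y y g + 0)) := by
        simp only [← Finset.smul_sum] at hQ s2 c2
        simp only [hterm, Finset.sum_add_distrib, Finset.sum_sub_distrib, ← Finset.smul_sum,
          hQ, s2, s3, s4, c2, c3, c3', c4, c5]
    _ = _ := by
        module

theorem IsOscPair.quartic_eq (h : E.IsOscPair x y) :
    quartic E g x y = bil y y g - E.eps • (E.contract x y * bil x y g) := by
  simp only [bil, quartic, Finset.smul_sum, Finset.mul_sum, ← Finset.sum_sub_distrib]
  refine Finset.sum_congr rfl fun a _ => Finset.sum_congr rfl fun b _ => ?_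
  rw [h.left_mul_contract]
  simp only [add_mul, smul_mul_assoc, mul_assoc]
  module

theorem IsOscPair.quartic_eq' (h : E.IsOscPair x y)
    (hx : SuperCommutes g x) (hy : SuperCommutes g y) :
    quartic E g x y = bil x x g - E.eps • (bil x y g * E.contract x y) := by
  simp only [bil, quartic, Finset.smul_sum, Finset.sum_mul, ← Finset.sum_sub_distrib]
  refine Finset.sum_congr rfl fun a _ => Finset.sum_congr rfl fun b _ => ?_
  rw [mul_assoc (x a), h.contract_mul_right, mul_assoc _ (g b a),
    (hx.commute_contract (E := E) hy b a).eq]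
  simp only [mul_add, add_mul, smul_mul_assoc, mul_smul_comm, mul_assoc]
  module

/-- The key commutator of the first invariant with the product of the two `osp` actions. -/
theorem IsOscPair.comm_mul (h : E.IsOscPair x y) (hg : E.IsOspFamily g)
    (hx : SuperCommutes g x) (hy : SuperCommutes g y) :
    E.contract x y * (bil x x g * bil y y g) - bil x x g * bil y y g * E.contract x y =
      E.eps • (E.contract x y * (bil y y g - bil x x g) +
        (bil y y g - bil x x g) * E.contract x y) := by
  have h1 := h.comm_bil_left hg hx hy
  have h2 := h.comm_bil_right hg hx hy
  have h3 := h.comm_bil_mixed hx hy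
  have h4 := h.anticomm_mixed_left hg hx hy
  have h5 := h.anticomm_mixed_right hg hx hy
  have h6 := h.comm_bil_bil hg hx hy
  have h7 := h.quartic_eq (g := g)
  have h8 := h.quartic_eq' hx hy
  -- Two of the four quartic forms are evaluated with s moved to the left and two with s moved to
  -- the right; the quadratic forms then cancel.
  have h9 : bil x x g * bil y y g - bil y y g * bil x x g =
      (2 : ℂ) • (E.contract x y * bil x y g + bil x y g * E.contract x y) := by
    have h10 : (4 : ℂ) • quartic E g x y = (2 : ℂ) • quartic E g x y + (2 : ℂ) • quartic E g x y := by
      module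
    rw [h6, h10]
    nth_rewrite 1 [h7]
    rw [h8]
    match_scalars <;> first | ring1 | linear_combination (2 : ℂ) * E.eps_mul_self
  clear h6 h7 h8
  generalize E.contract x y = s at *
  generalize bil x x g = X at *
  generalize bil y y g = Z at *
  generalize bil x y g = m at *
  have r1 : s * X = X * s - (2 : ℂ) • m := by
    rw [eq_add_of_sub_eq h1]
    module
  have r2 : s * Z = Z * s + (2 : ℂ) • m := by
    rw [eq_add_of_sub_eq h2, add_comm]
  have r3 : s * m = m * s + E.eps • (Z - X) := by
    rw [eq_add_of_sub_eq h3, add_comm]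
  have a1 : ∀ w, s * (X * w) = X * (s * w) - (2 : ℂ) • (m * w) := by
    intro w
    rw [← mul_assoc, r1, sub_mul, smul_mul_assoc, mul_assoc]
  have a2 : ∀ w, s * (Z * w) = Z * (s * w) + (2 : ℂ) • (m * w) := by
    intro w
    rw [← mul_assoc, r2, add_mul, smul_mul_assoc, mul_assoc]
  have a3 : ∀ w, s * (m * w) = m * (s * w) + E.eps • (Z * w - X * w) := by
    intro w
    rw [← mul_assoc, r3, add_mul, smul_mul_assoc, mul_assoc, sub_mul]
  -- With X, Z, m for the three forms, `h11` commutes s into [X, Z] = 2 {s, m}. By Leibniz, [s, XZ]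
  -- - ½ [s, [X, Z]] = {X, m} - {m, Z}, which is zero by `h12`.
  have h11 := congrArg (fun z => s * z - z * s) h9
  simp only [mul_add, add_mul, mul_sub, sub_mul, mul_smul_comm, smul_mul_assoc, mul_assoc, a1, a2,
    a3, r1, r2, r3, smul_add, smul_sub] at h11 ⊢
  have h12 := h4.trans h5.symm
  linear_combination (norm := module) (1 / 2 : ℂ) • h11 + (1 : ℂ) • h12

end Pair

end SuperMetric

/-! ### The failure of J_k to intertwine, in terms of s, H and the product X -/

section Defect

variable {R : Type*} [Ring R] [Algebra ℂ R]

theorem comm_invPoly_succ (e ω : ℂ) (s W : R) (k : ℕ) :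
    invPoly e ω s (k + 1) * W - W * invPoly e ω s (k + 1) =
      s * (invPoly e ω s k * W - W * invPoly e ω s k) +
        (s * W - W * s) * invPoly e ω s k -
        kap e ω k • (invPoly e ω s (k - 1) * W - W * invPoly e ω s (k - 1)) := by
  rw [invPoly_succ]
  simp only [sub_mul, mul_sub, smul_mul_assoc, mul_smul_comm, mul_assoc]
  module

theorem comm_invPoly_succ' (e ω : ℂ) (s W : R) (k : ℕ) :
    invPoly e ω s (k + 1) * W - W * invPoly e ω s (k + 1) =
      (invPoly e ω s k * W - W * invPoly e ω s k) * s +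
        invPoly e ω s k * (s * W - W * s) -
        kap e ω k • (invPoly e ω s (k - 1) * W - W * invPoly e ω s (k - 1)) := by
  rw [invPoly_succ, (commute_invPoly e ω (Commute.refl s) k).eq]
  simp only [sub_mul, mul_sub, smul_mul_assoc, mul_smul_comm, mul_assoc]
  module

/-- Both sides obey the same recurrence in k: the source {s, H} J_k on the left arises on the right
from [s, [s, H]] = 4e H, since s commutes with J_k. -/
theorem comm_invPoly_mul {e ω : ℂ} (he : e * e = 1) {s H X : R}
    (hH : s * (s * H - H * s) - (s * H - H * s) * s = (4 * e) • H)
    (hX : s * X - X * s = s * H + H * s) (k : ℕ) :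
    invPoly e ω s k * X - X * invPoly e ω s k = (e / 4) •
      (s * (invPoly e ω s k * (s * H - H * s) - (s * H - H * s) * invPoly e ω s k) +
        (invPoly e ω s k * (s * H - H * s) - (s * H - H * s) * invPoly e ω s k) * s) := by
  induction k using Nat.strong_induction_on with
  | _ k ih =>
  rcases k with _ | k
  · simp [invPoly]
  · have hc : invPoly e ω s k * s = s * invPoly e ω s k :=
      (commute_invPoly e ω (Commute.refl s) k).eq.symm
    rw [comm_invPoly_succ, comm_invPoly_succ, ih k (by omega), ih (k - 1) (by omega), hH, hX]
    generalize s * H - H * s = W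
    generalize invPoly e ω s (k - 1) = J' at *
    generalize invPoly e ω s k = J at *
    simp only [mul_add, add_mul, mul_sub, sub_mul, smul_mul_assoc, mul_smul_comm, mul_assoc, hc]
    match_scalars <;> first | ring1 | linear_combination he | linear_combination -he

/-- With W = [s, H], `quadratic_seq` evaluates [J_k, W] as a multiple of T_{k-1} and half the
anticommutator of s with T_{k-1} by T_k and T_{k-2}; `comm_invPoly_mul` needs exactly this
combination. -/
theorem defect_eq {e ω : ℂ} (he : e * e = 1) {s H X : R}
    (hH : s * (s * H - H * s) - (s * H - H * s) * s = (4 * e) • H)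
    (hX : s * X - X * s = s * H + H * s) (T : ℕ → R)
    (hT : ∀ k, invPoly e ω s k * H + H * invPoly e ω s k =
      (2 : ℂ) • T k + (1 / 2 * e * k * (k - 1)) • T (k - 2)) (u : ℂ) (k : ℕ) :
    invPoly e ω s k * X - X * invPoly e ω s k -
        u • (invPoly e ω s k * H + H * invPoly e ω s k) =
      (-2 * (u - k)) • T k - (1 / 2 * e * k * (k - 1) * (k + u - ω)) • T (k - 2) := by
  set W := s * H - H * s with hW
  set σ : R →ₗ[ℂ] R := (1 / 2 : ℂ) • (LinearMap.mulLeft ℂ s + LinearMap.mulRight ℂ s) with hσ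
  have hσa : ∀ w, σ w = (1 / 2 : ℂ) • (s * w + w * s) := fun w => rfl
  have hQ := quadratic_seq (e := e) (ω := ω) σ
    (fun k => invPoly e ω s k * W - W * invPoly e ω s k)
    (fun k => (1 / 2 : ℂ) • (invPoly e ω s k * H + H * invPoly e ω s k)) T
    (by
      intro k
      have h1 := comm_invPoly_succ e ω s W k
      have h2 := comm_invPoly_succ' e ω s W k
      rw [hH] at h1 h2
      rw [hσa]
      simp only [smul_mul_assoc, mul_smul_comm] at h1 h2
      linear_combination (norm := module) (1 / 2 : ℂ) • h1 + (1 / 2 : ℂ) • h2)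
    (by
      intro k
      have hc : invPoly e ω s k * s = s * invPoly e ω s k :=
        (commute_invPoly e ω (Commute.refl s) k).eq.symm
      have hc' : ∀ w, invPoly e ω s k * (s * w) = s * (invPoly e ω s k * w) := by
        intro w
        rw [← mul_assoc, hc, mul_assoc]
      simp only [hσa, hW, invPoly_succ]
      simp only [mul_add, add_mul, mul_sub, sub_mul, smul_mul_assoc, mul_smul_comm, mul_assoc, hc,
        hc']
      module)
    (by
      intro k
      simp only [hT]
      module)
    (by simp [invPoly])
  rw [comm_invPoly_mul he hH hX, hT]
  rcases k with _ | k
  · simp [invPoly]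
    module
  · have h1 := (hQ k).1
    have h2 := (hQ k).2
    rw [hσa] at h2
    rw [← hW, h1, show k + 1 - 2 = k - 1 by omega]
    simp only [smul_mul_assoc, mul_smul_comm]
    push_cast
    -- The factor 2(k+1) is (e/4) · 2 · 4e(k+1), with e² = 1; the 2 comes from the ½ in σ.
    linear_combination (norm := skip) (2 * (k + 1) : ℂ) • h2
    match_scalars <;> first | ring1 | linear_combination ((k : ℂ) + 1) * he

end Defect

/-! ### The defect for the osp quadratic forms -/

namespace SuperMetric

variable {N M : ℕ} {ϵ : ℤˣ} (E : SuperMetric N M ϵ)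

variable {R : Type*} [Ring R] [Algebra ℂ R]

/-- The contraction of `twSum₂` with `g`. -/
def twBil (s : R) (w : Idx N M → R) (g : Idx N M → Idx N M → R) (k : ℕ) : R :=
  ∑ a, ∑ b, E.twSum₂ s w k a b * g b a

variable {E} {g : Idx N M → Idx N M → R} {x y : Idx N M → R}

theorem anticomm_bil_invPoly (hg : E.IsOspFamily g) {s : R} (hs : ∀ a b, Commute (g a b) s)
    {m : ℂ} (hm : m * m = 1)
    (hx : ∀ f, x f * s = (-E.eps) • (s * x f) + m • y f)
    (hy : ∀ f, y f * s = (-E.eps) • (s * y f) + (E.eps * m) • x f)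
    (hxy : ∀ a b, x a * y b = ks a b • (y b * x a)) (k : ℕ) :
    bil x x g * invPoly E.eps E.omega s k + invPoly E.eps E.omega s k * bil x x g =
      (2 : ℂ) • E.twBil s x g k - (1 / 2 * E.eps * k * (k - 1)) • E.twBil s y g (k - 2) := by
  have h1 : bil x x g * invPoly E.eps E.omega s k + invPoly E.eps E.omega s k * bil x x g =
      ∑ a, ∑ b, (x a * x b * invPoly E.eps E.omega s k +
        E.q a b • (invPoly E.eps E.omega s k * (x b * x a))) * g b a := by
    have h2 : bil x x g = ∑ a, ∑ b, E.q a b • (x b * x a * g b a) := by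
      rw [bil, Finset.sum_comm]
      refine Finset.sum_congr rfl fun a _ => Finset.sum_congr rfl fun b _ => ?_
      rw [hg.symm a b, mul_smul_comm]
    nth_rewrite 2 [h2]
    simp only [bil, Finset.sum_mul, Finset.mul_sum, ← Finset.sum_add_distrib]
    refine Finset.sum_congr rfl fun a _ => Finset.sum_congr rfl fun b _ => ?_
    rw [mul_assoc _ (g b a), (commute_invPoly E.eps E.omega (hs b a) k).eq]
    simp only [add_mul, smul_mul_assoc, mul_smul_comm, mul_assoc]
  have h3 : E.twBil s y g (k - 2) =
      ∑ a, ∑ b, (-E.eps * ks a b) • (E.twSum₂ s y (k - 2) b a * g b a) := by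
    rw [twBil, Finset.sum_comm]
    refine Finset.sum_congr rfl fun a _ => Finset.sum_congr rfl fun b _ => ?_
    rw [hg.symm a b, mul_smul_comm, q]
  rw [h1, h3, twBil]
  simp only [Finset.smul_sum, ← Finset.sum_sub_distrib]
  refine Finset.sum_congr rfl fun a _ => Finset.sum_congr rfl fun b _ => ?_
  rw [E.anticomm_invPoly_aux hm hx hy hxy, add_mul, smul_mul_assoc, smul_mul_assoc]
  match_scalars
  · ring
  · linear_combination (-(1 / 2 * (k : ℂ) * (k - 1) * ks a b)) * E.eps_mul_self

/-- The quadratic form which intertwines the two sides of the `RLL`-relation. -/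
def twDiff (E : SuperMetric N M ϵ) (g : Idx N M → Idx N M → R) (x y : Idx N M → R) (k : ℕ) : R :=
  E.eps • (E.twBil (E.contract x y) y g k - E.twBil (E.contract x y) x g k)

/-- `anticomm_bil_invPoly` exchanges x and y when the order drops by two. The difference of the
y-form and the x-form only changes sign under this exchange, so `twDiff` is the single sequence T
required by `OSp.defect_eq`. -/
theorem IsOscPair.defect_eq (h : E.IsOscPair x y) (hg : E.IsOspFamily g)
    (hx : SuperCommutes g x) (hy : SuperCommutes g y) {X₁ X₂ : R}
    (hX₁ : X₁ = E.eps • bil x x g) (hX₂ : X₂ = E.eps • bil y y g) (u : ℂ) (k : ℕ) :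
    invPoly E.eps E.omega (E.contract x y) k * (X₁ * X₂) -
        X₁ * X₂ * invPoly E.eps E.omega (E.contract x y) k -
        u • (invPoly E.eps E.omega (E.contract x y) k * (X₂ - X₁) +
          (X₂ - X₁) * invPoly E.eps E.omega (E.contract x y) k) =
      (-2 * (u - k)) • E.twDiff g x y k -
        (1 / 2 * E.eps * k * (k - 1) * (k + u - E.omega)) • E.twDiff g x y (k - 2) := by
  have he := E.eps_mul_self
  have hs := fun a b => hx.commute_contract (E := E) hy a b
  have h1 := h.comm_bil_left hg hx hy
  have h2 := h.comm_bil_right hg hx hy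
  have h3 := h.comm_bil_mixed hx hy
  have hH : E.contract x y * (X₂ - X₁) - (X₂ - X₁) * E.contract x y =
      (4 * E.eps) • bil x y g := by
    rw [hX₁, hX₂]
    simp only [mul_sub, sub_mul, mul_smul_comm, smul_mul_assoc]
    linear_combination (norm := module) E.eps • h2 - E.eps • h1
  refine OSp.defect_eq he ?_ ?_ _ ?_ u k
  · rw [hH, hX₁, hX₂]
    simp only [mul_smul_comm, smul_mul_assoc]
    linear_combination (norm := module) (4 * E.eps) • h3
  · have h4 := h.comm_mul hg hx hy
    rw [hX₁, hX₂]
    simp only [mul_sub, sub_mul, mul_smul_comm, smul_mul_assoc, smul_smul, he, one_smul] at h4 ⊢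
    rw [h4]
    module
  · intro k
    have h5 := anticomm_bil_invPoly hg hs (m := 1) (by ring) h.left_mul_contract
      (by simpa using h.right_mul_contract) h.cross' k
    have h6 := anticomm_bil_invPoly hg hs he h.right_mul_contract
      (by simpa [he] using h.left_mul_contract) (fun a b => by rw [h.cross, ks_comm]) k
    rw [hX₁, hX₂, twDiff, twDiff]
    simp only [mul_sub, sub_mul, mul_smul_comm, smul_mul_assoc]
    linear_combination (norm := module) E.eps • h6 - E.eps • h5

theorem IsOscPair.commute_add (h : E.IsOscPair x y) (hg : E.IsOspFamily g)
    (hx : SuperCommutes g x) (hy : SuperCommutes g y) {X₁ X₂ : R}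
    (hX₁ : X₁ = E.eps • bil x x g) (hX₂ : X₂ = E.eps • bil y y g) :
    Commute (X₁ + X₂) (E.contract x y) := by
  have h1 := h.comm_bil_left hg hx hy
  have h2 := h.comm_bil_right hg hx hy
  rw [Commute, SemiconjBy, hX₁, hX₂]
  simp only [mul_add, add_mul, mul_smul_comm, smul_mul_assoc]
  linear_combination (norm := module) (-E.eps) • h1 - E.eps • h2

end SuperMetric

/-! ### Signs in graded tensor products -/

theorem units_pow_smul {V : Type*} [AddCommGroup V] [Module ℂ V] (z : ZMod 2) (v : V) :
    ((-1 : ℤˣ) ^ z) • v = sgn z • v := by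
  rcases zmod_two_cases z with rfl | rfl
  · rw [uzpow_zero, sgn_zero, one_smul, one_smul]
  · have h : (-1 : ℤˣ) ^ (1 : ZMod 2) = -1 := uzpow_one _
    rw [h, sgn_one, Units.neg_smul, one_smul, neg_one_smul]

theorem tmul_mul_tmul {A B : Type*} [Ring A] [Algebra ℂ A] [Ring B] [Algebra ℂ B]
    (𝒜 : ZMod 2 → Submodule ℂ A) (ℬ : ZMod 2 → Submodule ℂ B) [GradedAlgebra 𝒜] [GradedAlgebra ℬ]
    {i j : ZMod 2} {a' : A} {b : B} (ha : a' ∈ 𝒜 i) (hb : b ∈ ℬ j) (a : A) (b' : B) :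
    (a ᵍ⊗ₜ[ℂ] b * a' ᵍ⊗ₜ[ℂ] b' : 𝒜 ᵍ⊗[ℂ] ℬ) = sgn (j * i) • ((a * a') ᵍ⊗ₜ[ℂ] (b * b')) := by
  rw [← units_pow_smul]
  exact GradedTensorProduct.tmul_coe_mul_coe_tmul 𝒜 ℬ a ⟨b, hb⟩ ⟨a', ha⟩ b'

/-- The total degree of a family of indices. -/
def degSum {N M k : ℕ} (a : Fin k → Idx N M) : ZMod 2 := ∑ i, deg (a i)

theorem degSum_cons {N M k : ℕ} (e : Idx N M) (a : Fin k → Idx N M) :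
    degSum (Fin.cons e a : Fin (k + 1) → Idx N M) = deg e + degSum a := by
  simp [degSum, Fin.sum_univ_succ]

theorem degSum_rev {N M k : ℕ} (a : Fin k → Idx N M) : degSum (fun i => a (Fin.rev i)) = degSum a :=
  Equiv.sum_comp Fin.revPerm fun i => deg (a i)

namespace SuperMetric

variable {N M : ℕ} {ϵ : ℤˣ} (E : SuperMetric N M ϵ)

theorem qprod_eq (e : Idx N M) {k : ℕ} (a : Fin k → Idx N M) :
    E.qprod e a = (-E.eps) ^ k * sgn (deg e * degSum a) := by
  induction k with
  | zero => simp [qprod, degSum, sgn_zero]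
  | succ k ih =>
    induction a using Fin.consCases with
    | _ f b =>
    rw [qprod_cons, ih, degSum_cons, mul_add, sgn_add, pow_succ, q, ks]
    ring

theorem c_mem (a : Idx N M) : E.c a ∈ E.oscGrading (deg a) :=
  (mem_parityGrading _ _ _).2 (E.oscParity_c a)

theorem symProd_mem {k : ℕ} (a : Fin k → Idx N M) : E.symProd a ∈ E.oscGrading (degSum a) := by
  induction k with
  | zero =>
    rw [symProd_eq_nested]
    exact SetLike.GradedOne.one_mem
  | succ k ih =>
    induction a using Fin.consCases with
    | _ e b =>
    rw [symProd_cons, degSum_cons]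
    refine Submodule.smul_mem _ _ (Submodule.add_mem _ ?_ (Submodule.smul_mem _ _ ?_))
    · exact SetLike.GradedMul.mul_mem (E.c_mem e) (ih b)
    · rw [add_comm]
      exact SetLike.GradedMul.mul_mem (ih b) (E.c_mem e)

theorem leg_zero (z : E.Osc) : E.leg 0 z = (z ᵍ⊗ₜ[ℂ] (1 : E.Osc) : E.Osc2) := rfl

theorem leg_one (z : E.Osc) : E.leg 1 z = ((1 : E.Osc) ᵍ⊗ₜ[ℂ] z : E.Osc2) := rfl

theorem leg_cross {i j : ZMod 2} {z w : E.Osc} (hz : z ∈ E.oscGrading i)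
    (hw : w ∈ E.oscGrading j) : E.leg 1 w * E.leg 0 z = sgn (j * i) • (E.leg 0 z * E.leg 1 w) := by
  rw [leg_zero, leg_one, tmul_mul_tmul _ _ hz hw, one_mul, mul_one,
    GradedTensorProduct.tmul_one_mul_one_tmul]

theorem isOscPair_leg : E.IsOscPair (fun a => E.leg 0 (E.c a)) fun a => E.leg 1 (E.c a) where
  left a b := by rw [← map_mul, c_mul_c]; simp
  right a b := by rw [← map_mul, c_mul_c]; simp
  cross a b := by rw [E.leg_cross (E.c_mem a) (E.c_mem b), mul_comm (deg b)]; rfl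

/-! ### The invariants -/

/-- Each symmetrised product has its extra letter on the left or on the right, giving four
placements of the new pair around the old product. Equal total degrees of `a` and `b` make the
degree-dependent signs cancel up to powers of -ϵ. -/
theorem leg_symProd_cons_snoc (e f : Idx N M) (hef : deg e = deg f) {k : ℕ}
    (a b : Fin k → Idx N M) (hab : degSum a = degSum b) :
    E.leg 0 (E.symProd (Fin.cons e a : Fin (k + 1) → Idx N M)) *
        E.leg 1 (E.symProd (Fin.snoc b f : Fin (k + 1) → Idx N M)) =
      (1 / 4 : ℂ) • (E.leg 0 (E.c e) * (E.leg 0 (E.symProd a) * E.leg 1 (E.symProd b)) *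
          E.leg 1 (E.c f) +
        (-E.eps) ^ k • ((E.leg 0 (E.symProd a) * E.leg 1 (E.symProd b)) *
          (E.leg 0 (E.c e) * E.leg 1 (E.c f))) +
        (-E.eps) ^ k • ((E.leg 0 (E.c e) * E.leg 1 (E.c f)) *
          (E.leg 0 (E.symProd a) * E.leg 1 (E.symProd b))) +
        ks e f • (E.leg 1 (E.c f) * (E.leg 0 (E.symProd a) * E.leg 1 (E.symProd b)) *
          E.leg 0 (E.c e))) := by
  have h1 := E.leg_cross (E.c_mem e) (E.symProd_mem b)
  have h2 := E.leg_cross (E.symProd_mem a) (E.c_mem f)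
  have h3 := E.leg_cross (E.c_mem e) (E.c_mem f)
  rw [symProd_cons, symProd_snoc, qprod_eq, qprod_eq]
  simp only [map_smul, map_add, map_mul]
  have hk : ks e f = sgn (deg e * deg e) := by rw [ks, ← hef]
  rw [← hef, ← hab] at *
  rw [mul_comm (degSum a)] at h1
  generalize E.leg 0 (E.symProd a) = S at *
  generalize E.leg 1 (E.symProd b) = S' at *
  generalize E.leg 0 (E.c e) = X at *
  generalize E.leg 1 (E.c f) = Y at *
  have hs := sgn_mul_self (deg e * degSum a)
  have hp : (-E.eps) ^ k * (-E.eps) ^ k = (1 : ℂ) := by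
    rw [← mul_pow, neg_mul_neg, eps_mul_self, one_pow]
  have hk' := sgn_mul_self (deg e * deg e)
  have g2 : ∀ w, Y * (S * w) = sgn (deg e * degSum a) • (S * (Y * w)) := by
    intro w
    rw [← mul_assoc, h2, smul_mul_assoc, mul_assoc]
  have g3 : ∀ w, Y * (X * w) = sgn (deg e * deg e) • (X * (Y * w)) := by
    intro w
    rw [← mul_assoc, h3, smul_mul_assoc, mul_assoc]
  have g1 : ∀ w, S' * (X * w) = sgn (deg e * degSum a) • (X * (S' * w)) := by
    intro w
    rw [← mul_assoc, h1, smul_mul_assoc, mul_assoc]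
  rw [hk]
  simp only [mul_add, add_mul, smul_mul_assoc, mul_smul_comm, mul_assoc, h1, g2, g3, g1, smul_add,
    smul_smul]
  generalize sgn (deg e * degSum a) = z at *
  generalize sgn (deg e * deg e) = z' at *
  match_scalars
  · ring
  · ring
  · ring
  · linear_combination (1 / 4 * z * z) * hp - (1 / 4 * z * z) * hk'

/-- Peels off the pair (a_1, b_1): the second product is in reversed order, so a letter prepended to
`b` is appended there. -/
theorem invariant_succ (k : ℕ) :
    E.invariant (k + 1) = (1 / 4 : ℂ) • (
      (∑ e, ∑ f, E.low e f • (E.leg 0 (E.c e) * E.invariant k * E.leg 1 (E.c f))) +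
      (-E.eps) ^ k • (E.invariant k *
        E.contract (fun a => E.leg 0 (E.c a)) fun a => E.leg 1 (E.c a)) +
      (-E.eps) ^ k • (E.contract (fun a => E.leg 0 (E.c a)) (fun a => E.leg 1 (E.c a)) *
        E.invariant k) +
      ∑ e, ∑ f, (E.low e f * ks e f) •
        (E.leg 1 (E.c f) * E.invariant k * E.leg 0 (E.c e))) := by
  have hsum : ∀ φ : (Fin (k + 1) → Idx N M) → E.Osc2,
      ∑ a, φ a = ∑ e, ∑ a : Fin k → Idx N M, φ (Fin.cons e a) := by
    intro φ
    rw [← (Fin.consEquiv fun _ => Idx N M).sum_comp, Fintype.sum_prod_type]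
    rfl
  have hrev : ∀ (f : Idx N M) (b : Fin k → Idx N M),
      (fun i => (Fin.cons f b : Fin (k + 1) → Idx N M) (Fin.rev i)) =
        (Fin.snoc (fun i => b (Fin.rev i)) f : Fin (k + 1) → Idx N M) := by
    intro f b
    funext i
    refine Fin.lastCases ?_ (fun i => ?_) i
    · simp
    · simp [Fin.rev_castSucc]
  have hterm : ∀ (e f : Idx N M) (a b : Fin k → Idx N M),
      (E.low e f * ∏ i, E.low (a i) (b i)) •
        (E.leg 0 (E.symProd (Fin.cons e a : Fin (k + 1) → Idx N M)) *
          E.leg 1 (E.symProd (Fin.snoc (fun i => b (Fin.rev i)) f : Fin (k + 1) → Idx N M))) =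
      (1 / 4 : ℂ) • (
        E.low e f • (E.leg 0 (E.c e) * ((∏ i, E.low (a i) (b i)) •
          (E.leg 0 (E.symProd a) * E.leg 1 (E.symProd fun i => b (Fin.rev i)))) *
            E.leg 1 (E.c f)) +
        (-E.eps) ^ k • (((∏ i, E.low (a i) (b i)) •
          (E.leg 0 (E.symProd a) * E.leg 1 (E.symProd fun i => b (Fin.rev i)))) *
            E.low e f • (E.leg 0 (E.c e) * E.leg 1 (E.c f))) +
        (-E.eps) ^ k • (E.low e f • (E.leg 0 (E.c e) * E.leg 1 (E.c f)) *
          ((∏ i, E.low (a i) (b i)) •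
          (E.leg 0 (E.symProd a) * E.leg 1 (E.symProd fun i => b (Fin.rev i))))) +
        (E.low e f * ks e f) • (E.leg 1 (E.c f) * ((∏ i, E.low (a i) (b i)) •
          (E.leg 0 (E.symProd a) * E.leg 1 (E.symProd fun i => b (Fin.rev i)))) *
            E.leg 0 (E.c e))) := by
    intro e f a b
    rcases E.low_eq_zero_or e f with h | h
    · simp [h]
    by_cases h' : ∏ i, E.low (a i) (b i) = 0
    · simp [h']
    have hab : degSum a = degSum fun i => b (Fin.rev i) := by
      rw [degSum_rev]
      refine Finset.sum_congr rfl fun i _ => ?_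
      exact (E.low_eq_zero_or _ _).resolve_left (Finset.prod_ne_zero_iff.1 h' i (Finset.mem_univ i))
    rw [E.leg_symProd_cons_snoc e f h a _ hab]
    simp only [smul_mul_assoc, mul_smul_comm]
    module
  have hI : ∀ e f, ∑ a : Fin k → Idx N M, ∑ b : Fin k → Idx N M,
      (E.low e f * ∏ i, E.low (a i) (b i)) •
        (E.leg 0 (E.symProd (Fin.cons e a : Fin (k + 1) → Idx N M)) *
          E.leg 1 (E.symProd (Fin.snoc (fun i => b (Fin.rev i)) f : Fin (k + 1) → Idx N M))) =
      (1 / 4 : ℂ) • (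
        E.low e f • (E.leg 0 (E.c e) * E.invariant k * E.leg 1 (E.c f)) +
        (-E.eps) ^ k • (E.invariant k * E.low e f • (E.leg 0 (E.c e) * E.leg 1 (E.c f))) +
        (-E.eps) ^ k • (E.low e f • (E.leg 0 (E.c e) * E.leg 1 (E.c f)) * E.invariant k) +
        (E.low e f * ks e f) • (E.leg 1 (E.c f) * E.invariant k * E.leg 0 (E.c e))) := by
    intro e f
    simp only [hterm]
    simp only [invariant, Finset.mul_sum, Finset.sum_mul, Finset.smul_sum,
      ← Finset.sum_add_distrib]
  calc E.invariant (k + 1)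
      = ∑ e, ∑ f, ∑ a : Fin k → Idx N M, ∑ b : Fin k → Idx N M,
        (E.low e f * ∏ i, E.low (a i) (b i)) •
        (E.leg 0 (E.symProd (Fin.cons e a : Fin (k + 1) → Idx N M)) *
          E.leg 1 (E.symProd (Fin.snoc (fun i => b (Fin.rev i)) f : Fin (k + 1) → Idx N M))) := by
        rw [invariant, hsum]
        simp only [hsum, hrev, Fin.prod_univ_succ, Fin.cons_zero, Fin.cons_succ]
        exact Finset.sum_congr rfl fun e _ => Finset.sum_comm
    _ = _ := by
        simp only [hI, contract]
        generalize E.invariant k = I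
        simp only [Finset.mul_sum, Finset.sum_mul, Finset.smul_sum, ← Finset.sum_add_distrib]

/-- The sign relating the invariants to polynomials in the first one. -/
def chi (E : SuperMetric N M ϵ) (k : ℕ) : ℂ := ∏ i ∈ Finset.range k, (-E.eps) ^ i

theorem chi_mul_self (k : ℕ) : E.chi k * E.chi k = 1 := by
  rw [chi, ← Finset.prod_mul_distrib]
  refine Finset.prod_eq_one fun i _ => ?_
  rw [← mul_pow, neg_mul_neg, eps_mul_self, one_pow]

theorem chi_add_two (k : ℕ) : E.chi (k + 2) = -E.eps * E.chi k := by
  rw [chi, Finset.prod_range_succ, Finset.prod_range_succ, ← chi, pow_succ]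
  have hp : (-E.eps) ^ k * (-E.eps) ^ k = (1 : ℂ) := by
    rw [← mul_pow, neg_mul_neg, eps_mul_self, one_pow]
  linear_combination (-E.eps * E.chi k) * hp

/-- The contraction of the two families of super-oscillators. -/
def firstInv : E.Osc2 := E.contract (fun a => E.leg 0 (E.c a)) fun a => E.leg 1 (E.c a)

/-- In `invariant_succ` two placements give products with s, namely J_{k+1} + κ_k J_{k-1} each, and
two enclose J_k and give J_{k+1} - κ_k J_{k-1} each. All carry (-ϵ)^k, so the lower terms cancel and
χ_k picks up this factor. -/
theorem invariant_eq (k : ℕ) :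
    E.invariant k = E.chi k • invPoly E.eps E.omega E.firstInv k := by
  induction k with
  | zero =>
    simp [invariant, chi, invPoly, symProd_eq_nested, nested]
  | succ k ih =>
    have h1 := E.isOscPair_leg.contract_invPoly k
    have h2 := E.isOscPair_leg.contract_invPoly' k
    have hp : (-E.eps) ^ k * (-E.eps) ^ k = (1 : ℂ) := by
      rw [← mul_pow, neg_mul_neg, eps_mul_self, one_pow]
    have hc : invPoly E.eps E.omega E.firstInv k * E.firstInv =
        E.firstInv * invPoly E.eps E.omega E.firstInv k :=
      (commute_invPoly _ _ (Commute.refl _) k).eq.symm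
    rw [invariant_succ, ih, ← firstInv] at *
    have hs := invPoly_succ E.eps E.omega E.firstInv k
    simp only [mul_smul_comm, smul_mul_assoc, smul_comm _ (E.chi k), ← Finset.smul_sum, hc]
    have h1' := congrArg (fun z => (-E.eps) ^ k • z) h1
    have h2' := congrArg (fun z => (-E.eps) ^ k • z) h2
    simp only [smul_smul, hp, one_smul] at h1' h2'
    have hchi : E.chi (k + 1) = E.chi k * (-E.eps) ^ k := Finset.prod_range_succ _ _
    rw [h1', h2', hs, hchi]
    module

/-! ### Spans of super-symmetrised monomials -/

/-- The span of the super-symmetrised monomials of bidegree `(k, l)` and parity `d`. -/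
def monSpan (k l : ℕ) (d : ZMod 2) : Submodule ℂ E.Osc2 :=
  Submodule.span ℂ {z | ∃ (a : Fin k → Idx N M) (b : Fin l → Idx N M), degSum a + degSum b = d ∧
    z = E.leg 0 (E.symProd a) * E.leg 1 (E.symProd b)}

theorem mem_monSpan {k l : ℕ} {d : ZMod 2} (a : Fin k → Idx N M) (b : Fin l → Idx N M)
    (h : degSum a + degSum b = d) :
    E.leg 0 (E.symProd a) * E.leg 1 (E.symProd b) ∈ E.monSpan k l d :=
  Submodule.subset_span ⟨a, b, h, rfl⟩

/-- Symmetrised multiplication by an oscillator raises the degree by exactly one, with no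
lower-order terms, because it is the recursion `symProd_cons`. -/
theorem symm_mul_right_mem {k l : ℕ} {d : ZMod 2} (e : Idx N M) {w : E.Osc2}
    (hw : w ∈ E.monSpan k l d) :
    (1 / 2 : ℂ) • (E.leg 1 (E.c e) * w +
      ((-E.eps) ^ l * sgn (deg e * d)) • (w * E.leg 1 (E.c e))) ∈
      E.monSpan k (l + 1) (d + deg e) := by
  induction hw using Submodule.span_induction with
  | mem z hz =>
    obtain ⟨a, b, hd, rfl⟩ := hz
    have h : (1 / 2 : ℂ) • (E.leg 1 (E.c e) * (E.leg 0 (E.symProd a) * E.leg 1 (E.symProd b)) +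
        ((-E.eps) ^ l * sgn (deg e * d)) •
          (E.leg 0 (E.symProd a) * E.leg 1 (E.symProd b) * E.leg 1 (E.c e))) =
        sgn (deg e * degSum a) • (E.leg 0 (E.symProd a) *
          E.leg 1 (E.symProd (Fin.cons e b : Fin (l + 1) → Idx N M))) := by
      rw [symProd_cons, qprod_eq, ← hd, mul_add, sgn_add, ← mul_assoc,
        E.leg_cross (E.symProd_mem a) (E.c_mem e)]
      simp only [map_smul, map_add, map_mul, mul_add, mul_smul_comm, smul_mul_assoc, mul_assoc]
      module
    rw [h]
    refine Submodule.smul_mem _ _ (E.mem_monSpan _ _ ?_)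
    rw [degSum_cons, ← hd]
    ring
  | zero => simp
  | add x y _ _ hx hy =>
    have := Submodule.add_mem _ hx hy
    rw [mul_add, add_mul]
    convert this using 1
    module
  | smul c x _ hx =>
    have := Submodule.smul_mem _ c hx
    rw [mul_smul_comm, smul_mul_assoc]
    convert this using 1
    module

theorem symm_mul_left_mem {k l : ℕ} {d : ZMod 2} (e : Idx N M) {w : E.Osc2}
    (hw : w ∈ E.monSpan k l d) :
    (1 / 2 : ℂ) • (E.leg 0 (E.c e) * w +
      ((-E.eps) ^ k * sgn (deg e * d)) • (w * E.leg 0 (E.c e))) ∈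
      E.monSpan (k + 1) l (d + deg e) := by
  induction hw using Submodule.span_induction with
  | mem z hz =>
    obtain ⟨a, b, hd, rfl⟩ := hz
    have hs := sgn_mul_self (deg e * degSum b)
    have h : (1 / 2 : ℂ) • (E.leg 0 (E.c e) * (E.leg 0 (E.symProd a) * E.leg 1 (E.symProd b)) +
        ((-E.eps) ^ k * sgn (deg e * d)) •
          (E.leg 0 (E.symProd a) * E.leg 1 (E.symProd b) * E.leg 0 (E.c e))) =
        E.leg 0 (E.symProd (Fin.cons e a : Fin (k + 1) → Idx N M)) *
          E.leg 1 (E.symProd b) := by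
      rw [symProd_cons, qprod_eq, ← hd, mul_add, sgn_add, mul_assoc (E.leg 0 (E.symProd a)),
        E.leg_cross (E.c_mem e) (E.symProd_mem b), mul_comm (degSum b)]
      simp only [map_smul, map_add, map_mul, add_mul, mul_smul_comm, smul_mul_assoc, mul_assoc]
      match_scalars
      · ring
      · linear_combination ((-E.eps) ^ k * sgn (deg e * degSum a) / 2) * hs
    rw [h]
    refine E.mem_monSpan _ _ ?_
    rw [degSum_cons, ← hd]
    ring
  | zero => simp
  | add x y _ _ hx hy =>
    have := Submodule.add_mem _ hx hy
    rw [mul_add, add_mul]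
    convert this using 1
    module
  | smul c x _ hx =>
    have := Submodule.smul_mem _ c hx
    rw [mul_smul_comm, smul_mul_assoc]
    convert this using 1
    module

theorem invPoly_mem (k : ℕ) : invPoly E.eps E.omega E.firstInv k ∈ E.monSpan k k 0 := by
  have h : invPoly E.eps E.omega E.firstInv k = E.chi k • E.invariant k := by
    rw [invariant_eq, smul_smul, chi_mul_self, one_smul]
  rw [h, invariant]
  refine Submodule.smul_mem _ _ (Submodule.sum_mem _ fun a _ => Submodule.sum_mem _ fun b _ => ?_)
  by_cases h' : ∏ i, E.low (a i) (b i) = 0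
  · simp [h']
  refine Submodule.smul_mem _ _ (E.mem_monSpan _ _ ?_)
  have hab : degSum a = degSum b := by
    refine Finset.sum_congr rfl fun i _ => ?_
    exact (E.low_eq_zero_or _ _).resolve_left (Finset.prod_ne_zero_iff.1 h' i (Finset.mem_univ i))
  rw [degSum_rev, hab]
  exact CharTwo.add_self_eq_zero _

theorem twSum₂_right_mem (k : ℕ) (a b : Idx N M) :
    E.twSum₂ E.firstInv (fun a => E.leg 1 (E.c a)) k a b ∈
      E.monSpan k (k + 2) (deg b + deg a) := by
  have h1 := E.symm_mul_right_mem b (E.invPoly_mem k)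
  rw [mul_zero, sgn_zero, mul_one, zero_add] at h1
  have h2 := E.symm_mul_right_mem a h1
  -- The second multiplication acts at degree k + 1, so its sign is (-ϵ)^k times `E.q a b`, as in
  -- `twSum₂`.
  rw [pow_succ, ← ks, mul_assoc, ← q, mul_comm] at h2
  exact h2

theorem twSum₂_left_mem (k : ℕ) (a b : Idx N M) :
    E.twSum₂ E.firstInv (fun a => E.leg 0 (E.c a)) k a b ∈
      E.monSpan (k + 2) k (deg b + deg a) := by
  have h1 := E.symm_mul_left_mem b (E.invPoly_mem k)
  rw [mul_zero, sgn_zero, mul_one, zero_add] at h1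
  have h2 := E.symm_mul_left_mem a h1
  rw [pow_succ, ← ks, mul_assoc, ← q, mul_comm] at h2
  exact h2

end SuperMetric

/-! ### Homomorphic images, and the generators with signs absorbed -/

namespace SuperMetric

variable {N M : ℕ} {ϵ : ℤˣ} {E : SuperMetric N M ϵ}

variable {R S : Type*} [Ring R] [Algebra ℂ R] [Ring S] [Algebra ℂ S]

theorem IsOspFamily.map {g : Idx N M → Idx N M → R} (hg : E.IsOspFamily g) (φ : R →ₐ[ℂ] S) :
    E.IsOspFamily fun a b => φ (g a b) where
  symm a b := by
    rw [← map_smul, ← hg.symm]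
  comm a b c d := by
    simpa only [map_sub, map_mul, map_smul, map_add] using congrArg φ (hg.comm a b c d)
  cyclic a b c d := by
    simpa only [map_add, map_mul, map_smul, map_zero] using congrArg φ (hg.cyclic a b c d)

theorem IsOscPair.map {x y : Idx N M → R} (h : E.IsOscPair x y) (φ : R →ₐ[ℂ] S) :
    E.IsOscPair (fun a => φ (x a)) fun a => φ (y a) where
  left a b := by
    simpa only [map_add, map_mul, map_smul, map_one] using congrArg φ (h.left a b)
  right a b := by
    simpa only [map_add, map_mul, map_smul, map_one] using congrArg φ (h.right a b)
  cross a b := by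
    simpa only [map_mul, map_smul] using congrArg φ (h.cross a b)

theorem map_contract (φ : R →ₐ[ℂ] S) (x y : Idx N M → R) :
    φ (E.contract x y) = E.contract (fun a => φ (x a)) fun a => φ (y a) := by
  simp only [contract, map_sum, map_smul, map_mul]

theorem _root_.OSp.map_invPoly (φ : R →ₐ[ℂ] S) (e ω : ℂ) (s : R) (k : ℕ) :
    φ (invPoly e ω s k) = invPoly e ω (φ s) k := by
  induction k using Nat.strong_induction_on with
  | _ k ih =>
  rcases k with _ | k
  · simp [invPoly]
  · rw [invPoly_succ, invPoly_succ, map_sub, map_mul, map_smul, ih k (by omega),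
      ih (k - 1) (by omega)]

theorem map_twSum₂ (φ : R →ₐ[ℂ] S) (s : R) (w : Idx N M → R) (k : ℕ) (a b : Idx N M) :
    φ (E.twSum₂ s w k a b) = E.twSum₂ (φ s) (fun a => φ (w a)) k a b := by
  simp only [twSum₂, twSum, map_smul, map_add, map_mul, map_invPoly]

section Generators

variable {𝒴 : ZMod 2 → Submodule ℂ R} {G : Idx N M → Idx N M → R}

/-- The generators `G_{ab}` with a sign absorbed. -/
def twistG (G : Idx N M → Idx N M → R) (a b : Idx N M) : R := sgn (deg a) • G a b

theorem sum_low_raise {V : Type*} [AddCommGroup V] [Module ℂ V] (v : Idx N M → V)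
    (a : Idx N M) : ∑ b, E.low a b • ∑ d, E.up b d • v d = v a := by
  simp only [Finset.smul_sum, smul_smul]
  rw [Finset.sum_comm]
  simp only [← Finset.sum_smul, sum_low_up, ite_smul, one_smul, zero_smul]
  simp

/-- Lowers both raised indices with the metric; since the metric is even, the signs do not notice.
-/
theorem IsOspGenerators.supercomm_lower (hG : E.IsOspGenerators 𝒴 G) (d₁ c₁ d₂ c₂ : Idx N M) :
    sgn (deg c₁ * (deg d₂ + deg c₂)) •
        (G d₁ c₁ * G d₂ c₂ -
          sgn ((deg d₁ + deg c₁) * (deg d₂ + deg c₂)) • (G d₂ c₂ * G d₁ c₁)) =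
      (E.eps * sgn (deg c₁ * deg c₂) * E.low d₂ c₁) • G d₁ c₂ -
      (E.eps * sgn (deg d₁ * deg d₂) * E.low d₁ c₂) • G d₂ c₁ +
      (E.eps * sgn (deg c₂) * E.low d₂ d₁) • G c₂ c₁ -
      (E.eps * sgn (deg d₂) * E.low c₁ c₂) • G d₁ d₂ := by
  have hr : ∀ d c, ∑ a, E.low d a • E.raiseFst G a c = G d c := fun d c =>
    E.sum_low_raise (fun e => G e c) d
  have hb : ∀ a d, ∑ b, E.low d b • E.raiseBoth G a b = E.raiseFst G a d := fun a d =>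
    E.sum_low_raise (fun e => E.raiseFst G a e) d
  have h := Finset.sum_congr (rfl : (Finset.univ : Finset (Idx N M)) = Finset.univ) fun a₁ _ =>
    Finset.sum_congr (rfl : (Finset.univ : Finset (Idx N M)) = Finset.univ) fun a₂ _ =>
      congrArg (fun z => (E.low d₁ a₁ * E.low d₂ a₂) • z) (hG.supercomm a₁ c₁ a₂ c₂)
  have hl : ∀ a₁ a₂, (E.low d₁ a₁ * E.low d₂ a₂) • (sgn (deg c₁ * (deg a₂ + deg c₂)) •
        (E.raiseFst G a₁ c₁ * E.raiseFst G a₂ c₂ -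
          sgn ((deg a₁ + deg c₁) * (deg a₂ + deg c₂)) •
            (E.raiseFst G a₂ c₂ * E.raiseFst G a₁ c₁))) =
      sgn (deg c₁ * (deg d₂ + deg c₂)) •
        ((E.low d₁ a₁ • E.raiseFst G a₁ c₁) * (E.low d₂ a₂ • E.raiseFst G a₂ c₂) -
          sgn ((deg d₁ + deg c₁) * (deg d₂ + deg c₂)) •
            ((E.low d₂ a₂ • E.raiseFst G a₂ c₂) * (E.low d₁ a₁ • E.raiseFst G a₁ c₁))) := by
    intro a₁ a₂
    rcases E.low_eq_zero_or d₁ a₁ with h1 | h1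
    · simp [h1]
    rcases E.low_eq_zero_or d₂ a₂ with h2 | h2
    · simp [h2]
    rw [h1, h2]
    simp only [smul_mul_assoc, mul_smul_comm]
    module
  have hr' : ∀ a₁ a₂, (E.low d₁ a₁ * E.low d₂ a₂) • (
      (E.eps * sgn (deg c₁ * deg c₂) * (if a₂ = c₁ then 1 else 0)) • E.raiseFst G a₁ c₂ -
      (E.eps * sgn (deg a₁ * deg a₂) * (if a₁ = c₂ then 1 else 0)) • E.raiseFst G a₂ c₁ +
      (E.eps * sgn (deg c₂) * E.up a₁ a₂) • G c₂ c₁ -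
      (E.eps * sgn (deg a₂) * E.low c₁ c₂) • E.raiseBoth G a₁ a₂) =
      (E.eps * sgn (deg c₁ * deg c₂) * (E.low d₂ a₂ * if a₂ = c₁ then 1 else 0)) •
        (E.low d₁ a₁ • E.raiseFst G a₁ c₂) -
      (E.eps * sgn (deg d₁ * deg d₂) * (E.low d₁ a₁ * if a₁ = c₂ then 1 else 0)) •
        (E.low d₂ a₂ • E.raiseFst G a₂ c₁) +
      (E.eps * sgn (deg c₂) * (E.low d₂ a₂ * (E.low d₁ a₁ * E.up a₁ a₂))) • G c₂ c₁ -
      (E.eps * sgn (deg d₂) * E.low c₁ c₂) •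
        E.low d₁ a₁ • E.low d₂ a₂ • E.raiseBoth G a₁ a₂ := by
    intro a₁ a₂
    rcases E.low_eq_zero_or d₁ a₁ with h1 | h1
    · simp [h1]
    rcases E.low_eq_zero_or d₂ a₂ with h2 | h2
    · simp [h2]
    rw [h1, h2]
    module
  simp only [hl, hr', Finset.sum_sub_distrib, Finset.sum_add_distrib, ← Finset.smul_sum,
    ← Finset.mul_sum, ← Finset.sum_mul, hr, hb, ← Finset.sum_smul] at h
  rw [h]
  have h4 : ∑ a₁, ∑ a₂, E.low d₂ a₂ * (E.low d₁ a₁ * E.up a₁ a₂) = E.low d₂ d₁ := by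
    rw [Finset.sum_comm]
    simp only [← Finset.mul_sum, sum_low_up]
    simp
  rw [h4]
  simp only [mul_ite, mul_one, mul_zero, Finset.sum_ite_eq', Finset.mem_univ, if_true]

theorem IsOspGenerators.twistG_symm (hG : E.IsOspGenerators 𝒴 G) (a b : Idx N M) :
    twistG G a b = E.q a b • twistG G b a := by
  have h := eq_neg_of_add_eq_zero_left (hG.symmetry a b)
  rw [twistG, twistG, h, sgn_add, sgn_add, ← ks, q]
  match_scalars
  linear_combination (-E.eps * ks a b * sgn (deg b)) * sgn_mul_self (deg a)

theorem IsOspGenerators.twistG_comm (hG : E.IsOspGenerators 𝒴 G) (a b c d : Idx N M) :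
    twistG G a b * twistG G c d - ks₂ a b c d • (twistG G c d * twistG G a b) =
    E.eps • (E.low c b • twistG G a d + (E.q b c * E.low d b) • twistG G a c +
      (E.q a b * E.low c a) • twistG G b d +
      (E.q a b * E.q a c * E.low d a) • twistG G b c) := by
  -- This factor cancels the sign in front of the supercommutator and supplies the signs absorbed in
  -- `twistG`.
  have h := congrArg (fun z => (ks b c * ks b d * (sgn (deg a) * sgn (deg c))) • z)
    (hG.supercomm_lower a b c d)
  have hl : (ks b c * ks b d * (sgn (deg a) * sgn (deg c))) •
      (sgn (deg b * (deg c + deg d)) •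
        (G a b * G c d - sgn ((deg a + deg b) * (deg c + deg d)) • (G c d * G a b))) =
      twistG G a b * twistG G c d - ks₂ a b c d • (twistG G c d * twistG G a b) := by
    have h1 : sgn ((deg a + deg b) * (deg c + deg d)) = ks₂ a b c d := by
      rw [add_mul, sgn_add, sgn_mul_add, sgn_mul_add, ks₂]
    have h2 : ks b c * ks b d * (ks b c * ks b d) = 1 := by
      linear_combination (ks b d * ks b d) * ks_mul_self b c + ks_mul_self b d
    rw [h1, sgn_mul_add]
    simp only [twistG, smul_mul_assoc, mul_smul_comm]
    match_scalars
    · linear_combination (sgn (deg a) * sgn (deg c)) * h2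
    · linear_combination (-sgn (deg a) * sgn (deg c) * ks₂ a b c d) * h2
  simp only [hl] at h
  rw [h]
  have hG' : ∀ a b, G a b = sgn (deg a) • twistG G a b := by
    intro a b
    rw [twistG, smul_smul, sgn_mul_self, one_smul]
  have t1 : ks b c * ks b d * (sgn (deg a) * sgn (deg c)) *
      (E.eps * sgn (deg b * deg d) * E.low c b) * sgn (deg a) = E.eps * E.low c b := by
    rcases E.low_eq_zero_or c b with h | h
    · simp [h]
    · rw [← ks, ks_congr_left h.symm c, ks_self]
      linear_combination (E.eps * E.low c b * ks b d * ks b d * sgn (deg a) * sgn (deg a)) *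
        sgn_mul_self (deg c) + (E.eps * E.low c b * ks b d * ks b d) * sgn_mul_self (deg a) +
        (E.eps * E.low c b) * ks_mul_self b d
  have t2 : -(ks b c * ks b d * (sgn (deg a) * sgn (deg c)) *
      (E.eps * sgn (deg a * deg c) * E.low a d) * sgn (deg c)) * E.q c b =
      E.eps * (E.q a b * E.q a c * E.low d a) := by
    rcases E.low_eq_zero_or d a with h | h
    · rw [E.low_symm a d, h]
      simp
    · rw [← ks, E.low_symm a d, ks_congr_right h b, ks_congr_right h a, ks_self, q, q, q,
        ks_comm c b, ks_comm b a]
      linear_combination (E.eps * E.eps * E.eps * ks b c * ks b c * ks a b * sgn (deg a) *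
        sgn (deg a) * ks a c * E.low d a) * sgn_mul_self (deg c) +
        (E.eps * E.eps * E.eps * ks b c * ks b c * ks a b * ks a c * E.low d a) *
          sgn_mul_self (deg a) +
        (E.eps * E.eps * E.eps * ks a b * ks a c * E.low d a) * ks_mul_self b c
  have t3 : ks b c * ks b d * (sgn (deg a) * sgn (deg c)) *
      (E.eps * sgn (deg d) * E.low c a) * sgn (deg d) * E.q d b =
      E.eps * (E.q a b * E.low c a) := by
    rcases E.low_eq_zero_or c a with h | h
    · simp [h]
    · rw [h, ks_congr_right h, q, q, ks_comm d b, ks_comm b a]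
      linear_combination (-E.eps * E.eps * ks a b * ks b d * ks b d * E.low c a) *
        (sgn (deg d) * sgn (deg d) * sgn_mul_self (deg a) + sgn_mul_self (deg d)) -
        (E.eps * E.eps * ks a b * E.low c a) * ks_mul_self b d
  have t4 : -(ks b c * ks b d * (sgn (deg a) * sgn (deg c)) *
      (E.eps * sgn (deg c) * E.low b d) * sgn (deg a)) = E.eps * (E.q b c * E.low d b) := by
    rcases E.low_eq_zero_or d b with h | h
    · rw [E.low_symm b d, h]
      simp
    · rw [E.low_symm b d, ks_congr_right h, ks_self, q]
      linear_combination (-E.eps * E.eps * ks b c * sgn (deg b) * sgn (deg b) * E.low d b) *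
        (sgn (deg c) * sgn (deg c) * sgn_mul_self (deg a) + sgn_mul_self (deg c)) -
        (E.eps * E.eps * ks b c * E.low d b) * sgn_mul_self (deg b)
  rw [hG' a d, hG' c b, hG' d b, hG' a c, hG.twistG_symm c b, hG.twistG_symm d b]
  match_scalars
  · linear_combination t1
  · linear_combination t2
  · linear_combination t3
  · linear_combination t4

theorem sum_perm_three {V : Type*} [AddCommMonoid V] (f : Equiv.Perm (Fin 3) → V) :
    ∑ σ, f σ = f 1 + f (Equiv.swap 0 1) + f (Equiv.swap 1 2) + f (Equiv.swap 0 2) +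
      f (Equiv.swap 0 1 * Equiv.swap 1 2) + f (Equiv.swap 1 2 * Equiv.swap 0 1) := by
  have h : (Finset.univ : Finset (Equiv.Perm (Fin 3))) = {1, Equiv.swap 0 1, Equiv.swap 1 2,
      Equiv.swap 0 2, Equiv.swap 0 1 * Equiv.swap 1 2, Equiv.swap 1 2 * Equiv.swap 0 1} := by
    decide
  rw [h, Finset.sum_insert (by decide), Finset.sum_insert (by decide),
    Finset.sum_insert (by decide), Finset.sum_insert (by decide), Finset.sum_insert (by decide),
    Finset.sum_singleton]
  simp only [add_assoc]

/-- The super-anticommutator of the generators with signs absorbed. -/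
def twistAnticomm (G : Idx N M → Idx N M → R) (p q r a : Idx N M) : R :=
  twistG G p q * twistG G r a + ks₂ p q r a • (twistG G r a * twistG G p q)

theorem superAnticomm_eq (G : Idx N M → Idx N M → R) (p q r a : Idx N M) :
    superAnticomm G p q r a = (sgn (deg p) * sgn (deg r)) • twistAnticomm G p q r a := by
  have h1 : sgn ((deg p + deg q) * (deg r + deg a)) = ks₂ p q r a := by
    rw [add_mul, sgn_add, sgn_mul_add, sgn_mul_add, ks₂]
  have h2 : sgn (deg p) * sgn (deg r) * (sgn (deg p) * sgn (deg r)) = 1 := by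
    linear_combination (sgn (deg r) * sgn (deg r)) * sgn_mul_self (deg p) +
      sgn_mul_self (deg r)
  rw [superAnticomm, twistAnticomm, h1]
  simp only [twistG, smul_mul_assoc, mul_smul_comm]
  match_scalars
  · linear_combination -h2
  · linear_combination -ks₂ p q r a * h2

theorem IsOspGenerators.twistAnticomm_swap (hG : E.IsOspGenerators 𝒴 G) (p q r a : Idx N M) :
    twistAnticomm G q p r a = E.q p q • twistAnticomm G p q r a := by
  rw [twistAnticomm, twistAnticomm, hG.twistG_symm q p, ks₂_swap, E.q_comm q p]
  simp only [smul_mul_assoc, mul_smul_comm]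
  module

/-- The anticommutator is graded-symmetric in its first index pair, so the six permutations coincide
in pairs and three terms remain. -/
theorem twistAnticomm_cyclic (hG : E.IsOspGenerators 𝒴 G) (hGG : E.SymAnticommVanishes G)
    (a b c d : Idx N M) :
    twistAnticomm G d c b a + (E.q b d * E.q b c) • twistAnticomm G b d c a +
      (E.q d b * E.q d c) • twistAnticomm G c b d a = 0 := by
  have hq : ∀ p r : Idx N M, -E.eps * sgn (deg p * deg r + deg p + deg r) =
      E.q p r * (sgn (deg p) * sgn (deg r)) := by
    intro p r
    rw [sgn_add, sgn_add, q, ks]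
    ring
  have h := hGG ![d, c, b] a
  rw [smul_eq_zero, or_iff_right (by simp [Nat.factorial])] at h
  rw [sum_perm_three] at h
  simp only [reorderSignG, Fin.prod_univ_three, superAnticomm_eq, hq] at h
  have e1 : (Equiv.swap 0 1 : Equiv.Perm (Fin 3)) 0 = 1 := by decide
  have e2 : (Equiv.swap 0 1 : Equiv.Perm (Fin 3)) 1 = 0 := by decide
  have e3 : (Equiv.swap 0 1 : Equiv.Perm (Fin 3)) 2 = 2 := by decide
  have e4 : (Equiv.swap 1 2 : Equiv.Perm (Fin 3)) 0 = 0 := by decide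
  have e5 : (Equiv.swap 1 2 : Equiv.Perm (Fin 3)) 1 = 2 := by decide
  have e6 : (Equiv.swap 1 2 : Equiv.Perm (Fin 3)) 2 = 1 := by decide
  have e7 : (Equiv.swap 0 2 : Equiv.Perm (Fin 3)) 0 = 2 := by decide
  have e8 : (Equiv.swap 0 2 : Equiv.Perm (Fin 3)) 1 = 1 := by decide
  have e9 : (Equiv.swap 0 2 : Equiv.Perm (Fin 3)) 2 = 0 := by decide
  simp [e1, e2, e3, e4, e5, e6, e7, e8, e9, -Equiv.swap_apply_left, -Equiv.swap_apply_right] at h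
  rw [hG.twistAnticomm_swap d c, hG.twistAnticomm_swap b d, hG.twistAnticomm_swap c b,
    E.q_comm d c, E.q_comm c b] at h
  have hs : sgn (deg d) * sgn (deg b) * (sgn (deg d) * sgn (deg b)) = 1 := by
    linear_combination (sgn (deg b) * sgn (deg b)) * sgn_mul_self (deg d) + sgn_mul_self (deg b)
  have hb := sgn_mul_self (deg b)
  have hc := sgn_mul_self (deg c)
  have hd := sgn_mul_self (deg d)
  have hbc := E.q_mul_self b c
  have hcd := E.q_mul_self c d
  have k1 : E.q c d * (sgn (deg c) * sgn (deg d)) * (sgn (deg c) * sgn (deg b)) * E.q c d =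
      sgn (deg d) * sgn (deg b) := by
    linear_combination (sgn (deg d) * sgn (deg b) * sgn (deg c) * sgn (deg c)) * hcd +
      (sgn (deg d) * sgn (deg b)) * hc
  have k2 : E.q b c * (sgn (deg b) * sgn (deg c)) * (sgn (deg d) * sgn (deg c)) * E.q b d =
      sgn (deg d) * sgn (deg b) * (E.q b d * E.q b c) := by
    linear_combination (sgn (deg d) * sgn (deg b) * (E.q b d * E.q b c)) * hc
  have k3 : E.q b c * (sgn (deg b) * sgn (deg c)) * (E.q b d * (sgn (deg b) * sgn (deg d))) *
      (E.q c d * (sgn (deg c) * sgn (deg d))) * (sgn (deg b) * sgn (deg d)) * E.q b c =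
      sgn (deg d) * sgn (deg b) * (E.q b d * E.q c d) := by
    linear_combination (sgn (deg d) * sgn (deg b) * (E.q b d * E.q c d)) *
      (sgn (deg b) * sgn (deg b) * (sgn (deg d) * sgn (deg d)) * (E.q b c * E.q b c) * hc +
        sgn (deg b) * sgn (deg b) * (sgn (deg d) * sgn (deg d)) * hbc +
        sgn (deg b) * sgn (deg b) * hd + hb)
  have k4 : E.q c d * (sgn (deg c) * sgn (deg d)) * (E.q b d * (sgn (deg b) * sgn (deg d))) *
      (sgn (deg c) * sgn (deg d)) = sgn (deg d) * sgn (deg b) * (E.q b d * E.q c d) := by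
    linear_combination (sgn (deg d) * sgn (deg b) * (E.q b d * E.q c d)) *
      (sgn (deg d) * sgn (deg d) * hc + hd)
  have k5 : E.q b d * (sgn (deg b) * sgn (deg d)) * (E.q b c * (sgn (deg b) * sgn (deg c))) *
      (sgn (deg b) * sgn (deg c)) = sgn (deg d) * sgn (deg b) * (E.q b d * E.q b c) := by
    linear_combination (sgn (deg d) * sgn (deg b) * (E.q b d * E.q b c)) *
      (sgn (deg b) * sgn (deg b) * hc + hb)
  rw [E.q_comm d b, E.q_comm d c]
  -- The ½ accounts for each term occurring twice; the signs undo the common sign left by the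
  -- absorption.
  have h' := congrArg (fun z => (1 / 2 * (sgn (deg d) * sgn (deg b))) • z) h
  simp only [smul_zero] at h'
  rw [← h']
  match_scalars
  · linear_combination -hs - (1 / 2 * (sgn (deg d) * sgn (deg b))) * k1
  · linear_combination (-(E.q b d * E.q b c)) * hs -
      (1 / 2 * (sgn (deg d) * sgn (deg b))) * (k2 + k5)
  · linear_combination (-(E.q b d * E.q c d)) * hs -
      (1 / 2 * (sgn (deg d) * sgn (deg b))) * (k3 + k4)

theorem IsOspGenerators.isOspFamily (hG : E.IsOspGenerators 𝒴 G)
    (hGG : E.SymAnticommVanishes G) : E.IsOspFamily (twistG G) where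
  symm := hG.twistG_symm
  comm := hG.twistG_comm
  cyclic := twistAnticomm_cyclic hG hGG

end Generators

end SuperMetric

/-! ### Assembly of the spinorial relation -/

/-- The scalar terms cancel, v multiplies only [Z, X_1 + X_2] = 0, and the same commutator
symmetrises the term in u. -/
theorem rll_difference {R : Type*} [Ring R] [Algebra ℂ R] {Z X₁ X₂ : R}
    (h : Commute Z (X₁ + X₂)) (u v : ℂ) :
    Z * ((u + v) • (1 : R) - (1 / 2 : ℂ) • X₁) * (v • (1 : R) - (1 / 2 : ℂ) • X₂) -
      (v • (1 : R) - (1 / 2 : ℂ) • X₁) * ((u + v) • (1 : R) - (1 / 2 : ℂ) • X₂) * Z =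
    (1 / 4 : ℂ) • (Z * (X₁ * X₂) - X₁ * X₂ * Z - u • (Z * (X₂ - X₁) + (X₂ - X₁) * Z)) := by
  have h' := h.eq
  simp only [mul_add, add_mul, mul_sub, sub_mul, mul_smul_comm, smul_mul_assoc, mul_one, one_mul,
    smul_sub, smul_add, smul_smul, mul_assoc] at h' ⊢
  linear_combination (norm := module) (-(1 / 2 * v + 1 / 4 * u)) • h'

namespace SuperMetric

variable {N M : ℕ} {ϵ : ℤˣ} {E : SuperMetric N M ϵ}

/-- The term of index k + 2 cancels the T_k left by index k: (k+2)(k+1) adjusts the factorial,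
χ_{k+2} = -ϵ χ_k the sign, and the recurrence does the rest. For k = 0, 1 the factor k(k-1) removes
the truncated index. -/
theorem sum_telescope {V : Type*} [AddCommGroup V] [Module ℂ V] {r : ℕ → ℂ} {u : ℂ}
    (hr : Recurrence E.omega u r) (T : ℕ → V) (K : ℕ) :
    ∑ k ∈ Finset.range (K + 2), (r k / (k.factorial : ℂ) * E.chi k) • ((-2 * (u - k)) • T k -
        (1 / 2 * E.eps * k * (k - 1) * (k + u - E.omega)) • T (k - 2)) =
      (r (K + 1) / ((K + 1).factorial : ℂ) * E.chi (K + 1) * (-2 * (u - (K + 1 : ℕ)))) • T (K + 1) +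
        (r K / (K.factorial : ℂ) * E.chi K * (-2 * (u - K))) • T K := by
  induction K with
  | zero =>
    simp [Finset.sum_range_succ]
    module
  | succ K ih =>
    rw [Finset.sum_range_succ, ih, show K + 1 + 1 = K + 2 from rfl, Nat.add_sub_cancel, chi_add_two]
    have h1 : (K.factorial : ℂ) ≠ 0 := Nat.cast_ne_zero.2 K.factorial_ne_zero
    have h2 : ((K + 2).factorial : ℂ) = (K + 2) * ((K + 1) * K.factorial) := by
      rw [Nat.factorial_succ, Nat.factorial_succ]
      push_cast
      ring
    have h3 : (K : ℂ) + 1 ≠ 0 := Nat.cast_add_one_ne_zero K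
    have h4 : (K : ℂ) + 2 ≠ 0 := by
      have := Nat.cast_add_one_ne_zero (R := ℂ) (K + 1)
      push_cast at this
      rwa [add_assoc, one_add_one_eq_two] at this
    have hK := hr K
    have h5 : r (K + 2) / ((K + 2).factorial : ℂ) * (-E.eps * E.chi K) *
        (1 / 2 * E.eps * (K + 2 : ℕ) * ((K + 2 : ℕ) - 1) * ((K + 2 : ℕ) + u - E.omega)) =
        r K / (K.factorial : ℂ) * E.chi K * (-2 * (u - K)) := by
      rw [h2]
      push_cast
      rw [show (K : ℂ) + 2 - 1 = K + 1 by ring]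
      field_simp
      linear_combination (-E.chi K * E.eps ^ 2) * hK - 4 * E.chi K * r K * (u - K) * E.eps_mul_self
    rw [smul_sub, smul_smul, smul_smul, h5]
    module

section Bridge

variable {Y : Type*} [Ring Y] [Algebra ℂ Y] {𝒴 : ZMod 2 → Submodule ℂ Y} [GradedAlgebra 𝒴]

variable (E 𝒴) in
/-- The embedding of the two oscillator algebras. -/
abbrev inOsc : E.Osc2 →ₐ[ℂ] E.Osc2Y 𝒴 := GradedTensorProduct.includeLeft E.osc2Grading 𝒴

variable (E 𝒴) in
/-- The embedding of the algebra containing the generators of `osp`. -/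
abbrev inGen : Y →ₐ[ℂ] E.Osc2Y 𝒴 := GradedTensorProduct.includeRight E.osc2Grading 𝒴

theorem inOsc_mul_inGen (z : E.Osc2) (w : Y) :
    E.inOsc 𝒴 z * E.inGen 𝒴 w = (z ᵍ⊗ₜ[ℂ] w : E.Osc2Y 𝒴) :=
  GradedTensorProduct.tmul_one_mul_one_tmul ..

theorem leg_c_mem (i : Fin 2) (a : Idx N M) : E.leg i (E.c a) ∈ E.osc2Grading (deg a) := by
  rw [mem_parityGrading]
  fin_cases i
  · change tensorParity _ _ (E.leg 0 (E.c a)) = sgn (deg a) • E.leg 0 (E.c a)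
    rw [← map_smul, leg_zero, leg_zero, tensorParity_tmul, map_one, oscParity_c]
  · change tensorParity _ _ (E.leg 1 (E.c a)) = sgn (deg a) • E.leg 1 (E.c a)
    rw [← map_smul, leg_one, leg_one, tensorParity_tmul, map_one, oscParity_c]

variable {G : Idx N M → Idx N M → Y}

theorem IsOspGenerators.superCommutes (hG : E.IsOspGenerators 𝒴 G) (i : Fin 2) :
    SuperCommutes (fun a b => E.inGen 𝒴 (twistG G a b)) fun a => E.inOsc 𝒴 (E.leg i (E.c a)) := by
  intro a b c
  have hm : twistG G b c ∈ 𝒴 (deg b + deg c) := Submodule.smul_mem _ _ (hG.homogeneous b c)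
  have h := tmul_mul_tmul E.osc2Grading 𝒴 (leg_c_mem i a) hm 1 1
  rw [one_mul, mul_one, mul_comm (deg b + deg c), sgn_mul_add,
    ← inOsc_mul_inGen (E.leg i (E.c a)) (twistG G b c)] at h
  exact h

theorem symProd_pair (a b : Idx N M) :
    E.symProd ![a, b] = E.c a * E.c b - (1 / 2 * E.up a b) • (1 : E.Osc) := by
  have h0 : E.symProd (![] : Fin 0 → Idx N M) = 1 := E.symProd_eq_nested _
  have h1 : E.symProd ![b] = E.c b := by
    have h := E.symProd_cons b ![]
    rw [h0, qprod, Finset.univ_eq_empty, Finset.prod_empty, one_smul, mul_one, one_mul] at h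
    exact h.trans (by module)
  have h2 := E.symProd_cons a ![b]
  have h3 : E.qprod a ![b] = E.q a b := by simp [qprod]
  rw [h1, h3] at h2
  refine h2.trans ?_
  have h4 := E.c_mul_c a b
  linear_combination (norm := module) (-(1 / 2 : ℂ)) • h4

/-- The sign in F^{ab} is the one absorbed by `twistG`, and the constant in c^{(a} c^{b)} contracts
to the vanishing trace. -/
theorem L_eq (hg : E.IsOspFamily (twistG G)) (i : Fin 2) (u : ℂ) :
    E.L 𝒴 G i u = u • (1 : E.Osc2Y 𝒴) - (1 / 2 : ℂ) • E.eps •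
      bil (fun a => E.inOsc 𝒴 (E.leg i (E.c a))) (fun a => E.inOsc 𝒴 (E.leg i (E.c a)))
        fun a b => E.inGen 𝒴 (twistG G a b) := by
  have hterm : ∀ a b, ((E.leg i (E.F a b)) ᵍ⊗ₜ[ℂ] (G b a) : E.Osc2Y 𝒴) =
      E.eps • (E.inOsc 𝒴 (E.leg i (E.c a)) * E.inOsc 𝒴 (E.leg i (E.c b)) *
        E.inGen 𝒴 (twistG G b a)) -
      (1 / 2 * E.eps) • E.inGen 𝒴 (E.up a b • twistG G b a) := by
    intro a b
    rw [← inOsc_mul_inGen, F, symProd_pair, twistG]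
    simp only [map_smul, map_sub, map_mul, map_one, smul_mul_assoc, mul_smul_comm, sub_mul, one_mul]
    module
  have htr := congrArg (E.inGen 𝒴) hg.trace
  rw [map_zero] at htr
  simp only [map_sum] at htr
  rw [L, bil]
  simp only [hterm, Finset.sum_sub_distrib, ← Finset.smul_sum, htr, smul_zero, sub_zero]

theorem inOsc_mul_mem_filtration {k l d : ℕ} {j : ZMod 2} (hd : d ≤ k + l) {z : E.Osc2}
    (hz : z ∈ E.monSpan k l j) (w : Y) : E.inOsc 𝒴 z * E.inGen 𝒴 w ∈ E.filtration 𝒴 d := by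
  induction hz using Submodule.span_induction with
  | mem z hz =>
    obtain ⟨a, b, -, rfl⟩ := hz
    exact Submodule.subset_span ⟨k, l, a, b, w, hd, inOsc_mul_inGen _ _⟩
  | zero =>
    rw [map_zero, zero_mul]
    exact zero_mem _
  | add x y _ _ hx hy =>
    rw [map_add, add_mul]
    exact Submodule.add_mem _ hx hy
  | smul c x _ hx =>
    rw [map_smul, smul_mul_assoc]
    exact Submodule.smul_mem _ _ hx

theorem twDiff_mem_filtration {k d : ℕ} (hd : d ≤ k) :
    E.twDiff (fun a b => E.inGen 𝒴 (twistG G a b)) (fun a => E.inOsc 𝒴 (E.leg 0 (E.c a)))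
      (fun a => E.inOsc 𝒴 (E.leg 1 (E.c a))) k ∈ E.filtration 𝒴 d := by
  rw [twDiff, twBil, twBil, ← map_contract, ← firstInv]
  refine Submodule.smul_mem _ _ (Submodule.sub_mem _ ?_ ?_)
  · refine Submodule.sum_mem _ fun a _ => Submodule.sum_mem _ fun b _ => ?_
    rw [← map_twSum₂ (E.inOsc 𝒴) E.firstInv fun a => E.leg 1 (E.c a)]
    exact inOsc_mul_mem_filtration (by omega) (E.twSum₂_right_mem k a b) _
  · refine Submodule.sum_mem _ fun a _ => Submodule.sum_mem _ fun b _ => ?_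
    rw [← map_twSum₂ (E.inOsc 𝒴) E.firstInv fun a => E.leg 0 (E.c a)]
    exact inOsc_mul_mem_filtration (by omega) (E.twSum₂_left_mem k a b) _

theorem inOsc_Rsum (r : ℕ → ℂ) (K : ℕ) :
    E.inOsc 𝒴 (E.Rsum r K) = ∑ k ∈ Finset.range K, (r k / (k.factorial : ℂ) * E.chi k) •
      invPoly E.eps E.omega (E.contract (fun a => E.inOsc 𝒴 (E.leg 0 (E.c a)))
        fun a => E.inOsc 𝒴 (E.leg 1 (E.c a))) k := by
  rw [← map_contract, ← firstInv, Rsum, map_sum]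
  refine Finset.sum_congr rfl fun k _ => ?_
  rw [invariant_eq, smul_smul, map_smul, map_invPoly]

theorem spinorialRLL (hG : E.IsOspGenerators 𝒴 G) (hGG : E.SymAnticommVanishes G) {u : ℂ}
    {r : ℕ → ℂ} (hr : Recurrence E.omega u r) (v : ℂ) : E.SpinorialRLL 𝒴 G r u v := by
  have hg := hG.isOspFamily hGG
  have hg' := hg.map (E.inGen 𝒴)
  have hp := E.isOscPair_leg.map (E.inOsc 𝒴)
  have hx := hG.superCommutes 0
  have hy := hG.superCommutes 1
  have hc := hp.commute_add hg' hx hy rfl rfl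
  have hdef := hp.defect_eq hg' hx hy rfl rfl u
  have hL₀ := fun w => L_eq (𝒴 := 𝒴) hg 0 w
  have hL₁ := fun w => L_eq (𝒴 := 𝒴) hg 1 w
  intro d
  -- Telescoping leaves the last two indices K - 2 and K - 1, both at least d.
  refine ⟨d + 2, fun K hK => ?_⟩
  obtain ⟨K, rfl⟩ := Nat.exists_eq_add_of_le' (le_trans (Nat.le_add_left 2 d) hK)
  have hR : ((E.Rsum r (K + 2)) ᵍ⊗ₜ[ℂ] (1 : Y) : E.Osc2Y 𝒴) = E.inOsc 𝒴 (E.Rsum r (K + 2)) := rfl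
  have hT := fun k (hk : d ≤ k) => twDiff_mem_filtration (E := E) (𝒴 := 𝒴) (G := G) hk
  simp only [hL₀, hL₁, hR, inOsc_Rsum]
  generalize E.eps • bil (fun a => E.inOsc 𝒴 (E.leg 0 (E.c a)))
    (fun a => E.inOsc 𝒴 (E.leg 0 (E.c a))) (fun a b => E.inGen 𝒴 (twistG G a b)) = X₁ at *
  generalize E.eps • bil (fun a => E.inOsc 𝒴 (E.leg 1 (E.c a)))
    (fun a => E.inOsc 𝒴 (E.leg 1 (E.c a))) (fun a b => E.inGen 𝒴 (twistG G a b)) = X₂ at *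
  generalize E.twDiff (fun a b => E.inGen 𝒴 (twistG G a b))
    (fun a => E.inOsc 𝒴 (E.leg 0 (E.c a))) (fun a => E.inOsc 𝒴 (E.leg 1 (E.c a))) = T at *
  generalize E.contract (fun a => E.inOsc 𝒴 (E.leg 0 (E.c a)))
    (fun a => E.inOsc 𝒴 (E.leg 1 (E.c a))) = s at *
  rw [rll_difference]
  · have hsum : ∀ Z : ℕ → E.Osc2Y 𝒴, (∑ k ∈ Finset.range (K + 2), Z k) * (X₁ * X₂) -
        X₁ * X₂ * (∑ k ∈ Finset.range (K + 2), Z k) -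
        u • ((∑ k ∈ Finset.range (K + 2), Z k) * (X₂ - X₁) +
          (X₂ - X₁) * (∑ k ∈ Finset.range (K + 2), Z k)) =
        ∑ k ∈ Finset.range (K + 2), (Z k * (X₁ * X₂) - X₁ * X₂ * Z k -
          u • (Z k * (X₂ - X₁) + (X₂ - X₁) * Z k)) := by
      intro Z
      simp only [Finset.sum_mul, Finset.mul_sum, ← Finset.sum_sub_distrib,
        ← Finset.sum_add_distrib, Finset.smul_sum]
    have hone : ∀ (c : ℂ) (k : ℕ), c • invPoly E.eps E.omega s k * (X₁ * X₂) -
        X₁ * X₂ * c • invPoly E.eps E.omega s k -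
        u • (c • invPoly E.eps E.omega s k * (X₂ - X₁) +
          (X₂ - X₁) * c • invPoly E.eps E.omega s k) =
        c • ((-2 * (u - k)) • T k -
          (1 / 2 * E.eps * k * (k - 1) * (k + u - E.omega)) • T (k - 2)) := by
      intro c k
      rw [← hdef]
      simp only [smul_mul_assoc, mul_smul_comm]
      module
    rw [hsum]
    simp only [hone]
    rw [sum_telescope hr]
    exact Submodule.smul_mem _ _ (Submodule.add_mem _
      (Submodule.smul_mem _ _ (hT _ (by omega))) (Submodule.smul_mem _ _ (hT _ (by omega))))
  · exact Commute.sum_left _ _ _ fun k _ =>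
      ((commute_invPoly E.eps E.omega hc k).symm).smul_left _

end Bridge

end SuperMetric

/-! ### Solving the recurrence with Gamma functions -/

section GammaSequences

/-- The sequence `(-4)^m Γ(m - x) / Γ(m + 1 + y)`. -/
def gammaSeq (x y : ℂ) (m : ℕ) : ℂ :=
  (-4) ^ m * (Complex.Gamma (m - x) / Complex.Gamma (m + 1 + y))

/-- Only the numerator requires x ≠ m; the functional equation of 1/Γ holds at the poles too. -/
theorem gammaSeq_succ {x : ℂ} (y : ℂ) {m : ℕ} (hx : x ≠ m) :
    (m + 1 + y) * gammaSeq x y (m + 1) = -4 * (m - x) * gammaSeq x y m := by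
  have h1 : Complex.Gamma ((m + 1 : ℕ) - x) = (m - x) * Complex.Gamma (m - x) := by
    rw [← Complex.Gamma_add_one _ (sub_ne_zero.2 hx.symm)]
    congr 1
    push_cast
    ring
  have h2 := Complex.one_div_Gamma_eq_self_mul_one_div_Gamma_add_one ((m : ℂ) + 1 + y)
  have h3 : ((m + 1 : ℕ) : ℂ) + 1 + y = (m : ℂ) + 1 + y + 1 := by
    push_cast
    ring
  rw [gammaSeq, gammaSeq, h1, h3, pow_succ]
  linear_combination ((-4) ^ m * 4 * (m - x) * Complex.Gamma (m - x)) * h2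

/-- Matching at one large index n suffices: beyond n the coefficient on the left never vanishes, and
the coefficient on the right never vanishes at all, so the difference propagates as zero upwards and
downwards. Normalising at 0 could fail, as the left coefficient may have a zero. -/
theorem eq_smul_gammaSeq {x y : ℂ} (hx : ∀ m : ℕ, x ≠ m) {R : ℕ → ℂ}
    (hR : ∀ m : ℕ, (m + 1 + y) * R (m + 1) = -4 * (m - x) * R m) :
    ∃ α : ℂ, ∀ m, R m = gammaSeq x y m * α := by
  -- From n on, m + 1 + y has positive real part, so it is non-zero and not a pole of Γ.
  obtain ⟨n, hn⟩ := exists_nat_gt (-y.re)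
  have hre : ∀ m : ℕ, n ≤ m → 0 < ((m : ℂ) + 1 + y).re := by
    intro m hm
    have h : (n : ℝ) ≤ m := Nat.cast_le.2 hm
    simp only [Complex.add_re, Complex.natCast_re, Complex.one_re]
    linarith
  have hne : gammaSeq x y n ≠ 0 := by
    refine mul_ne_zero (pow_ne_zero _ (by norm_num)) (div_ne_zero ?_ ?_)
    · refine Complex.Gamma_ne_zero fun m hm => hx (n + m) ?_
      push_cast
      linear_combination -hm
    · exact Complex.Gamma_ne_zero_of_re_pos (hre n le_rfl)
  set D : ℕ → ℂ := fun m => R m - gammaSeq x y m * (R n / gammaSeq x y n) with hD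
  have hrec : ∀ m : ℕ, (m + 1 + y) * D (m + 1) = -4 * (m - x) * D m := by
    intro m
    simp only [hD]
    linear_combination hR m - (R n / gammaSeq x y n) * gammaSeq_succ y (hx m)
  have h0 : D n = 0 := by
    simp only [hD]
    rw [mul_div_cancel₀ _ hne, sub_self]
  have hup : ∀ j, D (n + j) = 0 := by
    intro j
    induction j with
    | zero => exact h0
    | succ j ih =>
      have h := hrec (n + j)
      rw [ih, mul_zero] at h
      refine (mul_eq_zero.1 h).resolve_left fun h' => ?_
      have h'' := hre (n + j) (Nat.le_add_right _ _)
      rw [h'] at h''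
      exact lt_irrefl _ h''
  have hdown : ∀ j, j ≤ n → D (n - j) = 0 := by
    intro j
    induction j with
    | zero => exact fun _ => h0
    | succ j ih =>
      intro hj
      have h := hrec (n - (j + 1))
      rw [show n - (j + 1) + 1 = n - j by omega, ih (by omega), mul_zero, eq_comm] at h
      exact (mul_eq_zero.1 h).resolve_left
        (mul_ne_zero (by norm_num) (sub_ne_zero.2 (hx _).symm))
  refine ⟨R n / gammaSeq x y n, fun m => sub_eq_zero.1 ?_⟩
  rcases le_total n m with hm | hm
  · obtain ⟨j, rfl⟩ := Nat.exists_eq_add_of_le hm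
    exact hup j
  · have h := hdown (n - m) (Nat.sub_le _ _)
    rwa [Nat.sub_sub_self hm] at h

theorem gammaCoeff_even (ω u α β : ℂ) (m : ℕ) :
    gammaCoeff ω u α β (2 * m) = gammaSeq (u / 2) ((u - ω) / 2) m * α := by
  rw [gammaCoeff, if_pos (even_two_mul m), Nat.mul_div_cancel_left m two_pos, gammaSeq]

theorem gammaCoeff_odd (ω u α β : ℂ) (m : ℕ) :
    gammaCoeff ω u α β (2 * m + 1) = gammaSeq ((u - 1) / 2) ((u - ω + 1) / 2) m * β := by
  rw [gammaCoeff, if_neg (Nat.not_even_two_mul_add_one m), show (2 * m + 1) / 2 = m by omega,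
    gammaSeq]

theorem recurrence_iff (ω u : ℂ) (r : ℕ → ℂ) :
    Recurrence ω u r ↔
      (∀ m : ℕ, (m + 1 + (u - ω) / 2) * r (2 * (m + 1)) = -4 * (m - u / 2) * r (2 * m)) ∧
      ∀ m : ℕ, (m + 1 + (u - ω + 1) / 2) * r (2 * (m + 1) + 1) =
        -4 * (m - (u - 1) / 2) * r (2 * m + 1) := by
  constructor
  · intro h
    refine ⟨fun m => ?_, fun m => ?_⟩
    · have h' := h (2 * m)
      rw [show 2 * m + 2 = 2 * (m + 1) by ring] at h'
      push_cast at h'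
      linear_combination (1 / 2 : ℂ) * h'
    · have h' := h (2 * m + 1)
      rw [show 2 * m + 1 + 2 = 2 * (m + 1) + 1 by ring] at h'
      push_cast at h'
      linear_combination (1 / 2 : ℂ) * h'
  · rintro ⟨he, ho⟩ k
    obtain ⟨m, rfl | rfl⟩ := Nat.even_or_odd' k
    · rw [show 2 * m + 2 = 2 * (m + 1) by ring]
      push_cast
      linear_combination 2 * he m
    · rw [show 2 * m + 1 + 2 = 2 * (m + 1) + 1 by ring]
      push_cast
      linear_combination 2 * ho m

theorem recurrence_gammaCoeff (ω : ℂ) {u α β : ℂ} (hα : α ≠ 0 → ∀ m : ℕ, u ≠ 2 * (m : ℂ))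
    (hβ : β ≠ 0 → ∀ m : ℕ, u ≠ 2 * (m : ℂ) + 1) : Recurrence ω u (gammaCoeff ω u α β) := by
  rw [recurrence_iff]
  simp only [gammaCoeff_even, gammaCoeff_odd]
  refine ⟨fun m => ?_, fun m => ?_⟩
  · rcases eq_or_ne α 0 with h | h
    · simp [h]
    · have hx : u / 2 ≠ m := fun hm => hα h m (by linear_combination 2 * hm)
      linear_combination α * gammaSeq_succ ((u - ω) / 2) hx
  · rcases eq_or_ne β 0 with h | h
    · simp [h]
    · have hx : (u - 1) / 2 ≠ m := fun hm => hβ h m (by linear_combination 2 * hm)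
      linear_combination β * gammaSeq_succ ((u - ω + 1) / 2) hx

theorem recurrence_iff_gammaCoeff (ω : ℂ) {u : ℂ} (hu : ∀ n : ℕ, u ≠ (n : ℂ)) (r : ℕ → ℂ) :
    Recurrence ω u r ↔ ∃ α β : ℂ, r = gammaCoeff ω u α β := by
  have h0 : ∀ m : ℕ, u ≠ 2 * (m : ℂ) := fun m h => hu (2 * m) (by push_cast; exact h)
  have h1 : ∀ m : ℕ, u ≠ 2 * (m : ℂ) + 1 := fun m h => hu (2 * m + 1) (by push_cast; exact h)
  constructor
  · intro hr
    obtain ⟨he, ho⟩ := (recurrence_iff ω u r).1 hr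
    obtain ⟨α, hα⟩ := eq_smul_gammaSeq (R := fun m => r (2 * m))
      (fun m hm => h0 m (by linear_combination 2 * hm)) he
    obtain ⟨β, hβ⟩ := eq_smul_gammaSeq (R := fun m => r (2 * m + 1))
      (fun m hm => h1 m (by linear_combination 2 * hm)) ho
    refine ⟨α, β, funext fun k => ?_⟩
    obtain ⟨m, rfl | rfl⟩ := Nat.even_or_odd' k
    · rw [gammaCoeff_even, ← hα]
    · rw [gammaCoeff_odd, ← hβ]
  · rintro ⟨α, β, rfl⟩
    exact recurrence_gammaCoeff ω (fun _ => h0) fun _ => h1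

end GammaSequences

end OSp

end

theorem proposition6 {N M : ℕ} {ϵ : ℤˣ} (E : OSp.SuperMetric N M ϵ)
    {Y : Type*} [Ring Y] [Algebra ℂ Y] (𝒴 : ZMod 2 → Submodule ℂ Y) [GradedAlgebra 𝒴]
    (G : OSp.Idx N M → OSp.Idx N M → Y)
    (hG : E.IsOspGenerators 𝒴 G) (hGG : E.SymAnticommVanishes G) :
    (∀ (A B : ℂ → ℂ) (u : ℂ),
      (A u ≠ 0 → ∀ m : ℕ, u ≠ 2 * (m : ℂ)) → (B u ≠ 0 → ∀ m : ℕ, u ≠ 2 * (m : ℂ) + 1) →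
        OSp.Recurrence E.omega u (OSp.gammaCoeff E.omega u (A u) (B u)) ∧
        ∀ v : ℂ, E.SpinorialRLL 𝒴 G (OSp.gammaCoeff E.omega u (A u) (B u)) u v) ∧
    (∀ (u : ℂ) (r : ℕ → ℂ), OSp.Recurrence E.omega u r →
      ∀ v : ℂ, E.SpinorialRLL 𝒴 G r u v) ∧
    (∀ u : ℂ, (∀ n : ℕ, u ≠ (n : ℂ)) → ∀ r : ℕ → ℂ,
      OSp.Recurrence E.omega u r ↔ ∃ α β : ℂ, r = OSp.gammaCoeff E.omega u α β) := by
  refine ⟨fun A B u hA hB => ?_, fun u r hr v => OSp.SuperMetric.spinorialRLL hG hGG hr v,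
    fun u hu r => OSp.recurrence_iff_gammaCoeff E.omega hu r⟩
  have hr := OSp.recurrence_gammaCoeff E.omega hA hB
  exact ⟨hr, fun v => OSp.SuperMetric.spinorialRLL hG hGG hr v⟩
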